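/- **Setting.** Signals are vector-valued functions on $\mathbb{R}$, $L_2$ is the space of square-integrable signals, $M^H$ is the conjugate transpose, and $\mathbb{O}_{>1}=\{q\in\mathbb{C}:|q|>1\}$. $\tilde{\mathbb H}_\infty$ is the set of matrix functions that are analytic and bounded on $\mathbb{O}_{>1}$. For $G\in\tilde{\mathbb H}_\infty$, $G(e^{j\Omega})$ denotes the radial limit $\lim_{r\downarrow 1}G(re^{j\Omega})$. *Plant.* Let $\mathcal P:(w,u)\mapsto(z,y)$ be given by a minimal (controllable and observable) realization with complex matrices, with $\dim y=\dim u=n_u$: $$x(t)=\int_{-\infty}^{t}e^{A(t-r)}\big(B_w w(r)+B_u u(r)\big)\,dr,\qquad z=C_zx+D_{uz}u,\qquad y=C_yx+D_{uy}u .$$ Say $\mathcal P\in\mathbb P$ if * $\mathcal P$ maps $L_2$ inputs to $L_2$ outputs, and there is $\gamma>0$ with $\|y\|_{L_2}^2+\|z\|_{L_2}^2\le\gamma^2(\|w\|_{L_2}^2+\|u\|_{L_2}^2)$ for all $w,u\in L_2$; and * the channel $u\mapsto y$ (with $w=0$) is passive: there is $\beta>0$ with $\int_{-\infty}^{\infty}(u^Hy+y^Hu)\,dt\ge-\beta$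 for all $u\in L_2$. Put $\hat P_{uy}(s)=C_y(sI-A)^{-1}B_u+D_{uy}$. *Feedback class.* For $\epsilon>0$, $\mathbb K_\epsilon$ is the set of causal linear time-invariant maps $\mathcal K:L_2\to L_2$, $y\mapsto -u$, on $\mathbb C^{n_u}$-valued signals, that are output strictly passive with parameter $\epsilon$: $$-\int_{-\infty}^{\infty}(u^Hy+y^Hu)\,dt-\epsilon\|u\|_{L_2}^2\ge 0\qquad\text{for all } y\in L_2 .$$ A controller is specified by its transfer function $\hat K$, an analytic $n_u\times n_u$ matrix function on some half-plane $\operatorname{Re}s>\sigma_0$ with $\sigma_0\ge0$. We write $\mathcal K\in\mathbb K_\epsilon$ if some member of $\mathbb K_\epsilon$ has the transfer function $\hat K$ there, i.e. the Laplace transform of its response to any $L_2$ input supported in $[0,\infty)$ equals $\hat K(s)$ times that of the input for $\operatorname{Re}s>\sigma_0$. *Bilinear transformation.* For $\tau>0$ let $s(q)=\frac1{2\tau}\frac{q-1}{q+1}$, $\tilde P_{uy}(q)=\hat P_{uy}(s(q))$ and $\tilde K(q)=\hat K(s(q))$. The Youla parameter of $\hat K$ is $$\tilde Q=\tilde K\,[I+\tilde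 P_{uy}\tilde K]^{-1}.$$ "$\tilde Q\in\tilde{\mathbb H}_\infty$" means that $I+\tilde P_{uy}\tilde K$ is invertible at every $q\in\mathbb{O}_{>1}$ with $\operatorname{Re}s(q)>\sigma_0$, and that $\tilde Q$, defined there by this formula, extends to a function in $\tilde{\mathbb H}_\infty$, again called $\tilde Q$. **Theorem.** Let $\mathcal P\in\mathbb P$ and $\epsilon,\tau>0$. There is a function $\tilde F$ with $\tilde F,\tilde F^{-1}\in\tilde{\mathbb H}_\infty$ and $$[\tilde P_{uy}(e^{j\Omega})+\tilde P_{uy}(e^{j\Omega})^H+\epsilon I]^{-1}=\tilde F(e^{j\Omega})^H+\tilde F(e^{j\Omega})\quad\text{for almost every }\Omega\in[-\pi,\pi].$$ For every such $\tilde F$ the following hold. 1. For every $\sigma_0\ge 0$ and every $\hat K$ as above, $\mathcal K\in\mathbb K_\epsilon$ if and only if $\tilde Q\in\tilde{\mathbb H}_\infty$ and $$\tilde U=\begin{bmatrix}\tilde Q&\tilde Q\\0&\tilde F\end{bmatrix}\quad\text{satisfies}\quad \tilde U(e^{j\Omega})+\tilde U(e^{j\Omega})^H\succeq0\ \text{ for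 almost every }\Omega\in[-\pi,\pi].$$ 2. The set of all $\tilde Q\in\tilde{\mathbb H}_\infty$ satisfying this constraint is convex. -/

import Mathlib

open MeasureTheory Filter Topology Matrix
open scoped ComplexOrder

noncomputable section

namespace PassiveYoula

/-- Vector signals on the time axis. -/
abbrev Signal (n : ℕ) := ℝ → EuclideanSpace ℂ (Fin n)

/-- Square-integrable vector signals on the whole time axis, up to a.e. equality. -/
abbrev L2Signal (n : ℕ) := Lp (EuclideanSpace ℂ (Fin n)) 2 (volume : Measure ℝ)

/-- Matrix acting on Euclidean vectors. -/
def act {m n : ℕ} (M : Matrix (Fin m) (Fin n) ℂ) (v : EuclideanSpace ℂ (Fin n)) :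
    EuclideanSpace ℂ (Fin m) :=
  WithLp.toLp 2 (M *ᵥ v.ofLp)

/-! ### The plant -/

/-- State-space data of a plant `(w, u) ↦ (z, y)` which is strictly proper from `w`. -/
structure Plant (nP nw nu nz : ℕ) where
  A : Matrix (Fin nP) (Fin nP) ℂ
  Bw : Matrix (Fin nP) (Fin nw) ℂ
  Bu : Matrix (Fin nP) (Fin nu) ℂ
  Cz : Matrix (Fin nz) (Fin nP) ℂ
  Cy : Matrix (Fin nu) (Fin nP) ℂ
  Duz : Matrix (Fin nz) (Fin nu) ℂ
  Duy : Matrix (Fin nu) (Fin nu) ℂ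

namespace Plant

variable {nP nw nu nz : ℕ} (P : Plant nP nw nu nz)

/-- The realization is minimal: controllable from `(w, u)` and observable from `(z, y)`. -/
def IsMinimal : Prop :=
  (∀ x : Fin nP → ℂ,
      (∀ k : ℕ, x ᵥ* (P.A ^ k * P.Bw) = 0 ∧ x ᵥ* (P.A ^ k * P.Bu) = 0) → x = 0) ∧
  (∀ x : Fin nP → ℂ,
      (∀ k : ℕ, (P.Cz * P.A ^ k) *ᵥ x = 0 ∧ (P.Cy * P.A ^ k) *ᵥ x = 0) → x = 0)

/-- The contribution at time `t` of the inputs at time `r`, namely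
`exp ((t - r) A) (B_w w(r) + B_u u(r))`. -/
def stateIntegrand (w : Signal nw) (u : Signal nu) (t r : ℝ) : EuclideanSpace ℂ (Fin nP) :=
  act (NormedSpace.exp (((t - r : ℝ) : ℂ) • P.A)) (act P.Bw (w r) + act P.Bu (u r))

/-- State response `x(t) = ∫_{-∞}^t exp ((t - r) A) (B_w w(r) + B_u u(r)) dr`. -/
def state (w : Signal nw) (u : Signal nu) : Signal nP :=
  fun t => ∫ r in Set.Iic t, P.stateIntegrand w u t r

/-- Performance output `z = C_z x + D_uz u`. -/
def outZ (w : Signal nw) (u : Signal nu) : Signal nz :=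
  fun t => act P.Cz (P.state w u t) + act P.Duz (u t)

/-- Measured output `y = C_y x + D_uy u`. -/
def outY (w : Signal nw) (u : Signal nu) : Signal nu :=
  fun t => act P.Cy (P.state w u t) + act P.Duy (u t)

/-- The plant maps `L₂` inputs to `L₂` outputs with a finite gain. -/
def BoundedL2Gain : Prop :=
  ∃ γ : ℝ, 0 < γ ∧ ∀ (w : Signal nw) (u : Signal nu),
    MemLp w 2 volume → MemLp u 2 volume →
      (∀ᵐ t : ℝ, IntegrableOn (P.stateIntegrand w u t) (Set.Iic t) volume) ∧
      MemLp (P.outZ w u) 2 volume ∧ MemLp (P.outY w u) 2 volume ∧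
      (∫ t, ‖P.outY w u t‖ ^ 2) + (∫ t, ‖P.outZ w u t‖ ^ 2) ≤
        γ ^ 2 * ((∫ t, ‖w t‖ ^ 2) + (∫ t, ‖u t‖ ^ 2))

/-- The channel `u ↦ y` (that is, with `w = 0`) is passive:
`∫ (u^H y + y^H u) dt ≥ -β` for all `u` in `L₂`. -/
def PassiveChannel : Prop :=
  ∃ β : ℝ, 0 < β ∧ ∀ u : Signal nu, MemLp u 2 volume →
    -β ≤ ∫ t, (inner ℂ (u t) (P.outY 0 u t) + inner ℂ (P.outY 0 u t) (u t)).re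

/-- The transfer function of the channel `u ↦ y`. -/
def tfUY (s : ℂ) : Matrix (Fin nu) (Fin nu) ℂ :=
  P.Cy * (s • (1 : Matrix (Fin nP) (Fin nP) ℂ) - P.A)⁻¹ * P.Bu + P.Duy

end Plant

/-- The class of plants: minimal realization, bounded `L₂` gain, passive channel `u ↦ y`. -/
def plantClass (nP nw nu nz : ℕ) : Set (Plant nP nw nu nz) :=
  {P | P.IsMinimal ∧ P.BoundedL2Gain ∧ P.PassiveChannel}

/-! ### Linear time-invariant mappings and the feedback class -/

/-- A causal linear time-invariant mapping of `L₂` signals on the time axis. -/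
structure LTIMap (m p : ℕ) where
  toLin : L2Signal m →ₗ[ℂ] L2Signal p
  causal : ∀ (T : ℝ) (f : L2Signal m),
    (∀ᵐ t : ℝ, t < T → f t = 0) → ∀ᵐ t : ℝ, t < T → toLin f t = 0
  timeInvariant : ∀ (T : ℝ) (f g : L2Signal m),
    (∀ᵐ t : ℝ, g t = f (t - T)) → ∀ᵐ t : ℝ, toLin g t = toLin f (t - T)

/-- Laplace transform of the part of a signal on the positive time axis. -/
def laplace {n : ℕ} (f : Signal n) (s : ℂ) : EuclideanSpace ℂ (Fin n) :=
  ∫ t in Set.Ioi (0 : ℝ), Complex.exp (-(s * t)) • f t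

/-- `H` is the transfer function of the mapping `S` on the half-plane `Re s > σ₀` (`σ₀ ≥ 0`):
the Laplace transform of the response to an input that starts at time zero is `H` times
the Laplace transform of the input. -/
def LTIMap.HasTransferFunction {m p : ℕ} (S : LTIMap m p) (σ₀ : ℝ)
    (H : ℂ → Matrix (Fin p) (Fin m) ℂ) : Prop :=
  ∀ f : L2Signal m, (∀ᵐ t : ℝ, t < 0 → f t = 0) →
    ∀ s : ℂ, σ₀ < s.re → laplace (S.toLin f) s = act (H s) (laplace f s)

/-- Output-strictly-passive feedback mappings `y ↦ -u` with parameter `ε`: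
`-∫ (u^H y + y^H u) dt - ε ‖u‖² ≥ 0` for all `y` in `L₂`. -/
def ospClass (n : ℕ) (ε : ℝ) : Set (LTIMap n n) :=
  {S | ∀ y u : L2Signal n, S.toLin y = -u →
    0 ≤ -(∫ t, (inner ℂ (u t) (y t) + inner ℂ (y t) (u t)).re) - ε * ‖u‖ ^ 2}

/-! ### Discrete-time transfer functions -/

/-- The map `q ↦ s`, inverse of the bilinear transformation `q = (1 + 2τs) / (1 - 2τs)`. -/
def sOfQ (τ : ℝ) (q : ℂ) : ℂ := 1 / (2 * (τ : ℂ)) * ((q - 1) / (q + 1))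

/-- The discrete-time transfer function obtained by the bilinear transformation. -/
def bilinear {m n : ℕ} (τ : ℝ) (H : ℂ → Matrix (Fin m) (Fin n) ℂ) :
    ℂ → Matrix (Fin m) (Fin n) ℂ :=
  fun q => H (sOfQ τ q)

/-- `H` is analytic on the half-plane `Re s > σ₀`. -/
def AnalyticOnHalfPlane {m n : ℕ} (σ₀ : ℝ) (H : ℂ → Matrix (Fin m) (Fin n) ℂ) : Prop :=
  ∀ i j, DifferentiableOn ℂ (fun s => H s i j) {s : ℂ | σ₀ < s.re}

/-- The discrete-time `H∞` space: analytic and bounded on `|q| > 1`. -/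
def HInf {m n : ℕ} (G : ℂ → Matrix (Fin m) (Fin n) ℂ) : Prop :=
  (∀ i j, DifferentiableOn ℂ (fun q => G q i j) {q : ℂ | 1 < ‖q‖}) ∧
  ∃ c : ℝ, ∀ q : ℂ, 1 < ‖q‖ → ∀ i j, ‖G q i j‖ ≤ c

/-- `M` is the boundary value `G(e^{iΩ})`, as a radial limit from `|q| > 1`. -/
def HasBoundaryValue {α β : Type} (G : ℂ → Matrix α β ℂ) (Ω : ℝ) (M : Matrix α β ℂ) : Prop :=
  Tendsto (fun r : ℝ => G ((r : ℂ) * Complex.exp (Ω * Complex.I))) (𝓝[>] 1) (𝓝 M)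

/-- `F` and `F⁻¹` are in `H∞` and `(P_uy + P_uy^H + ε I)⁻¹ = F^H + F` on the unit circle. -/
def IsSpectralSummand {nP nw nu nz : ℕ} (P : Plant nP nw nu nz) (ε τ : ℝ)
    (F : ℂ → Matrix (Fin nu) (Fin nu) ℂ) : Prop :=
  HInf F ∧ (∀ q : ℂ, 1 < ‖q‖ → IsUnit (F q).det) ∧ HInf (fun q => (F q)⁻¹) ∧
  ∀ᵐ Ω ∂(volume.restrict (Set.Icc (-Real.pi) Real.pi)),
    ∃ M, HasBoundaryValue F Ω M ∧
      (bilinear τ P.tfUY (Complex.exp (Ω * Complex.I)) +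
        (bilinear τ P.tfUY (Complex.exp (Ω * Complex.I)))ᴴ +
        (ε : ℂ) • (1 : Matrix (Fin nu) (Fin nu) ℂ))⁻¹ = Mᴴ + M

/-- `Q` is the Youla parameter of the feedback transfer function `K` (known on `Re s > σ₀`):
there `I + P_uy K` is invertible and `Q = K (I + P_uy K)⁻¹`. -/
def IsYoulaParameter {nP nw nu nz : ℕ} (P : Plant nP nw nu nz) (τ σ₀ : ℝ)
    (K Q : ℂ → Matrix (Fin nu) (Fin nu) ℂ) : Prop :=
  ∀ q : ℂ, 1 < ‖q‖ → σ₀ < (sOfQ τ q).re →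
    IsUnit (1 + bilinear τ P.tfUY q * bilinear τ K q).det ∧
    Q q = bilinear τ K q * (1 + bilinear τ P.tfUY q * bilinear τ K q)⁻¹

/-- The block transfer function `U = [[Q, Q], [0, F]]`. -/
def blockU {n : ℕ} (Q F : ℂ → Matrix (Fin n) (Fin n) ℂ) :
    ℂ → Matrix (Fin n ⊕ Fin n) (Fin n ⊕ Fin n) ℂ :=
  fun q => Matrix.fromBlocks (Q q) (Q q) 0 (F q)

/-- `U(e^{iΩ}) + U(e^{iΩ})^H ⪰ 0` on the unit circle; as usual for `H∞` functions, boundary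
values are radial limits and the inequality is meant for almost every `Ω`. -/
def YoulaConstraint {n : ℕ} (Q F : ℂ → Matrix (Fin n) (Fin n) ℂ) : Prop :=
  ∀ᵐ Ω ∂(volume.restrict (Set.Icc (-Real.pi) Real.pi)),
    ∃ M, HasBoundaryValue (blockU Q F) Ω M ∧ (M + Mᴴ).PosSemidef

end PassiveYoula

end

open PassiveYoula

/-!
The proof is carried by one quadratic inequality between matrices, `YoulaIneq P Q ε`, which says
`Q + Qᴴ ≥ Qᴴ (P + Pᴴ + ε) Q`. For `P = 0` it means that `1 - ε Q` is a contraction, that is, that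
`Q` is output strictly passive. Closing a feedback loop `H` around `Q` turns it into the same
inequality for `P + H` and `Q (1 + H Q)⁻¹`, as long as `P + H` is accretive
(`YoulaIneq.feedback`). With `H` the passive plant, passivity of the controller value `K` becomes
`YoulaIneq P Q ε` for its Youla parameter `Q = K (1 + P K)⁻¹`; the loop `-P` leads back. A Schur
complement together with `(P + Pᴴ + ε)⁻¹ = F + Fᴴ` shows that, at a point of the circle, the block
constraint on `[[Q, Q], [0, F]]` is `YoulaIneq P Q ε` (`posSemidef_block_iff`).

*The plant.* Minimality and finite gain make the state matrix stable (`isUnit_det_of_stable`), and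
passivity tested on truncated exponentials makes the transfer function `u ↦ y` accretive on the
right half-plane (`accretive_tfUY`). In the variable `z = q⁻¹` it is analytic on a neighbourhood
of the closed unit disc, including `z = -1`, the image of `s = ∞`.

*The spectral summand.* The function `(P + Pᴴ + ε)⁻¹` on the circle is real analytic, so its
Laurent series converges absolutely, and half of it gives `F`. The Hermitian part of `F` stays
bounded below inside the disc, so `F⁻¹` is bounded as well (`exists_isSpectralSummand`).

*From controller to constraint.* A member of the feedback class has a transfer function on the
whole open right half-plane, where it satisfies the passivity inequality pointwise, as one sees by
testing with the reproducing kernels of the Laplace transform (`exists_transfer_of_mem_ospClass`).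
After closing the loop, `Q` is bounded and analytic on `|q| > 1`, has radial limits almost
everywhere by Fatou's theorem (`exists_radial_limit`), and the inequality passes to the limit.

*From constraint to controller.* The boundary inequality has to be brought inside the domain. The
maximum principle applies to norm bounds only, so the loop `c - P` with a large constant `c` is
closed first: for the constant plant `c` the inequality is a norm bound, and opening the loop
again yields `YoulaIneq P Q ε` at every `|q| > 1` (`youlaIneq_of_boundary`). Hence
`K = Q (1 - P Q)⁻¹` extends to `|q| > 1` with `Θ = 1 - ε K` contractive there. It remains to find a causal
time-invariant contraction on `L²` with transfer function `Θ` (`exists_contraction_of_symbol`).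
Multiplication by `z = (a - s) / (a + s)` is realized by an isometry, the all-pass operator; a
power series in it with matrix coefficients is contractive by von Neumann's inequality
(`norm_series_isometry_le`), and `Θ` itself is reached by a weak limit of dilations.

The set of admissible `Q` is convex because the constraint is affine in `Q`.
-/

section Development

open scoped MatrixOrder Matrix.Norms.L2Operator

open PassiveYoula

namespace PassiveYoula

/-! ### Matrices acting on Euclidean vectors -/

section Act

variable {k m n : ℕ}

/-- The action of a matrix on Euclidean vectors as a continuous linear map. -/
noncomputable def actL (M : Matrix (Fin m) (Fin n) ℂ) :
    EuclideanSpace ℂ (Fin n) →L[ℂ] EuclideanSpace ℂ (Fin m) :=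
  LinearMap.toContinuousLinearMap
    { toFun := act M
      map_add' := fun x y => by simp [act, Matrix.mulVec_add]
      map_smul' := fun c x => by simp [act, Matrix.mulVec_smul] }

lemma actL_apply (M : Matrix (Fin m) (Fin n) ℂ) (v : EuclideanSpace ℂ (Fin n)) :
    actL M v = act M v := rfl

lemma act_coord (M : Matrix (Fin m) (Fin n) ℂ) (v : EuclideanSpace ℂ (Fin n)) (i : Fin m) :
    act M v i = ∑ j, M i j * v j := rfl

lemma act_add (M : Matrix (Fin m) (Fin n) ℂ) (x y : EuclideanSpace ℂ (Fin n)) :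
    act M (x + y) = act M x + act M y := (actL M).map_add x y

lemma act_smul (M : Matrix (Fin m) (Fin n) ℂ) (c : ℂ) (x : EuclideanSpace ℂ (Fin n)) :
    act M (c • x) = c • act M x := (actL M).map_smul c x

@[simp] lemma act_zero (M : Matrix (Fin m) (Fin n) ℂ) :
    act M (0 : EuclideanSpace ℂ (Fin n)) = 0 := (actL M).map_zero

lemma add_act (M N : Matrix (Fin m) (Fin n) ℂ) (x : EuclideanSpace ℂ (Fin n)) :
    act (M + N) x = act M x + act N x := by simp [act, Matrix.add_mulVec]

lemma sub_act (M N : Matrix (Fin m) (Fin n) ℂ) (x : EuclideanSpace ℂ (Fin n)) :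
    act (M - N) x = act M x - act N x := by simp [act, Matrix.sub_mulVec]

lemma smul_act (c : ℂ) (M : Matrix (Fin m) (Fin n) ℂ) (x : EuclideanSpace ℂ (Fin n)) :
    act (c • M) x = c • act M x := by simp [act, Matrix.smul_mulVec]

@[simp] lemma one_act (x : EuclideanSpace ℂ (Fin n)) :
    act (1 : Matrix (Fin n) (Fin n) ℂ) x = x := by simp [act]

@[simp] lemma zero_act (x : EuclideanSpace ℂ (Fin n)) :
    act (0 : Matrix (Fin m) (Fin n) ℂ) x = 0 := by simp [act]

lemma mul_act (M : Matrix (Fin m) (Fin n) ℂ) (N : Matrix (Fin n) (Fin k) ℂ)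
    (x : EuclideanSpace ℂ (Fin k)) : act (M * N) x = act M (act N x) := by
  simp [act, Matrix.mulVec_mulVec]

lemma inner_act_left (M : Matrix (Fin m) (Fin n) ℂ) (x : EuclideanSpace ℂ (Fin n))
    (y : EuclideanSpace ℂ (Fin m)) : inner ℂ (act M x) y = inner ℂ x (act Mᴴ y) := by
  simp only [PiLp.inner_apply, act_coord, RCLike.inner_apply, map_sum, map_mul,
    Matrix.conjTranspose_apply, Finset.mul_sum, Finset.sum_mul]
  rw [Finset.sum_comm]
  refine Finset.sum_congr rfl fun i _ => Finset.sum_congr rfl fun j _ => ?_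
  simp only [RCLike.star_def]; ring

lemma inner_act_right (M : Matrix (Fin m) (Fin n) ℂ) (x : EuclideanSpace ℂ (Fin m))
    (y : EuclideanSpace ℂ (Fin n)) : inner ℂ x (act M y) = inner ℂ (act Mᴴ x) y := by
  rw [inner_act_left, Matrix.conjTranspose_conjTranspose]

/-- Testing a matrix on basis vectors recovers its entries. -/
lemma act_single (M : Matrix (Fin m) (Fin n) ℂ) (i : Fin m) (j : Fin n) :
    act M (EuclideanSpace.single j 1) i = M i j := by
  rw [act_coord, Finset.sum_eq_single j] <;> simp +contextual

lemma norm_entry_le {M : Matrix (Fin m) (Fin n) ℂ} {c : ℝ} (h : ∀ x, ‖act M x‖ ≤ c * ‖x‖)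
    (i : Fin m) (j : Fin n) : ‖M i j‖ ≤ c := by
  have h1 := h (EuclideanSpace.single j 1)
  rw [← act_single M i j]
  refine (PiLp.norm_apply_le _ i).trans (h1.trans (by simp))

/-- A bound on the entries of a matrix gives a bound on its operator norm. -/
lemma norm_act_le {M : Matrix (Fin m) (Fin n) ℂ} {c : ℝ} (h : ∀ i j, ‖M i j‖ ≤ c)
    (x : EuclideanSpace ℂ (Fin n)) : ‖act M x‖ ≤ (m * n * c) * ‖x‖ := by
  have h0 : act M x = ∑ i, EuclideanSpace.single i (act M x i) := by
    ext i; simp [Finset.sum_apply, Pi.single_apply]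
  rw [h0]
  refine (norm_sum_le _ _).trans ?_
  have : ∀ i ∈ (Finset.univ : Finset (Fin m)),
      ‖EuclideanSpace.single i (act M x i)‖ ≤ n * c * ‖x‖ := by
    intro i _
    rw [PiLp.norm_single, act_coord]
    refine (norm_sum_le _ _).trans ?_
    refine (Finset.sum_le_sum (g := fun _ => c * ‖x‖) fun j _ => ?_).trans (by simp [mul_assoc])
    rw [norm_mul]
    exact mul_le_mul (h i j) (PiLp.norm_apply_le _ j) (norm_nonneg _)
      ((norm_nonneg _).trans (h i j))
  refine (Finset.sum_le_sum this).trans (by simp [mul_assoc])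

lemma isUnit_det_of_act {M : Matrix (Fin n) (Fin n) ℂ} (h : ∀ x, act M x = 0 → x = 0) :
    IsUnit M.det := by
  rw [isUnit_iff_ne_zero]
  intro h0
  obtain ⟨v, hv, hv0⟩ := Matrix.exists_mulVec_eq_zero_iff.mpr h0
  apply hv
  have := h (WithLp.toLp 2 v) (by simp [act, hv0])
  simpa using congrArg WithLp.ofLp this

lemma tendsto_act {α : Type*} {l : Filter α} {f : α → Matrix (Fin m) (Fin n) ℂ}
    {M : Matrix (Fin m) (Fin n) ℂ} (h : Tendsto f l (𝓝 M)) (x : EuclideanSpace ℂ (Fin n)) :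
    Tendsto (fun a => act (f a) x) l (𝓝 (act M x)) := by
  have : Continuous fun N : Matrix (Fin m) (Fin n) ℂ => act N x := by
    unfold act
    exact (PiLp.continuous_toLp 2 _).comp (continuous_id.matrix_mulVec continuous_const)
  exact (this.tendsto M).comp h

end Act

/-! ### The feedback transformation of a passivity inequality -/

section Feedback

variable {n : ℕ}

/-- The inequality `Q + Qᴴ ≥ Qᴴ (P + Pᴴ + ε) Q` between quadratic forms. For `P = 0` it says that
`Q` is output strictly passive, equivalently that `1 - ε Q` is a contraction; for the plant `P` it
is what output strict passivity of `K` means for `Q = K (1 + P K)⁻¹`. -/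
def YoulaIneq (P Q : Matrix (Fin n) (Fin n) ℂ) (ε : ℝ) : Prop :=
  ∀ a : EuclideanSpace ℂ (Fin n),
    ε * ‖act Q a‖ ^ 2 + 2 * (inner ℂ (act Q a) (act P (act Q a))).re ≤
      2 * (inner ℂ a (act Q a)).re

/-- The Hermitian part of `P` is positive semidefinite. -/
def Accretive (P : Matrix (Fin n) (Fin n) ℂ) : Prop :=
  ∀ v : EuclideanSpace ℂ (Fin n), 0 ≤ (inner ℂ v (act P v)).re

lemma inner_re_comm (x y : EuclideanSpace ℂ (Fin n)) : (inner ℂ x y).re = (inner ℂ y x).re := by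
  rw [← inner_conj_symm x y, Complex.conj_re]

lemma inner_self_re_eq (x : EuclideanSpace ℂ (Fin n)) : (inner ℂ x x).re = ‖x‖ ^ 2 := by
  rw [inner_self_eq_norm_sq_to_K]; norm_cast

/-- The substitution `a = b - H u`, `u = Q a`: feeding `H` back around `Q` adds `H` to `P`. -/
lemma YoulaIneq.feedback {P Q H : Matrix (Fin n) (Fin n) ℂ} {ε : ℝ} (h : YoulaIneq P Q ε)
    (hε : 0 < ε) (hPH : Accretive (P + H)) :
    IsUnit (1 + H * Q).det ∧ YoulaIneq (P + H) (Q * (1 + H * Q)⁻¹) ε := by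
  have hu : IsUnit (1 + H * Q).det := by
    refine isUnit_det_of_act fun a ha => ?_
    have h1 := h a
    have h2 := hPH (act Q a)
    rw [add_act, one_act, mul_act] at ha
    have h3 : a = -act H (act Q a) := eq_neg_of_add_eq_zero_left ha
    have h5 : (inner ℂ a (act Q a)).re = -(inner ℂ (act Q a) (act H (act Q a))).re := by
      rw [inner_re_comm]; nth_rw 2 [h3]; rw [inner_neg_right, Complex.neg_re]
    rw [add_act, inner_add_right, Complex.add_re] at h2
    have h4 : ‖act Q a‖ ^ 2 ≤ 0 := by
      rw [h5] at h1; nlinarith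
    have h6 : act Q a = 0 := by
      rw [← norm_eq_zero]; exact pow_eq_zero_iff two_ne_zero |>.mp (le_antisymm h4 (sq_nonneg _))
    rw [h3, h6]; simp
  refine ⟨hu, fun b => ?_⟩
  set a := act (1 + H * Q)⁻¹ b with ha
  have hb : b = a + act H (act Q a) := by
    have : act ((1 + H * Q) * (1 + H * Q)⁻¹) b = b := by
      rw [Matrix.mul_nonsing_inv _ hu, one_act]
    rw [mul_act, ← ha, add_act, one_act, mul_act] at this
    exact this.symm
  have h1 := h a
  rw [mul_act, ← ha, add_act, inner_add_right, Complex.add_re]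
  have : (inner ℂ b (act Q a)).re =
      (inner ℂ a (act Q a)).re + (inner ℂ (act Q a) (act H (act Q a))).re := by
    rw [inner_re_comm, hb, inner_add_right, Complex.add_re, inner_re_comm a]
  rw [this]; linarith

lemma feedback_one_sub {Q H : Matrix (Fin n) (Fin n) ℂ} (hu : IsUnit (1 + H * Q).det) :
    1 - H * (Q * (1 + H * Q)⁻¹) = (1 + H * Q)⁻¹ := by
  have h := Matrix.mul_nonsing_inv _ hu
  rw [add_mul, one_mul, Matrix.mul_assoc] at h
  exact sub_eq_of_eq_add h.symm

/-- Feedback by `-H` undoes feedback by `H`. -/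
lemma feedback_feedback_neg {Q H : Matrix (Fin n) (Fin n) ℂ} (hu : IsUnit (1 + H * Q).det) :
    (Q * (1 + H * Q)⁻¹) * (1 + -H * (Q * (1 + H * Q)⁻¹))⁻¹ = Q := by
  have h : 1 + -H * (Q * (1 + H * Q)⁻¹) = (1 + H * Q)⁻¹ := by
    rw [neg_mul, ← sub_eq_add_neg, feedback_one_sub hu]
  rw [h, Matrix.nonsing_inv_nonsing_inv _ hu, Matrix.mul_assoc, Matrix.nonsing_inv_mul _ hu,
    mul_one]

lemma YoulaIneq.norm_le {P Q : Matrix (Fin n) (Fin n) ℂ} {ε : ℝ} (h : YoulaIneq P Q ε)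
    (hε : 0 < ε) (hP : Accretive P) (a : EuclideanSpace ℂ (Fin n)) :
    ‖act Q a‖ ≤ 2 / ε * ‖a‖ := by
  have h1 := h a
  have h2 := hP (act Q a)
  have h3 : (inner ℂ a (act Q a)).re ≤ ‖a‖ * ‖act Q a‖ :=
    (Complex.re_le_norm _).trans (norm_inner_le_norm _ _)
  rcases (norm_nonneg (act Q a)).eq_or_lt with h0 | h0
  · rw [← h0]; positivity
  · have : ε * ‖act Q a‖ ≤ 2 * ‖a‖ := by
      refine le_of_mul_le_mul_right ?_ h0
      nlinarith
    rw [div_mul_eq_mul_div, le_div_iff₀ hε]; linarith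

lemma YoulaIneq.weaken {P P' Q : Matrix (Fin n) (Fin n) ℂ} {ε : ℝ} (h : YoulaIneq P Q ε)
    (hP : Accretive (P - P')) : YoulaIneq P' Q ε := by
  intro a
  have h1 := h a
  have h2 := hP (act Q a)
  rw [sub_act, inner_sub_right, Complex.sub_re] at h2
  linarith

/-- A real multiple of the identity in `P` only changes the parameter. -/
lemma youlaIneq_smul_one {Q : Matrix (Fin n) (Fin n) ℂ} {ε c : ℝ} :
    YoulaIneq ((c : ℂ) • 1) Q ε ↔ YoulaIneq 0 Q (2 * c + ε) := by
  refine forall_congr' fun a => ?_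
  have : (inner ℂ (act Q a) ((c : ℂ) • act Q a)).re = c * ‖act Q a‖ ^ 2 := by
    rw [inner_smul_right, Complex.re_ofReal_mul, inner_self_re_eq]
  rw [smul_act, one_act, this, zero_act, inner_zero_right]
  simp only [Complex.zero_re]
  constructor <;> intro h <;> nlinarith

/-- Output strict passivity is contractivity of `1 - κ Q`. -/
lemma youlaIneq_zero_iff {Q : Matrix (Fin n) (Fin n) ℂ} {κ : ℝ} (hκ : 0 < κ) :
    YoulaIneq 0 Q κ ↔ ∀ a, ‖a - (κ : ℂ) • act Q a‖ ≤ ‖a‖ := by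
  refine forall_congr' fun a => ?_
  rw [← sq_le_sq₀ (norm_nonneg _) (norm_nonneg _), @norm_sub_sq ℂ]
  simp only [zero_act, inner_zero_right, inner_smul_right, norm_smul, mul_pow,
    RCLike.re_to_complex, Complex.zero_re, Complex.re_ofReal_mul, Complex.norm_real,
    Real.norm_eq_abs, sq_abs]
  constructor
  · intro h; nlinarith
  · intro h
    refine le_of_mul_le_mul_left ?_ hκ
    nlinarith

/-- The quadratic form inequality is preserved under limits. -/
lemma YoulaIneq.of_tendsto {α : Type*} {l : Filter α} [l.NeBot]
    {f g : α → Matrix (Fin n) (Fin n) ℂ} {P Q : Matrix (Fin n) (Fin n) ℂ} {ε : ℝ}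
    (hf : Tendsto f l (𝓝 P)) (hg : Tendsto g l (𝓝 Q)) (h : ∀ᶠ a in l, YoulaIneq (f a) (g a) ε) :
    YoulaIneq P Q ε := by
  intro a
  have h1 := tendsto_act hg a
  have h2 : Tendsto (fun x => act (f x) (act (g x) a)) l (𝓝 (act P (act Q a))) := by
    simp_rw [← mul_act]
    exact tendsto_act (hf.mul hg) a
  refine le_of_tendsto_of_tendsto
    (((h1.norm.pow 2).const_mul ε).add (((Complex.continuous_re.tendsto _).comp
      (h1.inner h2)).const_mul 2))
    (((Complex.continuous_re.tendsto _).comp (tendsto_const_nhds.inner h1)).const_mul 2) ?_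
  filter_upwards [h] with x hx using hx a

end Feedback

/-! ### The block inequality on the unit circle -/

section Block

variable {n : ℕ}

lemma accretive_iff {P : Matrix (Fin n) (Fin n) ℂ} : Accretive P ↔ (P + Pᴴ).PosSemidef := by
  have key : ∀ x : EuclideanSpace ℂ (Fin n),
      star x.ofLp ⬝ᵥ ((P + Pᴴ) *ᵥ x.ofLp) = ((2 * (inner ℂ x (act P x)).re : ℝ) : ℂ) := by
    intro x
    have h1 : star x.ofLp ⬝ᵥ ((P + Pᴴ) *ᵥ x.ofLp) = inner ℂ x (act (P + Pᴴ) x) := by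
      simp [act, EuclideanSpace.inner_eq_star_dotProduct, dotProduct_comm]
    rw [h1, add_act, inner_add_right, ← inner_act_left, ← inner_conj_symm (act P x) x,
      Complex.add_conj]
  constructor
  · intro h
    refine Matrix.PosSemidef.of_dotProduct_mulVec_nonneg ?_ fun x => ?_
    · rw [Matrix.IsHermitian, conjTranspose_add, conjTranspose_conjTranspose, add_comm]
    · rw [← WithLp.ofLp_toLp 2 x, key]
      have := h (WithLp.toLp 2 x)
      exact_mod_cast mul_nonneg zero_le_two this
  · intro h v
    have := h.dotProduct_mulVec_nonneg v.ofLp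
    rw [key] at this
    have h2 : (0 : ℝ) ≤ 2 * (inner ℂ v (act P v)).re := by exact_mod_cast this
    linarith

/-- A matrix and its conjugate transpose are contractive together. -/
lemma youlaIneq_zero_conjTranspose {X : Matrix (Fin n) (Fin n) ℂ} {κ : ℝ} (hκ : 0 < κ)
    (h : YoulaIneq 0 X κ) : YoulaIneq 0 Xᴴ κ := by
  rw [youlaIneq_zero_iff hκ] at h ⊢
  intro a
  set b := a - (κ : ℂ) • act Xᴴ a with hb
  have h0 : ∀ c, (inner ℂ (a - (κ : ℂ) • act Xᴴ a) c).re =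
      (inner ℂ a (c - (κ : ℂ) • act X c)).re := by
    intro c
    rw [inner_sub_left, inner_smul_left, Complex.conj_ofReal, ← inner_act_right, inner_sub_right,
      inner_smul_right]
  have h1 : (inner ℂ b b).re = (inner ℂ a (b - (κ : ℂ) • act X b)).re := h0 b
  have h2 : (inner ℂ b b).re = ‖b‖ ^ 2 := inner_self_re_eq b
  have h3 : ‖b‖ ^ 2 ≤ ‖a‖ * ‖b‖ := by
    rw [← h2, h1]
    refine (Complex.re_le_norm _).trans ((norm_inner_le_norm _ _).trans ?_)
    exact mul_le_mul_of_nonneg_left (h b) (norm_nonneg _)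
  rcases (norm_nonneg b).eq_or_lt with h0 | h0
  · rw [← h0]; positivity
  · exact le_of_mul_le_mul_right (by rw [← pow_two]; exact h3) h0

lemma posDef_add_smul_one {P : Matrix (Fin n) (Fin n) ℂ} {ε : ℝ} (hP : Accretive P) (hε : 0 < ε) :
    (P + Pᴴ + (ε : ℂ) • (1 : Matrix (Fin n) (Fin n) ℂ)).PosDef := by
  exact Matrix.PosDef.posSemidef_add (accretive_iff.mp hP)
    (Matrix.PosDef.one.smul (by exact_mod_cast hε))

/-- In the weighted inner product given by `P + Pᴴ + ε` the inequality is a contraction property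
of `Q`, hence passes to the conjugate transpose. -/
lemma YoulaIneq.conjTranspose {P Q : Matrix (Fin n) (Fin n) ℂ} {ε : ℝ} (hP : Accretive P)
    (hε : 0 < ε) (h : YoulaIneq P Q ε) : YoulaIneq P Qᴴ ε := by
  have hΨ := posDef_add_smul_one hP hε
  obtain ⟨B, hB⟩ := CStarAlgebra.nonneg_iff_eq_star_mul_self.mp
    (Matrix.nonneg_iff_posSemidef.mpr hΨ.posSemidef)
  rw [Matrix.star_eq_conjTranspose] at hB
  have hBu : IsUnit B.det := by
    have := hΨ.isUnit
    rw [hB, Matrix.isUnit_iff_isUnit_det, Matrix.det_mul] at this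
    exact isUnit_of_mul_isUnit_right this
  have key : ∀ u : EuclideanSpace ℂ (Fin n),
      ‖act B u‖ ^ 2 = ε * ‖u‖ ^ 2 + 2 * (inner ℂ u (act P u)).re := by
    intro u
    have h1 : ‖act B u‖ ^ 2 = (inner ℂ u (act (Bᴴ * B) u)).re := by
      rw [mul_act, ← inner_act_left, inner_self_eq_norm_sq_to_K]; norm_cast
    rw [h1, ← hB, add_act, add_act, inner_add_right, inner_add_right, ← inner_act_left, smul_act,
      one_act, inner_smul_right, Complex.add_re, Complex.add_re,
      Complex.re_ofReal_mul, inner_re_comm (act P u), inner_self_re_eq]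
    ring
  have equiv : ∀ R : Matrix (Fin n) (Fin n) ℂ,
      YoulaIneq P R ε ↔ YoulaIneq 0 (B * R * Bᴴ) 1 := by
    intro R
    have h2 : ∀ w, 1 * ‖act (B * R * Bᴴ) w‖ ^ 2 +
        2 * (inner ℂ (act (B * R * Bᴴ) w) (act 0 (act (B * R * Bᴴ) w))).re ≤
          2 * (inner ℂ w (act (B * R * Bᴴ) w)).re ↔
        ε * ‖act R (act Bᴴ w)‖ ^ 2 + 2 * (inner ℂ (act R (act Bᴴ w))
          (act P (act R (act Bᴴ w)))).re ≤ 2 * (inner ℂ (act Bᴴ w) (act R (act Bᴴ w))).re := by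
      intro w
      rw [← key, zero_act, inner_zero_right, mul_act, mul_act, inner_act_right B]
      simp
    constructor
    · intro hR w
      exact (h2 w).mpr (hR _)
    · intro hR a
      have h3 : act Bᴴ (act (Bᴴ)⁻¹ a) = a := by
        rw [← mul_act, Matrix.mul_nonsing_inv, one_act]
        rw [Matrix.det_conjTranspose]; exact hBu.star
      have := (h2 (act (Bᴴ)⁻¹ a)).mp (hR _)
      rwa [h3] at this
  have h4 := youlaIneq_zero_conjTranspose one_pos ((equiv Q).mp h)
  refine (equiv Qᴴ).mpr ?_
  rwa [conjTranspose_mul, conjTranspose_mul, conjTranspose_conjTranspose, ← Matrix.mul_assoc]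
    at h4

/-- Schur complement: the block inequality with spectral summand `F` is the quadratic inequality
for `Qᴴ`, hence for `Q`. -/
lemma posSemidef_block_iff {P Q F : Matrix (Fin n) (Fin n) ℂ} {ε : ℝ} (hP : Accretive P)
    (hε : 0 < ε)
    (hF : (P + Pᴴ + (ε : ℂ) • (1 : Matrix (Fin n) (Fin n) ℂ))⁻¹ = Fᴴ + F) :
    (Matrix.fromBlocks Q Q 0 F + (Matrix.fromBlocks Q Q 0 F)ᴴ).PosSemidef ↔ YoulaIneq P Q ε := by
  have hΨ := posDef_add_smul_one hP hε
  have hD : (F + Fᴴ).PosDef := by rw [add_comm, ← hF]; exact hΨ.inv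
  have hDinv : (F + Fᴴ)⁻¹ = P + Pᴴ + (ε : ℂ) • (1 : Matrix (Fin n) (Fin n) ℂ) := by
    rw [add_comm F, ← hF, Matrix.nonsing_inv_nonsing_inv]
    exact (Matrix.isUnit_iff_isUnit_det _).mp hΨ.isUnit
  have h1 : Matrix.fromBlocks Q Q 0 F + (Matrix.fromBlocks Q Q 0 F)ᴴ =
      Matrix.fromBlocks (Q + Qᴴ) Q Qᴴ (F + Fᴴ) := by
    rw [Matrix.fromBlocks_conjTranspose, Matrix.fromBlocks_add]; simp
  have : Invertible (F + Fᴴ) := hD.isUnit.invertible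
  rw [h1, hD.fromBlocks₂₂, hDinv]
  have h2 : Q + Qᴴ - Q * (P + Pᴴ + (ε : ℂ) • (1 : Matrix (Fin n) (Fin n) ℂ)) * Qᴴ =
      (Q - Q * (P + ((ε / 2 : ℝ) : ℂ) • 1) * Qᴴ) +
        (Q - Q * (P + ((ε / 2 : ℝ) : ℂ) • 1) * Qᴴ)ᴴ := by
    have h3 : (ε : ℂ) • (1 : Matrix (Fin n) (Fin n) ℂ) =
        ((ε / 2 : ℝ) : ℂ) • 1 + ((ε / 2 : ℝ) : ℂ) • 1 := by
      rw [← add_smul]; congr 1; push_cast; ring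
    simp only [h3, conjTranspose_sub, conjTranspose_mul, conjTranspose_add, conjTranspose_smul,
      conjTranspose_conjTranspose, conjTranspose_one, RCLike.star_def, Complex.conj_ofReal]
    simp only [Matrix.mul_add, Matrix.add_mul, Matrix.mul_assoc]
    abel
  have h4 : Accretive (Q - Q * (P + ((ε / 2 : ℝ) : ℂ) • 1) * Qᴴ) ↔ YoulaIneq P Qᴴ ε := by
    refine forall_congr' fun x => ?_
    have h5 : (inner ℂ x (act Qᴴ x)).re = (inner ℂ x (act Q x)).re := by
      rw [← inner_act_left, inner_re_comm]
    rw [sub_act, mul_act, mul_act, inner_sub_right, inner_act_right Q x (act _ (act Qᴴ x)),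
      add_act, smul_act, one_act, inner_add_right, inner_smul_right,
      Complex.sub_re, Complex.add_re, Complex.re_ofReal_mul, inner_self_re_eq, h5]
    constructor <;> intro h <;> nlinarith
  rw [h2, ← accretive_iff, h4]
  refine ⟨fun h => ?_, fun h => h.conjTranspose hP hε⟩
  simpa using h.conjTranspose hP hε

end Block

/-! ### Entrywise analyticity -/

section Analytic

variable {k m n : ℕ} {U : Set ℂ}

/-- A matrix function whose entries are complex differentiable on `U`. -/
def MatDiff (f : ℂ → Matrix (Fin m) (Fin n) ℂ) (U : Set ℂ) : Prop :=
  ∀ i j, DifferentiableOn ℂ (fun q => f q i j) U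

lemma MatDiff.const (M : Matrix (Fin m) (Fin n) ℂ) : MatDiff (fun _ => M) U :=
  fun _ _ => differentiableOn_const _

lemma MatDiff.add {f g : ℂ → Matrix (Fin m) (Fin n) ℂ} (hf : MatDiff f U) (hg : MatDiff g U) :
    MatDiff (fun q => f q + g q) U := fun i j => (hf i j).add (hg i j)

lemma MatDiff.neg {f : ℂ → Matrix (Fin m) (Fin n) ℂ} (hf : MatDiff f U) :
    MatDiff (fun q => -f q) U := fun i j => (hf i j).neg

lemma MatDiff.sub {f g : ℂ → Matrix (Fin m) (Fin n) ℂ} (hf : MatDiff f U) (hg : MatDiff g U) :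
    MatDiff (fun q => f q - g q) U := fun i j => (hf i j).sub (hg i j)

lemma MatDiff.smul {c : ℂ → ℂ} {f : ℂ → Matrix (Fin m) (Fin n) ℂ} (hc : DifferentiableOn ℂ c U)
    (hf : MatDiff f U) : MatDiff (fun q => c q • f q) U := fun i j => hc.mul (hf i j)

lemma MatDiff.mul {f : ℂ → Matrix (Fin m) (Fin n) ℂ} {g : ℂ → Matrix (Fin n) (Fin k) ℂ}
    (hf : MatDiff f U) (hg : MatDiff g U) : MatDiff (fun q => f q * g q) U := fun i j => by
  simp only [Matrix.mul_apply]
  exact DifferentiableOn.fun_sum fun l _ => (hf i l).mul (hg l j)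

lemma MatDiff.det {f : ℂ → Matrix (Fin n) (Fin n) ℂ} (hf : MatDiff f U) :
    DifferentiableOn ℂ (fun q => (f q).det) U := by
  simp only [Matrix.det_apply]
  refine DifferentiableOn.fun_sum fun σ _ => DifferentiableOn.const_smul ?_ _
  exact DifferentiableOn.fun_finsetProd fun i _ => hf _ _

lemma MatDiff.inv {f : ℂ → Matrix (Fin n) (Fin n) ℂ} (hf : MatDiff f U)
    (h : ∀ q ∈ U, IsUnit (f q).det) : MatDiff (fun q => (f q)⁻¹) U := fun i j => by
  simp only [Matrix.inv_def, Matrix.smul_apply, Ring.inverse_eq_inv', smul_eq_mul,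
    Matrix.adjugate_apply]
  refine (hf.det.inv fun q hq => (h q hq).ne_zero).mul ?_
  refine MatDiff.det fun a b => ?_
  by_cases hab : a = j
  · subst hab; simp
  · simpa [Matrix.updateRow_apply, hab] using hf a b

lemma MatDiff.comp {f : ℂ → Matrix (Fin m) (Fin n) ℂ} {g : ℂ → ℂ} {V : Set ℂ} (hf : MatDiff f U)
    (hg : DifferentiableOn ℂ g V) (h : Set.MapsTo g V U) : MatDiff (fun q => f (g q)) V :=
  fun i j => (hf i j).comp hg h

lemma MatDiff.mono {f : ℂ → Matrix (Fin m) (Fin n) ℂ} {V : Set ℂ} (hf : MatDiff f U)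
    (h : V ⊆ U) : MatDiff f V := fun i j => (hf i j).mono h

/-- The coordinates of `f q` applied to a fixed vector, paired with a fixed vector. -/
lemma MatDiff.inner_act {f : ℂ → Matrix (Fin m) (Fin n) ℂ} (hf : MatDiff f U)
    (a : EuclideanSpace ℂ (Fin n)) (b : EuclideanSpace ℂ (Fin m)) :
    DifferentiableOn ℂ (fun q => (inner ℂ b (act (f q) a) : ℂ)) U := by
  simp only [PiLp.inner_apply, act_coord, RCLike.inner_apply]
  refine DifferentiableOn.fun_sum fun i _ => DifferentiableOn.mul_const ?_ _
  exact DifferentiableOn.fun_sum fun j _ => (hf i j).mul_const _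

end Analytic

/-! ### Stability of the plant -/

section Stability

variable {nP nw nu nz : ℕ}

lemma vecMul_pow_of_eigen {n : ℕ} {A : Matrix (Fin n) (Fin n) ℂ} {x : Fin n → ℂ} {s : ℂ}
    (hx : x ᵥ* A = s • x) (k : ℕ) : x ᵥ* A ^ k = s ^ k • x := by
  induction k with
  | zero => simp
  | succ k ih => rw [pow_succ, ← Matrix.vecMul_vecMul, ih, Matrix.smul_vecMul, hx, smul_smul,
      pow_succ]

lemma vecMul_exp_of_eigen {n : ℕ} {A : Matrix (Fin n) (Fin n) ℂ} {x : Fin n → ℂ} {s : ℂ}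
    (hx : x ᵥ* A = s • x) : x ᵥ* NormedSpace.exp A = Complex.exp s • x := by
  have h1 := NormedSpace.exp_series_hasSum_exp' (𝕂 := ℂ) A
  have hc : Continuous fun M : Matrix (Fin n) (Fin n) ℂ => x ᵥ* M :=
    continuous_const.matrix_vecMul continuous_id
  let φ : Matrix (Fin n) (Fin n) ℂ →+ (Fin n → ℂ) :=
    { toFun := fun M => x ᵥ* M
      map_zero' := by simp
      map_add' := fun M N => by rw [Matrix.vecMul_add] }
  have h2 := h1.map φ hc
  have h3 := (NormedSpace.exp_series_hasSum_exp' (𝕂 := ℂ) s).smul_const x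
  rw [← Complex.exp_eq_exp_ℂ] at h3
  refine h2.unique (h3.congr_fun ?_)
  intro k
  simp only [φ, Function.comp_apply, AddMonoidHom.coe_mk, ZeroHom.coe_mk, Matrix.vecMul_smul,
    vecMul_pow_of_eigen hx, smul_smul, smul_eq_mul]

/-- The weight `(1 + r²)^(-1/2)`, although square integrable, is not integrable at `-∞`. -/
lemma not_integrableOn_Iic_of_le {f : ℝ → ℂ} {t κ : ℝ} (hκ : 0 < κ)
    (h : ∀ r ≤ t, κ * (Real.sqrt (1 + r ^ 2))⁻¹ ≤ ‖f r‖) : ¬ IntegrableOn f (Set.Iic t) := by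
  intro hf
  set m := min t (-1) with hm
  have h1 : IntegrableOn (fun r : ℝ => (-r)⁻¹) (Set.Iic m) := by
    refine Integrable.mono (((hf.mono_set (Set.Iic_subset_Iic.mpr (min_le_left _ _))).const_mul
      ((2 / κ : ℝ) : ℂ))) (by fun_prop) ?_
    refine (ae_restrict_mem measurableSet_Iic).mono fun r hr => ?_
    have hr1 : r ≤ -1 := hr.trans (min_le_right _ _)
    have hr2 := h r (hr.trans (min_le_left _ _))
    have h3 : Real.sqrt (1 + r ^ 2) ≤ 2 * (-r) := by
      rw [Real.sqrt_le_left (by linarith)]; nlinarith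
    have h4 : (2 * (-r))⁻¹ ≤ (Real.sqrt (1 + r ^ 2))⁻¹ := inv_anti₀ (by positivity) h3
    rw [norm_mul, Complex.norm_real, Real.norm_of_nonneg (inv_nonneg.mpr (by linarith : 0 ≤ -r)),
      Real.norm_of_nonneg (by positivity : 0 ≤ 2 / κ)]
    calc (-r)⁻¹ = 2 / κ * (κ * (2 * (-r))⁻¹) := by
          rw [mul_inv]; field_simp
      _ ≤ 2 / κ * ‖f r‖ := by
          gcongr
          exact (mul_le_mul_of_nonneg_left h4 hκ.le).trans hr2
  have h2 := (Measure.measurePreserving_neg (volume : Measure ℝ)).integrableOn_comp_preimage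
    (Homeomorph.neg ℝ).measurableEmbedding (f := fun r : ℝ => (-r)⁻¹) (s := Set.Iic m)
  have h3 := h2.mpr h1
  have h4 : (Neg.neg ⁻¹' Set.Iic m : Set ℝ) = Set.Ici (-m) := by
    ext r; simp [neg_le]
  rw [h4] at h3
  refine not_integrableOn_Ici_inv (a := -m) ?_
  simpa [Function.comp_def] using h3

/-- The state matrix has no eigenvalue in the closed right half-plane. Otherwise it has a left
eigenvector `x` for such an eigenvalue, controllability makes one of `x B_w`, `x B_u` nonzero, and
the slowly decaying input `(1 + r²)^(-1/2)` in its direction gives a divergent state integral. -/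
theorem isUnit_det_of_stable (P : Plant nP nw nu nz) (hP : P ∈ plantClass nP nw nu nz) {s : ℂ}
    (hs : 0 ≤ s.re) : IsUnit (s • (1 : Matrix (Fin nP) (Fin nP) ℂ) - P.A).det := by
  by_contra hdet
  rw [isUnit_iff_ne_zero, not_not] at hdet
  obtain ⟨x, hx0, hx⟩ := Matrix.exists_vecMul_eq_zero_iff.mpr hdet
  have hxA : x ᵥ* P.A = s • x := by
    rw [Matrix.vecMul_sub, Matrix.vecMul_smul, Matrix.vecMul_one, sub_eq_zero] at hx
    exact hx.symm
  obtain ⟨hmin, ⟨γ, -, hγ⟩, -⟩ := hP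
  set ρ : ℝ → ℂ := fun r => (((Real.sqrt (1 + r ^ 2))⁻¹ : ℝ) : ℂ) with hρ
  have hρm : ∀ {n : ℕ} (c : EuclideanSpace ℂ (Fin n)), MemLp (fun r => ρ r • c) 2 volume := by
    intro n c
    have hc : Continuous ρ := by
      refine Complex.continuous_ofReal.comp (Continuous.inv₀ (by fun_prop) fun r => ?_)
      have : 0 < 1 + r ^ 2 := by positivity
      exact (Real.sqrt_pos.mpr this).ne'
    rw [memLp_two_iff_integrable_sq_norm (by fun_prop)]
    refine (integrable_inv_one_add_sq.mul_const (‖c‖ ^ 2)).congr (ae_of_all _ fun r => ?_)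
    have : 0 ≤ 1 + r ^ 2 := by positivity
    simp only [hρ, norm_smul, Complex.norm_real, mul_pow, Real.norm_eq_abs, sq_abs, inv_pow,
      Real.sq_sqrt this]
  -- the state integral diverges if `x ⬝ᵥ (B_w w + B_u u)` is a nonzero multiple of `ρ`
  have key : ∀ (w : Signal nw) (u : Signal nu) (κ : ℝ), 0 < κ → MemLp w 2 volume →
      MemLp u 2 volume →
      (∀ r, x ⬝ᵥ (act P.Bw (w r) + act P.Bu (u r)).ofLp = ρ r * κ) → False := by
    intro w u κ hκ hw hu hxu
    obtain ⟨t, ht⟩ := (hγ w u hw hu).1.exists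
    let φ : EuclideanSpace ℂ (Fin nP) →L[ℂ] ℂ := LinearMap.toContinuousLinearMap
      { toFun := fun v => x ⬝ᵥ v.ofLp
        map_add' := fun a b => by simp
        map_smul' := fun a b => by simp }
    have h1 : IntegrableOn (fun r => φ (P.stateIntegrand w u t r)) (Set.Iic t) :=
      φ.integrable_comp ht
    refine not_integrableOn_Iic_of_le hκ (fun r hr => ?_) h1
    have h2 : φ (P.stateIntegrand w u t r) = Complex.exp (((t - r : ℝ) : ℂ) * s) * (ρ r * κ) := by
      change x ⬝ᵥ (P.stateIntegrand w u t r).ofLp = _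
      have h3 : x ᵥ* (((t - r : ℝ) : ℂ) • P.A) = (((t - r : ℝ) : ℂ) * s) • x := by
        rw [Matrix.vecMul_smul, hxA, smul_smul]
      rw [Plant.stateIntegrand, act, WithLp.ofLp_toLp, Matrix.dotProduct_mulVec,
        vecMul_exp_of_eigen h3, smul_dotProduct, hxu, smul_eq_mul]
    rw [h2, norm_mul, norm_mul, Complex.norm_exp, Complex.re_ofReal_mul]
    have h3 : 1 ≤ Real.exp ((t - r) * s.re) :=
      Real.one_le_exp (mul_nonneg (by linarith) hs)
    have h4 : ‖ρ r‖ * ‖(κ : ℂ)‖ = κ * (Real.sqrt (1 + r ^ 2))⁻¹ := by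
      simp only [hρ, Complex.norm_real]
      rw [Real.norm_of_nonneg (by positivity), Real.norm_of_nonneg hκ.le, mul_comm]
    rw [h4]
    exact le_mul_of_one_le_left (by positivity) h3
  have star_pos : ∀ {n : ℕ} (y : Fin n → ℂ), y ≠ 0 →
      ∃ κ : ℝ, 0 < κ ∧ y ⬝ᵥ star y = (κ : ℂ) := by
    intro n y hy
    have h1 : 0 < y ⬝ᵥ star y := by
      rw [dotProduct_comm]; exact dotProduct_star_self_pos_iff.mpr hy
    rw [Complex.lt_def] at h1
    refine ⟨(y ⬝ᵥ star y).re, h1.1, ?_⟩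
    apply Complex.ext <;> simp [← h1.2]
  have hBw : x ᵥ* P.Bw = 0 := by
    by_contra hne
    obtain ⟨κ, hκ, hk⟩ := star_pos _ hne
    refine key (fun r => ρ r • WithLp.toLp 2 (star (x ᵥ* P.Bw))) 0 κ hκ (hρm _) MemLp.zero
      fun r => ?_
    rw [Pi.zero_apply, act_zero, add_zero, act_smul, WithLp.ofLp_smul, dotProduct_smul, act,
      WithLp.ofLp_toLp, Matrix.dotProduct_mulVec, hk, smul_eq_mul]
  have hBu : x ᵥ* P.Bu = 0 := by
    by_contra hne
    obtain ⟨κ, hκ, hk⟩ := star_pos _ hne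
    refine key 0 (fun r => ρ r • WithLp.toLp 2 (star (x ᵥ* P.Bu))) κ hκ MemLp.zero (hρm _)
      fun r => ?_
    rw [Pi.zero_apply, act_zero, zero_add, act_smul, WithLp.ofLp_smul, dotProduct_smul, act,
      WithLp.ofLp_toLp, Matrix.dotProduct_mulVec, hk, smul_eq_mul]
  refine hx0 (hmin.1 x fun k => ?_)
  rw [← Matrix.vecMul_vecMul, ← Matrix.vecMul_vecMul, vecMul_pow_of_eigen hxA]
  simp [Matrix.smul_vecMul, hBw, hBu]

end Stability

/-! ### Passivity of the plant in the frequency domain -/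

section Passivity

variable {nP nw nu nz : ℕ}

lemma exp_commute_resolvent {n : ℕ} (A : Matrix (Fin n) (Fin n) ℂ) (s c : ℂ)
    (hu : IsUnit (s • (1 : Matrix (Fin n) (Fin n) ℂ) - A).det) :
    (s • (1 : Matrix (Fin n) (Fin n) ℂ) - A)⁻¹ * NormedSpace.exp (c • A) =
      NormedSpace.exp (c • A) * (s • (1 : Matrix (Fin n) (Fin n) ℂ) - A)⁻¹ := by
  have h1 : Commute (s • (1 : Matrix (Fin n) (Fin n) ℂ) - A) (c • A) := by
    refine Commute.sub_left ?_ ((Commute.refl A).smul_right c)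
    exact ((Commute.one_left A).smul_right c).smul_left s
  have h2 : Commute (s • (1 : Matrix (Fin n) (Fin n) ℂ) - A) (NormedSpace.exp (c • A)) :=
    h1.exp_right
  calc _ = (s • (1 : Matrix (Fin n) (Fin n) ℂ) - A)⁻¹ * (NormedSpace.exp (c • A) *
        ((s • (1 : Matrix (Fin n) (Fin n) ℂ) - A) *
          (s • (1 : Matrix (Fin n) (Fin n) ℂ) - A)⁻¹)) := by
        rw [Matrix.mul_nonsing_inv _ hu, mul_one]
    _ = _ := by
        rw [← Matrix.mul_assoc (NormedSpace.exp _), ← h2.eq, Matrix.mul_assoc, ← Matrix.mul_assoc,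
          Matrix.nonsing_inv_mul _ hu, one_mul]

/-- The steady state response to the exponential `exp (s r) b`. -/
lemma integral_exp_resolvent {n : ℕ} (A : Matrix (Fin n) (Fin n) ℂ) {s : ℂ} (t : ℝ)
    (hu : IsUnit (s • (1 : Matrix (Fin n) (Fin n) ℂ) - A).det) (b : EuclideanSpace ℂ (Fin n))
    (hint : IntegrableOn (fun r : ℝ => act (NormedSpace.exp (((t - r : ℝ) : ℂ) • A))
      (Complex.exp (s * r) • b)) (Set.Iic t)) :
    ∫ r in Set.Iic t, act (NormedSpace.exp (((t - r : ℝ) : ℂ) • A)) (Complex.exp (s * r) • b) =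
      Complex.exp (s * t) • act (s • (1 : Matrix (Fin n) (Fin n) ℂ) - A)⁻¹ b := by
  set R := (s • (1 : Matrix (Fin n) (Fin n) ℂ) - A)⁻¹ with hR
  set g : ℝ → EuclideanSpace ℂ (Fin n) := fun r =>
    act (NormedSpace.exp (((t - r : ℝ) : ℂ) • A)) (Complex.exp (s * r) • b) with hg
  have hf : ∀ r, HasDerivAt (fun r => act R (g r)) (g r) r := by
    intro r
    have e1 : HasDerivAt (fun r : ℝ => NormedSpace.exp (((t - r : ℝ) : ℂ) • A))
        (-(NormedSpace.exp (((t - r : ℝ) : ℂ) • A) * A)) r := by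
      have h1 := hasDerivAt_exp_smul_const (𝕂 := ℂ) A ((t - r : ℝ) : ℂ)
      have h2 : HasDerivAt (fun r : ℝ => ((t - r : ℝ) : ℂ)) (-1) r := by
        have := ((hasDerivAt_id r).const_sub t).ofReal_comp
        simpa using this
      have := HasDerivAt.scomp r h1 h2
      simpa [Function.comp_def] using this
    have e2 : HasDerivAt (fun r : ℝ => Complex.exp (s * r)) (Complex.exp (s * r) * s) r := by
      have h2 : HasDerivAt (fun r : ℝ => s * (r : ℂ)) s r := by
        have := ((hasDerivAt_id r).ofReal_comp).const_mul s
        simpa using this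
      exact h2.cexp
    have e3 : HasDerivAt (fun r : ℝ => Complex.exp (s * r) •
        NormedSpace.exp (((t - r : ℝ) : ℂ) • A))
        (Complex.exp (s * r) • (-(NormedSpace.exp (((t - r : ℝ) : ℂ) • A) * A)) +
          (Complex.exp (s * r) * s) • NormedSpace.exp (((t - r : ℝ) : ℂ) • A)) r := e2.smul e1
    let φ : Matrix (Fin n) (Fin n) ℂ →L[ℝ] EuclideanSpace ℂ (Fin n) :=
      LinearMap.toContinuousLinearMap
      { toFun := fun M => act R (act M b)
        map_add' := fun a b => by simp [add_act, act_add]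
        map_smul' := fun a b => by
          simp only [RingHom.id_apply]
          rw [← Complex.coe_smul, smul_act, act_smul, Complex.coe_smul] }
    have e4 := φ.hasFDerivAt.comp_hasDerivAt r e3
    have e5 : (fun r => act R (g r)) = φ ∘ (fun r : ℝ => Complex.exp (s * r) •
        NormedSpace.exp (((t - r : ℝ) : ℂ) • A)) := by
      ext1 r
      change act R (act _ _) = act R (act _ b)
      rw [smul_act, act_smul]
    rw [e5]
    refine e4.congr_deriv ?_
    change act R (act _ b) = act _ _
    have e6 : Complex.exp (s * r) • (-(NormedSpace.exp (((t - r : ℝ) : ℂ) • A) * A)) +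
        (Complex.exp (s * r) * s) • NormedSpace.exp (((t - r : ℝ) : ℂ) • A) =
        Complex.exp (s * r) • (NormedSpace.exp (((t - r : ℝ) : ℂ) • A) * (s • 1 - A)) := by
      rw [Matrix.mul_sub, Matrix.mul_smul, mul_one, smul_sub, smul_smul, smul_neg]
      abel
    rw [e6, smul_act, act_smul, act_smul, ← mul_act, ← Matrix.mul_assoc, hR,
      exp_commute_resolvent A s _ hu, Matrix.mul_assoc, Matrix.nonsing_inv_mul _ hu, mul_one]
  have hRint : IntegrableOn (fun r => act R (g r)) (Set.Iic t) := (actL R).integrable_comp hint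
  have h0 := tendsto_zero_of_hasDerivAt_of_integrableOn_Iic (fun r _ => hf r) hint hRint
  rw [integral_Iic_of_hasDerivAt_of_tendsto' (fun r _ => hf r) hint h0, sub_zero]
  simp [hg, act_smul]

/-- The truncated exponential signal `exp (s t) v` on the negative time axis. -/
noncomputable def pastExp {n : ℕ} (s : ℂ) (v : EuclideanSpace ℂ (Fin n)) : Signal n :=
  (Set.Iio (0 : ℝ)).indicator fun t => Complex.exp (s * t) • v

lemma norm_exp_mul_real (s : ℂ) (t : ℝ) : ‖Complex.exp (s * t)‖ = Real.exp (s.re * t) := by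
  rw [Complex.norm_exp, Complex.re_mul_ofReal]

lemma memLp_pastExp {n : ℕ} {s : ℂ} (hs : 0 < s.re) (v : EuclideanSpace ℂ (Fin n)) :
    MemLp (pastExp s v) 2 volume := by
  have hm : AEStronglyMeasurable (pastExp s v) volume := by
    refine AEStronglyMeasurable.indicator ?_ measurableSet_Iio
    exact Continuous.aestronglyMeasurable (by fun_prop)
  rw [memLp_two_iff_integrable_sq_norm hm]
  have h1 : (fun t => ‖pastExp s v t‖ ^ 2) =
      (Set.Iio (0 : ℝ)).indicator fun t => Real.exp ((2 * s.re) * t) * ‖v‖ ^ 2 := by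
    ext t
    by_cases ht : t ∈ Set.Iio (0 : ℝ)
    · simp only [pastExp, Set.indicator_of_mem ht, norm_smul, norm_exp_mul_real, mul_pow,
        ← Real.exp_nat_mul]
      congr 2; push_cast; ring
    · simp [pastExp, Set.indicator_of_notMem ht]
  rw [h1, integrable_indicator_iff measurableSet_Iio]
  refine Integrable.mul_const ?_ _
  exact (integrableOn_exp_mul_Iic (by positivity) 0).mono_set Set.Iio_subset_Iic_self

/-- Passivity tested on truncated exponentials gives positive realness in the right half-plane. -/
theorem accretive_tfUY (P : Plant nP nw nu nz) (hP : P ∈ plantClass nP nw nu nz) {s : ℂ}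
    (hs : 0 < s.re) : Accretive (P.tfUY s) := by
  obtain ⟨-, ⟨γ, -, hγ⟩, ⟨β, -, hβ⟩⟩ := id hP
  have hu := isUnit_det_of_stable P hP hs.le
  have hout : ∀ v, ∀ᵐ t : ℝ, t < 0 →
      P.outY 0 (pastExp s v) t = Complex.exp (s * t) • act (P.tfUY s) v := by
    intro v
    filter_upwards [(hγ 0 (pastExp s v) MemLp.zero (memLp_pastExp hs v)).1] with t ht h0
    have h1 : ∀ r ∈ Set.Iic t, P.stateIntegrand 0 (pastExp s v) t r =
        act (NormedSpace.exp (((t - r : ℝ) : ℂ) • P.A)) (Complex.exp (s * r) • act P.Bu v) := by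
      intro r hr
      have hr0 : r ∈ Set.Iio (0 : ℝ) := lt_of_le_of_lt hr h0
      rw [Plant.stateIntegrand, Pi.zero_apply, act_zero, zero_add, pastExp,
        Set.indicator_of_mem hr0, act_smul]
    have h2 : P.state 0 (pastExp s v) t = Complex.exp (s * t) •
        act (s • (1 : Matrix (Fin nP) (Fin nP) ℂ) - P.A)⁻¹ (act P.Bu v) := by
      rw [Plant.state, setIntegral_congr_fun measurableSet_Iic h1]
      exact integral_exp_resolvent P.A t hu _ ((integrableOn_congr_fun h1 measurableSet_Iic).mp ht)
    have ht0 : t ∈ Set.Iio (0 : ℝ) := h0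
    rw [Plant.outY, h2, pastExp, Set.indicator_of_mem ht0, Plant.tfUY, add_act, mul_act, mul_act,
      act_smul, act_smul, smul_add]
  have hval : ∀ v, ∫ t, (inner ℂ (pastExp s v t) (P.outY 0 (pastExp s v) t) +
      inner ℂ (P.outY 0 (pastExp s v) t) (pastExp s v t)).re =
      (inner ℂ v (act (P.tfUY s) v)).re / s.re := by
    intro v
    have h1 : ∀ᵐ t : ℝ, (inner ℂ (pastExp s v t) (P.outY 0 (pastExp s v) t) +
        inner ℂ (P.outY 0 (pastExp s v) t) (pastExp s v t)).re =
        (Set.Iio (0 : ℝ)).indicator (fun t => Real.exp ((2 * s.re) * t) *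
          (2 * (inner ℂ v (act (P.tfUY s) v)).re)) t := by
      filter_upwards [hout v] with t ht
      by_cases h0 : t ∈ Set.Iio (0 : ℝ)
      · rw [ht h0, pastExp, Set.indicator_of_mem h0, Set.indicator_of_mem h0, Complex.add_re,
          inner_re_comm (_ • act _ _), ← two_mul, inner_smul_left, inner_smul_right, ← mul_assoc,
          ← Complex.normSq_eq_conj_mul_self, Complex.re_ofReal_mul, Complex.normSq_eq_norm_sq,
          norm_exp_mul_real, ← Real.exp_nat_mul]
        push_cast
        ring_nf
      · simp [pastExp, Set.indicator_of_notMem h0]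
    rw [integral_congr_ae h1, integral_indicator measurableSet_Iio, integral_mul_const,
      ← integral_Iic_eq_integral_Iio, integral_exp_mul_Iic (by positivity)]
    simp
    field_simp
  intro v
  by_contra hneg
  push Not at hneg
  have hscale : ∀ c : ℝ, -β ≤ c ^ 2 * ((inner ℂ v (act (P.tfUY s) v)).re / s.re) := by
    intro c
    have h1 := hβ (pastExp s ((c : ℂ) • v)) (memLp_pastExp hs _)
    rw [hval, act_smul, inner_smul_left, inner_smul_right, Complex.conj_ofReal,
      Complex.re_ofReal_mul, Complex.re_ofReal_mul] at h1
    refine h1.trans_eq (by ring)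
  set X := (inner ℂ v (act (P.tfUY s) v)).re / s.re with hX
  have hX0 : X < 0 := div_neg_of_neg_of_pos hneg hs
  -- scaling `v` makes the left side of the passivity inequality fall below `-β`
  have h1 := hscale (Real.sqrt ((|β| + 1) / (-X)))
  rw [Real.sq_sqrt (div_nonneg (by positivity) (by linarith))] at h1
  have h2 : (|β| + 1) / (-X) * X = -(|β| + 1) := by
    rw [div_neg, neg_mul, div_mul_cancel₀ _ hX0.ne]
  rw [h2] at h1
  linarith [le_abs_self β]

end Passivity

/-! ### The plant on the unit disc -/

section Disc

variable {nP nw nu nz : ℕ}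

/-- Inverse of the Cayley transform `s ↦ q⁻¹`: the point `s` of the right half-plane that
corresponds to `z = q⁻¹` in the unit disc. -/
noncomputable def sOfZ (τ : ℝ) (z : ℂ) : ℂ := (1 - z) / (2 * τ * (1 + z))

lemma one_add_ne_zero {z : ℂ} (hz : ‖z‖ < 1) : 1 + z ≠ 0 := by
  intro h
  have : z = -1 := by linear_combination h
  rw [this] at hz
  simp at hz

lemma sOfQ_eq_sOfZ {τ : ℝ} (hτ : 0 < τ) {q : ℂ} (hq : q ≠ 0) (hq1 : q + 1 ≠ 0) :
    sOfQ τ q = sOfZ τ q⁻¹ := by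
  have hτ' : (τ : ℂ) ≠ 0 := by exact_mod_cast hτ.ne'
  have h1 : 1 + q⁻¹ ≠ 0 := by
    intro h; apply hq1; field_simp at h; linear_combination h
  rw [sOfQ, sOfZ]
  field_simp

lemma sOfZ_re {τ : ℝ} (z : ℂ) :
    (sOfZ τ z).re = (1 - ‖z‖ ^ 2) / (2 * τ * ‖1 + z‖ ^ 2) := by
  have h1 : sOfZ τ z = ((((2 * τ : ℝ))⁻¹ : ℝ) : ℂ) * ((1 - z) / (1 + z)) := by
    rw [sOfZ]; push_cast; rw [← div_div, div_eq_inv_mul (1 - z), mul_div_assoc]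
  rw [h1, Complex.re_ofReal_mul, Complex.div_re, ← Complex.normSq_eq_norm_sq,
    ← Complex.normSq_eq_norm_sq, ← add_div]
  have h2 : (1 - z).re * (1 + z).re + (1 - z).im * (1 + z).im = 1 - Complex.normSq z := by
    simp [Complex.normSq_apply]; ring
  rw [h2, ← div_eq_inv_mul, div_div, mul_comm (Complex.normSq _)]

lemma sOfZ_re_pos {τ : ℝ} (hτ : 0 < τ) {z : ℂ} (hz : ‖z‖ < 1) : 0 < (sOfZ τ z).re := by
  have h1 : 0 < ‖1 + z‖ := norm_pos_iff.mpr (one_add_ne_zero hz)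
  rw [sOfZ_re]
  have : 0 < 1 - ‖z‖ ^ 2 := by nlinarith [norm_nonneg z]
  positivity

/-- The pencil `(1 - z) - 2τ(1 + z) A`, a multiple of `s - A`. -/
noncomputable def Plant.discPencil (P : Plant nP nw nu nz) (τ : ℝ) (z : ℂ) :
    Matrix (Fin nP) (Fin nP) ℂ := (1 - z) • 1 - (2 * τ * (1 + z)) • P.A

/-- The transfer function `u ↦ y` in the variable `z = q⁻¹`, written without a pole at `z = -1`
(which corresponds to `s = ∞`). -/
noncomputable def Plant.discTf (P : Plant nP nw nu nz) (τ : ℝ) (z : ℂ) :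
    Matrix (Fin nu) (Fin nu) ℂ :=
  P.Cy * ((2 * τ * (1 + z)) • (P.discPencil τ z)⁻¹) * P.Bu + P.Duy

variable (P : Plant nP nw nu nz)

lemma discPencil_eq {τ : ℝ} (hτ : 0 < τ) {z : ℂ} (hz : 1 + z ≠ 0) :
    P.discPencil τ z = (2 * τ * (1 + z)) • (sOfZ τ z • 1 - P.A) := by
  have hτ' : (τ : ℂ) ≠ 0 := by exact_mod_cast hτ.ne'
  rw [Plant.discPencil, smul_sub, smul_smul]
  congr 2
  rw [sOfZ]; field_simp

lemma isUnit_det_discPencil (hP : P ∈ plantClass nP nw nu nz) {τ : ℝ} (hτ : 0 < τ) {z : ℂ}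
    (hz : ‖z‖ ≤ 1) : IsUnit (P.discPencil τ z).det := by
  have hτ' : (τ : ℂ) ≠ 0 := by exact_mod_cast hτ.ne'
  by_cases h : 1 + z = 0
  · have hz1 : z = -1 := by linear_combination h
    rw [Plant.discPencil, hz1, isUnit_iff_ne_zero]
    simp only [add_neg_cancel, mul_zero, zero_smul, sub_zero, Matrix.det_smul, Matrix.det_one]
    norm_num
  · rw [discPencil_eq P hτ h, Matrix.det_smul]
    have h1 : 0 ≤ (sOfZ τ z).re := by
      rw [sOfZ_re]
      have : 0 ≤ 1 - ‖z‖ ^ 2 := by nlinarith [norm_nonneg z]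
      positivity
    refine IsUnit.mul (IsUnit.pow _ (isUnit_iff_ne_zero.mpr ?_)) (isUnit_det_of_stable P hP h1)
    exact mul_ne_zero (mul_ne_zero two_ne_zero hτ') h

lemma discTf_eq (hP : P ∈ plantClass nP nw nu nz) {τ : ℝ} (hτ : 0 < τ) {z : ℂ}
    (hz : ‖z‖ ≤ 1) (hz1 : 1 + z ≠ 0) : P.discTf τ z = P.tfUY (sOfZ τ z) := by
  have hτ' : (τ : ℂ) ≠ 0 := by exact_mod_cast hτ.ne'
  have hc : 2 * (τ : ℂ) * (1 + z) ≠ 0 := mul_ne_zero (mul_ne_zero two_ne_zero hτ') hz1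
  have hu := isUnit_det_discPencil P hP hτ hz
  rw [discPencil_eq P hτ hz1] at hu
  rw [Plant.discTf, Plant.tfUY, discPencil_eq P hτ hz1]
  congr 3
  symm
  refine Matrix.inv_eq_right_inv ?_
  rw [Matrix.mul_smul, ← Matrix.smul_mul, Matrix.mul_nonsing_inv _ hu]

lemma bilinear_tfUY_eq (hP : P ∈ plantClass nP nw nu nz) {τ : ℝ} (hτ : 0 < τ) {q : ℂ}
    (hq : 1 ≤ ‖q‖) (hq1 : q + 1 ≠ 0) : bilinear τ P.tfUY q = P.discTf τ q⁻¹ := by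
  have hq0 : q ≠ 0 := by
    rintro rfl; simp at hq; linarith
  have h1 : 1 + q⁻¹ ≠ 0 := by
    intro h; apply hq1; field_simp at h; linear_combination h
  rw [discTf_eq P hP hτ _ h1, bilinear, sOfQ_eq_sOfZ hτ hq0 hq1]
  rw [norm_inv]; exact inv_le_one_of_one_le₀ hq

lemma matDiff_discPencil (τ : ℝ) (U : Set ℂ) : MatDiff (P.discPencil τ) U :=
  (MatDiff.smul (by fun_prop) (MatDiff.const _)).sub
    (MatDiff.smul (by fun_prop) (MatDiff.const _))

/-- The open set on which the transfer function in the disc variable is analytic. -/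
def Plant.discDomain (P : Plant nP nw nu nz) (τ : ℝ) : Set ℂ :=
  {z | (P.discPencil τ z).det ≠ 0}

lemma isOpen_discDomain (τ : ℝ) : IsOpen (P.discDomain τ) := by
  have h : Differentiable ℂ fun z => (P.discPencil τ z).det :=
    differentiableOn_univ.mp (matDiff_discPencil P τ Set.univ).det
  exact isOpen_ne_fun h.continuous continuous_const

lemma closedBall_subset_discDomain (hP : P ∈ plantClass nP nw nu nz) {τ : ℝ} (hτ : 0 < τ) :
    Metric.closedBall 0 1 ⊆ P.discDomain τ := fun _ hz =>
  (isUnit_det_discPencil P hP hτ (mem_closedBall_zero_iff.mp hz)).ne_zero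

lemma matDiff_discTf (τ : ℝ) : MatDiff (P.discTf τ) (P.discDomain τ) :=
  (((MatDiff.const _).mul (MatDiff.smul (by fun_prop)
    ((matDiff_discPencil P τ _).inv fun _ hq => isUnit_iff_ne_zero.mpr hq))).mul
      (MatDiff.const _)).add (MatDiff.const _)

lemma MatDiff.continuousOn {m n : ℕ} {f : ℂ → Matrix (Fin m) (Fin n) ℂ} {U : Set ℂ}
    (hf : MatDiff f U) : ContinuousOn f U :=
  continuousOn_pi.mpr fun i => continuousOn_pi.mpr fun j => (hf i j).continuousOn

lemma continuousOn_discTf (hP : P ∈ plantClass nP nw nu nz) {τ : ℝ} (hτ : 0 < τ) :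
    ContinuousOn (P.discTf τ) (Metric.closedBall 0 1) :=
  (matDiff_discTf P τ).continuousOn.mono (closedBall_subset_discDomain P hP hτ)

lemma exists_bound_discTf (hP : P ∈ plantClass nP nw nu nz) {τ : ℝ} (hτ : 0 < τ) :
    ∃ c : ℝ, 0 ≤ c ∧ ∀ z, ‖z‖ ≤ 1 → ∀ x, ‖act (P.discTf τ z) x‖ ≤ c * ‖x‖ := by
  obtain ⟨c, hc⟩ := (isCompact_closedBall (0 : ℂ) 1).exists_bound_of_continuousOn
    (continuousOn_discTf P hP hτ)
  refine ⟨max c 0, le_max_right _ _, fun z hz x => ?_⟩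
  have h1 := hc z (mem_closedBall_zero_iff.mpr hz)
  have h2 : ‖act (P.discTf τ z) x‖ ≤ ‖P.discTf τ z‖ * ‖x‖ :=
    Matrix.l2_opNorm_mulVec (P.discTf τ z) x
  exact h2.trans (mul_le_mul_of_nonneg_right (h1.trans (le_max_left _ _)) (norm_nonneg _))

lemma Accretive.of_tendsto {α : Type*} {n : ℕ} {l : Filter α} [l.NeBot]
    {f : α → Matrix (Fin n) (Fin n) ℂ} {M : Matrix (Fin n) (Fin n) ℂ} (hf : Tendsto f l (𝓝 M))
    (h : ∀ᶠ a in l, Accretive (f a)) : Accretive M := fun v =>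
  ge_of_tendsto ((Complex.continuous_re.tendsto _).comp
    (tendsto_const_nhds.inner (tendsto_act hf v))) (h.mono fun _ ha => ha v)

lemma accretive_discTf (hP : P ∈ plantClass nP nw nu nz) {τ : ℝ} (hτ : 0 < τ) {z : ℂ}
    (hz : ‖z‖ ≤ 1) : Accretive (P.discTf τ z) := by
  have hin : ∀ w : ℂ, ‖w‖ < 1 → Accretive (P.discTf τ w) := fun _ hz => by
    rw [discTf_eq P hP hτ hz.le (one_add_ne_zero hz)]
    exact accretive_tfUY P hP (sOfZ_re_pos hτ hz)
  have hcl : z ∈ closure (Metric.ball (0 : ℂ) 1) := by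
    rw [closure_ball _ one_ne_zero]; exact mem_closedBall_zero_iff.mpr hz
  have hne : (𝓝[Metric.ball (0 : ℂ) 1] z).NeBot := mem_closure_iff_nhdsWithin_neBot.mp hcl
  refine Accretive.of_tendsto (l := 𝓝[Metric.ball (0 : ℂ) 1] z) (f := P.discTf τ) ?_ ?_
  · exact ((continuousOn_discTf P hP hτ) z (mem_closedBall_zero_iff.mpr hz)).mono
      Metric.ball_subset_closedBall
  · filter_upwards [self_mem_nhdsWithin] with w hw using hin w (mem_ball_zero_iff.mp hw)

end Disc

/-! ### Boundary values of bounded analytic functions -/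

section Boundary

/-- A bounded analytic function on `|q| > 1` is a bounded analytic function of `q⁻¹` in the disc,
the singularity at `q = ∞` being removable. -/
lemma exists_disc_function {E : Type*} [NormedAddCommGroup E] [NormedSpace ℂ E] [CompleteSpace E]
    {g : ℂ → E} (hg : DifferentiableOn ℂ g {q | 1 < ‖q‖}) {c : ℝ}
    (hb : ∀ q : ℂ, 1 < ‖q‖ → ‖g q‖ ≤ c) :
    ∃ f : ℂ → E, DifferentiableOn ℂ f (Metric.ball 0 1) ∧ (∀ z : ℂ, ‖z‖ < 1 → ‖f z‖ ≤ c) ∧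
      ∀ q : ℂ, 1 < ‖q‖ → f q⁻¹ = g q := by
  set h : ℂ → E := fun z => g z⁻¹ with hh
  have hmaps : ∀ z ∈ Metric.ball (0 : ℂ) 1 \ {0}, 1 < ‖z⁻¹‖ := by
    intro z hz
    rw [norm_inv]
    exact (one_lt_inv₀ (norm_pos_iff.mpr hz.2)).mpr (mem_ball_zero_iff.mp hz.1)
  have hd : DifferentiableOn ℂ h (Metric.ball (0 : ℂ) 1 \ {0}) := by
    refine hg.comp (fun z hz => ?_) hmaps
    exact (differentiableAt_inv hz.2).differentiableWithinAt
  have hball : Metric.ball (0 : ℂ) 1 ∈ 𝓝 0 := Metric.ball_mem_nhds _ one_pos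
  have hbd : BddAbove (norm ∘ h '' (Metric.ball (0 : ℂ) 1 \ {0})) := by
    refine ⟨c, ?_⟩
    rintro _ ⟨z, hz, rfl⟩
    exact hb _ (hmaps z hz)
  have hf := Complex.differentiableOn_update_limUnder_of_bddAbove hball hd hbd
  set f := Function.update h 0 (limUnder (𝓝[≠] 0) h) with hfdef
  have hfne : ∀ z, z ≠ 0 → f z = h z := fun z hz => by rw [hfdef, Function.update_of_ne hz]
  refine ⟨f, hf, ?_, ?_⟩
  · intro z hz
    by_cases h0 : z = 0
    · subst h0
      have h1 : Tendsto f (𝓝[≠] 0) (𝓝 (f 0)) :=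
        ((hf.differentiableAt hball).continuousAt).tendsto.mono_left nhdsWithin_le_nhds
      refine le_of_tendsto h1.norm ?_
      filter_upwards [self_mem_nhdsWithin, mem_nhdsWithin_of_mem_nhds hball] with w hw hw1
      rw [hfne w hw]
      exact hb _ (hmaps w ⟨hw1, hw⟩)
    · rw [hfne z h0]
      exact hb _ (hmaps z ⟨mem_ball_zero_iff.mpr hz, h0⟩)
  · intro q hq
    have hq0 : q ≠ 0 := by rintro rfl; simp at hq; linarith
    rw [hfne _ (inv_ne_zero hq0)]
    simp [hh]

/-- A property of the angle that has period `2π` and holds almost everywhere on `[-π, π]` holds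
almost everywhere on the line. -/
lemma ae_of_ae_restrict_of_periodic {p : ℝ → Prop} (hp : ∀ (θ : ℝ) (n : ℤ),
    p (θ - n * (2 * Real.pi)) → p θ)
    (h : ∀ᵐ θ ∂(volume.restrict (Set.Icc (-Real.pi) Real.pi)), p θ) : ∀ᵐ θ : ℝ, p θ := by
  rw [ae_restrict_iff' measurableSet_Icc] at h
  have h1 : ∀ n : ℤ, ∀ᵐ θ : ℝ, (θ - n * (2 * Real.pi)) ∈ Set.Icc (-Real.pi) Real.pi →
      p (θ - n * (2 * Real.pi)) := fun n =>
    (measurePreserving_sub_right volume ((n : ℝ) * (2 * Real.pi))).quasiMeasurePreserving.ae h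
  filter_upwards [ae_all_iff.mpr h1] with θ hθ
  have hpi : 0 < 2 * Real.pi := by positivity
  refine hp θ (toIcoDiv hpi (-Real.pi) θ) (hθ _ ?_)
  have h2 := toIcoMod_mem_Ico hpi (-Real.pi) θ
  rw [toIcoMod, zsmul_eq_mul] at h2
  exact ⟨h2.1, by linarith [h2.2]⟩

lemma ae_neg {p : ℝ → Prop} (h : ∀ᵐ θ : ℝ, p θ) : ∀ᵐ θ : ℝ, p (-θ) :=
  (Measure.measurePreserving_neg (volume : Measure ℝ)).quasiMeasurePreserving.ae h

/-- The Poisson kernel of the unit disc. -/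
noncomputable def poissonK (z : ℂ) (θ : ℝ) : ℝ :=
  (1 - ‖z‖ ^ 2) / ‖Complex.exp (θ * Complex.I) - z‖ ^ 2

lemma exp_sub_ne_zero {z : ℂ} (hz : ‖z‖ < 1) (θ : ℝ) : Complex.exp (θ * Complex.I) - z ≠ 0 := by
  intro h
  rw [sub_eq_zero] at h
  rw [← h, Complex.norm_exp_ofReal_mul_I] at hz
  exact lt_irrefl _ hz

lemma poissonK_nonneg {z : ℂ} (hz : ‖z‖ < 1) (θ : ℝ) : 0 ≤ poissonK z θ := by
  have : 0 ≤ 1 - ‖z‖ ^ 2 := by nlinarith [norm_nonneg z]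
  unfold poissonK; positivity

lemma continuous_poissonK {z : ℂ} (hz : ‖z‖ < 1) : Continuous (poissonK z) := by
  unfold poissonK
  refine Continuous.div (by fun_prop) (by fun_prop) fun θ => ?_
  exact pow_ne_zero _ (norm_ne_zero_iff.mpr (exp_sub_ne_zero hz θ))

lemma poisson_formula {f : ℂ → ℂ} (hf : DiffContOnCl ℂ f (Metric.ball 0 1)) {z : ℂ}
    (hz : ‖z‖ < 1) :
    f z = (2 * Real.pi)⁻¹ • ∫ θ in (0 : ℝ)..2 * Real.pi,
      poissonK z θ • f (Complex.exp (θ * Complex.I)) := by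
  have h := hf.circleAverage_poissonKernel_smul' (mem_ball_zero_iff.mpr hz)
  rw [← h, Real.circleAverage]
  simp only [circleMap, Complex.ofReal_one, one_mul, zero_add, sub_zero,
    Complex.norm_exp_ofReal_mul_I, one_pow, poissonK]

lemma integral_poissonK {z : ℂ} (hz : ‖z‖ < 1) :
    (2 * Real.pi)⁻¹ * ∫ θ in (0 : ℝ)..2 * Real.pi, poissonK z θ = 1 := by
  have h := poisson_formula (f := fun _ => (1 : ℂ)) diffContOnCl_const hz
  have h1 : ∀ θ, poissonK z θ • (1 : ℂ) = ((poissonK z θ : ℝ) : ℂ) := fun θ => by simp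
  simp only [h1, intervalIntegral.integral_ofReal] at h
  rw [Complex.real_smul] at h
  exact_mod_cast h.symm

/-- A bounded analytic function on the disc is estimated by the Poisson integral of the modulus of
its radial limits; the integrand enters through a pointwise majorant `a * poissonK z θ + b`, whose
mean over the circle is `a + b`. -/
theorem norm_le_of_poisson_bound {f : ℂ → ℂ} (hf : DifferentiableOn ℂ f (Metric.ball 0 1)) {c : ℝ}
    (hb : ∀ z : ℂ, ‖z‖ < 1 → ‖f z‖ ≤ c) {z : ℂ} (hz : ‖z‖ < 1) {a b : ℝ}
    (hlim : ∀ᵐ θ : ℝ, ∃ l : ℂ,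
      Tendsto (fun ρ : ℝ => f (ρ * Complex.exp (θ * Complex.I))) (𝓝[<] 1) (𝓝 l) ∧
      poissonK z θ * ‖l‖ ≤ a * poissonK z θ + b) : ‖f z‖ ≤ a + b := by
  classical
  have hex : ∃ l : ℝ → ℂ, ∀ᵐ θ : ℝ,
      Tendsto (fun ρ : ℝ => f (ρ * Complex.exp (θ * Complex.I))) (𝓝[<] 1) (𝓝 (l θ)) ∧
      poissonK z θ * ‖l θ‖ ≤ a * poissonK z θ + b := by
    refine ⟨fun θ => if h : ∃ l : ℂ,
      Tendsto (fun ρ : ℝ => f (ρ * Complex.exp (θ * Complex.I))) (𝓝[<] 1) (𝓝 l) ∧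
      poissonK z θ * ‖l‖ ≤ a * poissonK z θ + b then h.choose else 0, ?_⟩
    filter_upwards [hlim] with θ hθ
    rw [dif_pos hθ]
    exact hθ.choose_spec
  obtain ⟨l, hl⟩ := hex
  have hc : Continuous (poissonK z) := continuous_poissonK hz
  have hev : ∀ᶠ ρ : ℝ in 𝓝[<] 1, 0 < ρ ∧ ρ < 1 := by
    filter_upwards [self_mem_nhdsWithin, mem_nhdsWithin_of_mem_nhds (lt_mem_nhds one_pos)]
      with ρ h1 h2 using ⟨h2, h1⟩
  have hin : ∀ ρ : ℝ, 0 < ρ → ρ < 1 → ∀ w : ℂ, ‖w‖ ≤ 1 → ‖(ρ : ℂ) * w‖ < 1 := by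
    intro ρ h0 h1 w hw
    rw [norm_mul, Complex.norm_real, Real.norm_of_nonneg h0.le]
    nlinarith [norm_nonneg w]
  have hdil : ∀ ρ : ℝ, 0 < ρ → ρ < 1 → DiffContOnCl ℂ (fun w => f (ρ * w)) (Metric.ball 0 1) := by
    intro ρ h0 h1
    refine DifferentiableOn.diffContOnCl ?_
    rw [closure_ball _ one_ne_zero]
    refine hf.comp (by fun_prop) fun w hw => ?_
    exact mem_ball_zero_iff.mpr (hin ρ h0 h1 w (mem_closedBall_zero_iff.mp hw))
  have hpt : ∀ᶠ ρ : ℝ in 𝓝[<] 1, ‖f (ρ * z)‖ ≤ (2 * Real.pi)⁻¹ *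
      ∫ θ in (0 : ℝ)..2 * Real.pi, poissonK z θ * ‖f (ρ * Complex.exp (θ * Complex.I))‖ := by
    filter_upwards [hev] with ρ hρ
    rw [poisson_formula (hdil ρ hρ.1 hρ.2) hz, norm_smul, Real.norm_of_nonneg (by positivity)]
    refine mul_le_mul_of_nonneg_left ?_ (by positivity)
    refine (intervalIntegral.norm_integral_le_integral_norm (by positivity)).trans_eq ?_
    refine intervalIntegral.integral_congr fun θ _ => ?_
    simp only [norm_smul]
    rw [Real.norm_of_nonneg (poissonK_nonneg hz θ)]
  have hlim1 : Tendsto (fun ρ : ℝ => ∫ θ in (0 : ℝ)..2 * Real.pi,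
      poissonK z θ * ‖f (ρ * Complex.exp (θ * Complex.I))‖) (𝓝[<] 1)
      (𝓝 (∫ θ in (0 : ℝ)..2 * Real.pi, poissonK z θ * ‖l θ‖)) := by
    refine intervalIntegral.tendsto_integral_filter_of_dominated_convergence
      (fun θ => poissonK z θ * c) ?_ ?_ ((hc.mul continuous_const).intervalIntegrable _ _) ?_
    · filter_upwards [hev] with ρ hρ
      refine Continuous.aestronglyMeasurable (hc.mul (Continuous.norm ?_))
      refine hf.continuousOn.comp_continuous (by fun_prop) fun θ => ?_
      exact mem_ball_zero_iff.mpr (hin ρ hρ.1 hρ.2 _ (Complex.norm_exp_ofReal_mul_I θ).le)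
    · filter_upwards [hev] with ρ hρ
      refine ae_of_all _ fun θ _ => ?_
      rw [Real.norm_of_nonneg (mul_nonneg (poissonK_nonneg hz θ) (norm_nonneg _))]
      exact mul_le_mul_of_nonneg_left
        (hb _ (hin ρ hρ.1 hρ.2 _ (Complex.norm_exp_ofReal_mul_I θ).le)) (poissonK_nonneg hz θ)
    · filter_upwards [hl] with θ hθ _ using hθ.1.norm.const_mul _
  have hfz : Tendsto (fun ρ : ℝ => ‖f (ρ * z)‖) (𝓝[<] 1) (𝓝 ‖f z‖) := by
    have h1 : ContinuousAt f z := (hf.differentiableAt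
      (Metric.isOpen_ball.mem_nhds (mem_ball_zero_iff.mpr hz))).continuousAt
    have h2 : Tendsto (fun ρ : ℝ => (ρ : ℂ) * z) (𝓝[<] 1) (𝓝 z) := by
      have : Continuous fun ρ : ℝ => (ρ : ℂ) * z := by fun_prop
      have h3 := (this.tendsto 1).mono_left (nhdsWithin_le_nhds (s := Set.Iio (1 : ℝ)))
      simpa using h3
    exact (h1.tendsto.comp h2).norm
  have h1 := le_of_tendsto_of_tendsto hfz (hlim1.const_mul (2 * Real.pi)⁻¹) hpt
  refine h1.trans ?_
  have hint : IntervalIntegrable (fun θ => a * poissonK z θ + b) volume 0 (2 * Real.pi) :=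
    ((continuous_const.mul hc).add continuous_const).intervalIntegrable _ _
  have h2 : ∫ θ in (0 : ℝ)..2 * Real.pi, poissonK z θ * ‖l θ‖ ≤
      ∫ θ in (0 : ℝ)..2 * Real.pi, (a * poissonK z θ + b) := by
    rw [intervalIntegral.integral_of_le (by positivity), intervalIntegral.integral_of_le
      (by positivity)]
    refine integral_mono_of_nonneg (ae_of_all _ fun θ => mul_nonneg (poissonK_nonneg hz θ)
      (norm_nonneg _)) hint.1 (ae_restrict_of_ae ?_)
    filter_upwards [hl] with θ hθ using hθ.2
  refine (mul_le_mul_of_nonneg_left h2 (by positivity)).trans_eq ?_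
  rw [intervalIntegral.integral_add (f := fun θ => a * poissonK z θ)
    ((continuous_const.mul hc).intervalIntegrable _ _) (continuous_const.intervalIntegrable _ _),
    intervalIntegral.integral_const_mul, intervalIntegral.integral_const, mul_add,
    mul_left_comm, integral_poissonK hz]
  simp
  field_simp

/-- The maximum principle with radial limits. -/
theorem norm_le_of_radial_limits {f : ℂ → ℂ} (hf : DifferentiableOn ℂ f (Metric.ball 0 1)) {c : ℝ}
    (hb : ∀ z : ℂ, ‖z‖ < 1 → ‖f z‖ ≤ c) {C : ℝ}
    (hlim : ∀ᵐ θ : ℝ, ∃ l : ℂ,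
      Tendsto (fun ρ : ℝ => f (ρ * Complex.exp (θ * Complex.I))) (𝓝[<] 1) (𝓝 l) ∧ ‖l‖ ≤ C)
    {z : ℂ} (hz : ‖z‖ < 1) : ‖f z‖ ≤ C := by
  have := norm_le_of_poisson_bound hf hb hz (a := C) (b := 0) ?_
  · simpa using this
  · filter_upwards [hlim] with θ ⟨l, h1, h2⟩
    refine ⟨l, h1, ?_⟩
    rw [add_zero, mul_comm C]
    exact mul_le_mul_of_nonneg_left h2 (poissonK_nonneg hz θ)

/-- If the radial limits of a bounded analytic function are close to `0` near a boundary point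
`w`, then the function itself is close to `0` near `w`. -/
lemma tendsto_zero_of_boundary {D : ℂ → ℂ} (hD : DifferentiableOn ℂ D (Metric.ball 0 1)) {c : ℝ}
    (hb : ∀ z : ℂ, ‖z‖ < 1 → ‖D z‖ ≤ c) {w : ℂ} (hw : ‖w‖ = 1)
    (hlim : ∀ η > 0, ∃ δ > 0, ∀ᵐ θ : ℝ, ∃ l : ℂ,
      Tendsto (fun ρ : ℝ => D (ρ * Complex.exp (θ * Complex.I))) (𝓝[<] 1) (𝓝 l) ∧
      (‖Complex.exp (θ * Complex.I) - w‖ < δ → ‖l‖ ≤ η)) :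
    Tendsto D (𝓝[Metric.ball 0 1] w) (𝓝 0) := by
  have hc0 : 0 ≤ c := (norm_nonneg _).trans (hb 0 (by simp))
  rw [Metric.tendsto_nhds]
  intro e he
  obtain ⟨δ, hδ, hl⟩ := hlim (e / 2) (by positivity)
  have hκ : Tendsto (fun z : ℂ => c * ((1 - ‖z‖ ^ 2) / (δ / 2) ^ 2)) (𝓝[Metric.ball 0 1] w)
      (𝓝 0) := by
    have : Continuous fun z : ℂ => c * ((1 - ‖z‖ ^ 2) / (δ / 2) ^ 2) := by fun_prop
    have h1 := (this.tendsto w).mono_left (nhdsWithin_le_nhds (s := Metric.ball (0 : ℂ) 1))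
    simpa [hw] using h1
  filter_upwards [self_mem_nhdsWithin, mem_nhdsWithin_of_mem_nhds (Metric.ball_mem_nhds w
    (half_pos hδ)), hκ.eventually (gt_mem_nhds (half_pos he))] with z hz hzw hsmall
  have hz1 : ‖z‖ < 1 := mem_ball_zero_iff.mp hz
  have hz2 : 0 ≤ 1 - ‖z‖ ^ 2 := by nlinarith [norm_nonneg z]
  rw [dist_zero_right]
  refine lt_of_le_of_lt (norm_le_of_poisson_bound hD hb hz1 (a := e / 2)
    (b := c * ((1 - ‖z‖ ^ 2) / (δ / 2) ^ 2)) ?_) (by linarith)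
  filter_upwards [hl] with θ ⟨l, h1, h2⟩
  refine ⟨l, h1, ?_⟩
  have hP := poissonK_nonneg hz1 θ
  by_cases hθ : ‖Complex.exp (θ * Complex.I) - w‖ < δ
  · have := mul_le_mul_of_nonneg_left (h2 hθ) hP
    have h3 : 0 ≤ c * ((1 - ‖z‖ ^ 2) / (δ / 2) ^ 2) := by positivity
    linarith
  · push Not at hθ
    have hlc : ‖l‖ ≤ c := by
      refine le_of_tendsto h1.norm ?_
      filter_upwards [self_mem_nhdsWithin, mem_nhdsWithin_of_mem_nhds (lt_mem_nhds one_pos)]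
        with ρ hρ1 hρ0
      refine hb _ ?_
      rw [norm_mul, Complex.norm_exp_ofReal_mul_I, mul_one, Complex.norm_real,
        Real.norm_of_nonneg (le_of_lt hρ0)]
      exact hρ1
    have h3 : δ / 2 ≤ ‖Complex.exp (θ * Complex.I) - z‖ := by
      have h4 : ‖Complex.exp (θ * Complex.I) - w‖ ≤
          ‖Complex.exp (θ * Complex.I) - z‖ + ‖z - w‖ := norm_sub_le_norm_sub_add_norm_sub _ _ _
      have h5 : ‖z - w‖ < δ / 2 := by rw [← dist_eq_norm]; exact hzw
      linarith
    have h4 : poissonK z θ ≤ (1 - ‖z‖ ^ 2) / (δ / 2) ^ 2 := by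
      unfold poissonK; gcongr
    have h5 : poissonK z θ * ‖l‖ ≤ (1 - ‖z‖ ^ 2) / (δ / 2) ^ 2 * c :=
      mul_le_mul h4 hlc (norm_nonneg _) (by positivity)
    have h6 : 0 ≤ e / 2 * poissonK z θ := by positivity
    linarith

/-- **Fatou's theorem**: a bounded analytic function on the disc has radial limits almost
everywhere. A primitive `G` is Lipschitz, so it extends to the closed disc and its boundary function
is differentiable at almost every angle. At such a point `w` the difference quotient
`D z = (G z - G w) / (z - w)` is bounded analytic with boundary values tending to some `l`, hence
tends to `l`; since `f = D + (z - w) D'`, Cauchy's estimate gives `f → l` along the radius. -/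
theorem exists_radial_limit {f : ℂ → ℂ} (hf : DifferentiableOn ℂ f (Metric.ball 0 1)) {c : ℝ}
    (hb : ∀ z : ℂ, ‖z‖ < 1 → ‖f z‖ ≤ c) :
    ∀ᵐ θ : ℝ, ∃ l : ℂ,
      Tendsto (fun ρ : ℝ => f (ρ * Complex.exp (θ * Complex.I))) (𝓝[<] 1) (𝓝 l) := by
  have hc0 : 0 ≤ c := (norm_nonneg _).trans (hb 0 (by simp))
  lift c to NNReal using hc0
  obtain ⟨G₀, hG₀⟩ := hf.isExactOn_ball
  have hLip : LipschitzOnWith c G₀ (Metric.ball 0 1) := by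
    refine Convex.lipschitzOnWith_of_nnnorm_hasDerivWithin_le (f' := f) (convex_ball 0 1)
      (fun z hz => (hG₀ z hz).hasDerivWithinAt) fun z hz => ?_
    rw [← NNReal.coe_le_coe]
    exact hb z (mem_ball_zero_iff.mp hz)
  obtain ⟨G, hGL, hGG⟩ := hLip.extend_finite_dimension
  set K := lipschitzExtensionConstant ℂ * c with hK
  have hGc : Continuous G := hGL.continuous
  have hG : ∀ z ∈ Metric.ball (0 : ℂ) 1, HasDerivAt G (f z) z := fun z hz =>
    (hG₀ z hz).congr_of_eventuallyEq
      ((hGG.symm.eventuallyEq_of_mem (Metric.isOpen_ball.mem_nhds hz)))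
  have hgL : LipschitzWith (K * 1) fun θ : ℝ => G (Complex.exp (θ * Complex.I)) := by
    refine hGL.comp ?_
    refine lipschitzWith_of_nnnorm_deriv_le (by fun_prop) fun θ => ?_
    have h1 : HasDerivAt (fun θ : ℝ => Complex.exp (θ * Complex.I))
        (Complex.exp (θ * Complex.I) * Complex.I) θ := by
      have : HasDerivAt (fun θ : ℝ => (θ : ℂ) * Complex.I) Complex.I θ := by
        simpa using (hasDerivAt_id θ).ofReal_comp.mul_const Complex.I
      exact this.cexp
    rw [h1.deriv, ← NNReal.coe_le_coe, coe_nnnorm, norm_mul, Complex.norm_exp_ofReal_mul_I]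
    simp
  filter_upwards [hgL.ae_differentiableAt_real] with θ₀ hθ₀
  set w := Complex.exp (θ₀ * Complex.I) with hw
  have hw1 : ‖w‖ = 1 := Complex.norm_exp_ofReal_mul_I θ₀
  have hw0 : w ≠ 0 := by rw [← norm_ne_zero_iff, hw1]; exact one_ne_zero
  set d := deriv (fun θ : ℝ => G (Complex.exp (θ * Complex.I))) θ₀ with hd
  set l := d / (w * Complex.I) with hl
  -- the difference quotients on the circle converge to `l`
  have hquot : Tendsto (fun ζ => (G ζ - G w) / (ζ - w)) (𝓝[Metric.sphere 0 1 \ {w}] w) (𝓝 l) := by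
    have hE : HasDerivAt (fun θ : ℝ => Complex.exp (θ * Complex.I)) (w * Complex.I) θ₀ := by
      have : HasDerivAt (fun θ : ℝ => (θ : ℂ) * Complex.I) Complex.I θ₀ := by
        simpa using (hasDerivAt_id θ₀).ofReal_comp.mul_const Complex.I
      exact this.cexp
    have h1 := (hasDerivAt_iff_tendsto_slope.mp hθ₀.hasDerivAt).div
      (hasDerivAt_iff_tendsto_slope.mp hE) (mul_ne_zero hw0 Complex.I_ne_zero)
    have h2 : Tendsto (fun ζ : ℂ => θ₀ + Complex.arg (ζ / w))
        (𝓝[Metric.sphere 0 1 \ {w}] w) (𝓝[≠] θ₀) := by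
      refine tendsto_nhdsWithin_iff.mpr ⟨?_, ?_⟩
      · have h3 : ContinuousAt (fun ζ : ℂ => θ₀ + Complex.arg (ζ / w)) w := by
          refine continuousAt_const.add (ContinuousAt.comp (g := Complex.arg) ?_
            (by fun_prop (disch := assumption)))
          refine Complex.continuousAt_arg ?_
          rw [div_self hw0]; exact Complex.one_mem_slitPlane
        have h4 := h3.tendsto.mono_left (nhdsWithin_le_nhds (s := Metric.sphere 0 1 \ {w}))
        rwa [div_self hw0, Complex.arg_one, add_zero] at h4
      · filter_upwards [self_mem_nhdsWithin] with ζ hζ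
        simp only [Set.mem_compl_iff, Set.mem_singleton_iff, add_eq_left]
        intro h0
        apply hζ.2
        have h3 := Complex.norm_mul_exp_arg_mul_I (ζ / w)
        rw [h0, norm_div, hw1, mem_sphere_zero_iff_norm.mp hζ.1] at h3
        simp only [div_one, Complex.ofReal_one, Complex.ofReal_zero, zero_mul, Complex.exp_zero,
          mul_one] at h3
        rw [Set.mem_singleton_iff]
        field_simp at h3
        exact h3.symm
    refine (h1.comp h2).congr' ?_
    filter_upwards [self_mem_nhdsWithin] with ζ hζ
    have h3 : Complex.exp (((θ₀ + Complex.arg (ζ / w) : ℝ) : ℂ) * Complex.I) = ζ := by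
      have h3 := Complex.norm_mul_exp_arg_mul_I (ζ / w)
      rw [norm_div, hw1, mem_sphere_zero_iff_norm.mp hζ.1] at h3
      rw [Complex.ofReal_add, add_mul, Complex.exp_add, ← hw]
      simp only [div_one, Complex.ofReal_one, one_mul] at h3
      rw [h3]; field_simp
    have h4 : Complex.arg (ζ / w) ≠ 0 := by
      intro h0
      rw [h0, add_zero, ← hw] at h3
      exact hζ.2 h3.symm
    have h4' : ((Complex.arg (ζ / w) : ℝ) : ℂ) ≠ 0 := by exact_mod_cast h4
    have h5 : ζ - w ≠ 0 := sub_ne_zero.mpr hζ.2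
    simp only [Function.comp_apply, Pi.div_apply, slope_def_module, h3, ← hw, add_sub_cancel_left,
      Complex.real_smul, Complex.ofReal_inv]
    field_simp
  -- the difference quotient inside the disc
  set D : ℂ → ℂ := fun z => (G z - G w) / (z - w) with hDdef
  have hne : ∀ z : ℂ, ‖z‖ < 1 → z - w ≠ 0 := fun z hz h => by
    rw [sub_eq_zero.mp h, hw1] at hz; exact lt_irrefl _ hz
  have hDd : ∀ z ∈ Metric.ball (0 : ℂ) 1, HasDerivAt D
      ((f z * (z - w) - (G z - G w) * 1) / (z - w) ^ 2) z := fun z hz =>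
    ((hG z hz).sub_const _).div ((hasDerivAt_id z).sub_const w) (hne z (mem_ball_zero_iff.mp hz))
  have hDb : ∀ z : ℂ, ‖z‖ < 1 → ‖D z‖ ≤ K := fun z hz => by
    rw [hDdef, norm_div, div_le_iff₀ (norm_pos_iff.mpr (hne z hz)), ← dist_eq_norm, ← dist_eq_norm]
    exact hGL.dist_le_mul _ _
  have hDl : Tendsto (fun z => D z - l) (𝓝[Metric.ball 0 1] w) (𝓝 0) := by
    refine tendsto_zero_of_boundary (c := K + ‖l‖)
      (fun z hz => ((hDd z hz).differentiableAt.sub_const l).differentiableWithinAt)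
      (fun z hz => (norm_sub_le _ _).trans (by gcongr; exact hDb z hz)) hw1 fun η hη => ?_
    obtain ⟨δ, hδ, hδ1⟩ := Metric.mem_nhdsWithin_iff.mp
      (Metric.tendsto_nhds.mp hquot η hη)
    refine ⟨δ, hδ, ?_⟩
    have hcount : ∀ᵐ θ : ℝ, Complex.exp (θ * Complex.I) ≠ w := by
      have : {θ : ℝ | ¬ Complex.exp (θ * Complex.I) ≠ w} ⊆
          Set.range fun n : ℤ => θ₀ + n * (2 * Real.pi) := by
        intro θ hθ
        simp only [Set.mem_ofPred_eq, not_not] at hθ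
        rw [hw, Complex.exp_eq_exp_iff_exists_int] at hθ
        obtain ⟨n, hn⟩ := hθ
        refine ⟨n, ?_⟩
        have h1 : (θ : ℂ) * Complex.I = ((θ₀ + n * (2 * Real.pi) : ℝ) : ℂ) * Complex.I := by
          rw [hn]; push_cast; ring
        exact_mod_cast (mul_right_cancel₀ Complex.I_ne_zero h1).symm
      exact (Set.countable_range _).mono this |>.measure_zero _
    filter_upwards [hcount] with θ hθ
    refine ⟨D (Complex.exp (θ * Complex.I)) - l, ?_, fun hclose => ?_⟩
    · have h1 : ContinuousAt (fun z => D z - l) (Complex.exp (θ * Complex.I)) := by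
        refine ContinuousAt.sub (ContinuousAt.div ?_ (by fun_prop) (sub_ne_zero.mpr hθ))
          continuousAt_const
        exact (hGc.sub continuous_const).continuousAt
      have h2 : Tendsto (fun ρ : ℝ => (ρ : ℂ) * Complex.exp (θ * Complex.I)) (𝓝[<] 1)
          (𝓝 (Complex.exp (θ * Complex.I))) := by
        have : Continuous fun ρ : ℝ => (ρ : ℂ) * Complex.exp (θ * Complex.I) := by fun_prop
        have h3 := (this.tendsto 1).mono_left (nhdsWithin_le_nhds (s := Set.Iio (1 : ℝ)))
        simpa using h3
      exact h1.tendsto.comp h2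
    · have h1 : dist (D (Complex.exp (θ * Complex.I))) l < η := by
        refine hδ1 ⟨?_, ?_, hθ⟩
        · rw [Metric.mem_ball, dist_eq_norm]; exact hclose
        · rw [mem_sphere_zero_iff_norm]; exact Complex.norm_exp_ofReal_mul_I θ
      rw [← dist_eq_norm]; exact h1.le
  -- along the radius, Cauchy's estimate on the disc of radius `(1 - ρ) / 2` about `z = ρ w`
  refine ⟨l, ?_⟩
  rw [Metric.tendsto_nhds]
  intro e he
  obtain ⟨δ, hδ, hδ1⟩ := Metric.mem_nhdsWithin_iff.mp
    (Metric.tendsto_nhds.mp hDl (e / 4) (by positivity))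
  have hsm : ∀ z : ℂ, ‖z‖ < 1 → ‖z - w‖ < δ → ‖D z - l‖ < e / 4 := fun z hz hzw => by
    have := hδ1 ⟨by rw [Metric.mem_ball, dist_eq_norm]; exact hzw, mem_ball_zero_iff.mpr hz⟩
    simpa [dist_eq_norm] using this
  filter_upwards [self_mem_nhdsWithin, mem_nhdsWithin_of_mem_nhds (lt_mem_nhds one_pos),
    mem_nhdsWithin_of_mem_nhds (lt_mem_nhds (show 1 - δ / 2 < 1 by linarith))] with ρ hρ1 hρ0 hρδ
  have hρ1' : ρ < 1 := hρ1
  set z := (ρ : ℂ) * w with hz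
  have hzn : ‖z‖ = ρ := by
    rw [hz, norm_mul, hw1, mul_one, Complex.norm_real, Real.norm_of_nonneg hρ0.le]
  have hzw : ‖z - w‖ = 1 - ρ := by
    have : z - w = ((ρ - 1 : ℝ) : ℂ) * w := by rw [hz]; push_cast; ring
    rw [this, norm_mul, hw1, mul_one, Complex.norm_real, Real.norm_eq_abs, abs_sub_comm,
      abs_of_pos (by linarith)]
  have hz1 : ‖z‖ < 1 := by rw [hzn]; exact hρ1
  have hzb : z ∈ Metric.ball (0 : ℂ) 1 := mem_ball_zero_iff.mpr hz1
  have hR : 0 < (1 - ρ) / 2 := by linarith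
  have hclose : ∀ ζ : ℂ, ‖ζ - z‖ ≤ (1 - ρ) / 2 → ‖ζ‖ < 1 ∧ ‖ζ - w‖ < δ := by
    intro ζ hζ
    constructor
    · have : ‖ζ‖ ≤ ‖ζ - z‖ + ‖z‖ := by simpa using norm_add_le (ζ - z) z
      rw [hzn] at this; linarith
    · have : ‖ζ - w‖ ≤ ‖ζ - z‖ + ‖z - w‖ := norm_sub_le_norm_sub_add_norm_sub _ _ _
      rw [hzw] at this; linarith
  have hcauchy : ‖deriv (fun ζ => D ζ - l) z‖ ≤ e / 4 / ((1 - ρ) / 2) := by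
    refine Complex.norm_deriv_le_of_forall_mem_sphere_norm_le hR ?_ fun ζ hζ => ?_
    · refine DifferentiableOn.diffContOnCl fun ζ hζ => ?_
      rw [closure_ball _ hR.ne', mem_closedBall_iff_norm] at hζ
      exact ((hDd ζ (mem_ball_zero_iff.mpr (hclose ζ hζ).1)).differentiableAt.sub_const
        l).differentiableWithinAt
    · have := hclose ζ (mem_sphere_iff_norm.mp hζ).le
      exact (hsm ζ this.1 this.2).le
  have hder : deriv (fun ζ => D ζ - l) z =
      (f z * (z - w) - (G z - G w) * 1) / (z - w) ^ 2 := ((hDd z hzb).sub_const l).deriv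
  have hfz : f z - l = (D z - l) + (z - w) * deriv (fun ζ => D ζ - l) z := by
    rw [hder, hDdef]
    have := hne z hz1
    field_simp
    ring
  have h1 : ‖D z - l‖ < e / 4 := by
    have := hclose z (by simpa using hR.le)
    exact hsm z this.1 this.2
  change dist (f z) l < e
  rw [dist_eq_norm, hfz]
  calc ‖(D z - l) + (z - w) * deriv (fun ζ => D ζ - l) z‖
      ≤ ‖D z - l‖ + (1 - ρ) * (e / 4 / ((1 - ρ) / 2)) := by
        refine (norm_add_le _ _).trans ?_
        rw [norm_mul, hzw]
        gcongr
    _ = ‖D z - l‖ + e / 2 := by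
        have : 1 - ρ ≠ 0 := by linarith
        field_simp
        ring
    _ < e := by linarith

end Boundary

/-! ### Power series in an isometry -/

section VonNeumann

variable {H : Type*} [NormedAddCommGroup H] [InnerProductSpace ℂ H]

/-- The character `exp (i m θ)`. -/
noncomputable def expI (m : ℤ) (θ : ℝ) : ℂ := Complex.exp ((m * θ : ℝ) * Complex.I)

lemma norm_expI (m : ℤ) (θ : ℝ) : ‖expI m θ‖ = 1 := Complex.norm_exp_ofReal_mul_I _

@[fun_prop] lemma continuous_expI (m : ℤ) : Continuous (expI m) := by
  unfold expI; fun_prop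

lemma expI_mul (m n : ℤ) (θ : ℝ) : expI m θ * expI n θ = expI (m + n) θ := by
  rw [expI, expI, expI, ← Complex.exp_add]; congr 1; push_cast; ring

lemma conj_expI (m : ℤ) (θ : ℝ) : (starRingEnd ℂ) (expI m θ) = expI (-m) θ := by
  rw [expI, expI, ← Complex.exp_conj]; congr 1; simp

lemma integral_expI (m : ℤ) :
    ∫ θ in (0 : ℝ)..2 * Real.pi, expI m θ = if m = 0 then 2 * (Real.pi : ℂ) else 0 := by
  split_ifs with h
  · simp [h, expI]
  · have h1 : ∀ θ : ℝ, expI m θ = Complex.exp ((m * Complex.I) * θ) := fun θ => by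
      rw [expI]; congr 1; push_cast; ring
    have hm : (m : ℂ) * Complex.I ≠ 0 :=
      mul_ne_zero (by exact_mod_cast h) Complex.I_ne_zero
    simp_rw [h1]
    rw [integral_exp_mul_complex hm]
    have h2 : (m : ℂ) * Complex.I * ((2 * Real.pi : ℝ) : ℂ) = m * (2 * Real.pi * Complex.I) := by
      push_cast; ring
    rw [h2, Complex.exp_int_mul_two_pi_mul_I]
    simp

lemma hasSum_integral_series {E : Type*} [NormedAddCommGroup E] [NormedSpace ℂ E]
    [CompleteSpace E] {f : ℕ → ℝ → E} {u : ℕ → ℝ} (hf : ∀ k, Continuous (f k))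
    (hu : Summable u) (hb : ∀ k θ, ‖f k θ‖ ≤ u k) (a b : ℝ) :
    HasSum (fun k => ∫ θ in a..b, f k θ) (∫ θ in a..b, ∑' k, f k θ) :=
  intervalIntegral.hasSum_integral_of_dominated_convergence (fun k _ => u k)
    (fun k => (hf k).aestronglyMeasurable) (fun k => ae_of_all _ fun θ _ => hb k θ)
    (ae_of_all _ fun _ _ => hu) intervalIntegrable_const
    (ae_of_all _ fun θ _ => (Summable.of_norm_bounded hu fun k => hb k θ).hasSum)

/-- The resolvent orbit `∑ r^k exp (-i k θ) V^k x`. -/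
noncomputable def orbit (V : H →L[ℂ] H) (r : ℝ) (x : H) (θ : ℝ) : H :=
  ∑' k : ℕ, ((r : ℂ) ^ k * expI (-k) θ) • (V ^ k) x

variable {V : H →L[ℂ] H} {r : ℝ}

lemma norm_pow_apply (hV : ∀ x, ‖V x‖ = ‖x‖) (k : ℕ) (x : H) : ‖(V ^ k) x‖ = ‖x‖ := by
  induction k with
  | zero => simp
  | succ k ih => rw [pow_succ', mul_apply_eq_comp, hV, ih]

lemma norm_orbit_term (hV : ∀ x, ‖V x‖ = ‖x‖) (hr : 0 ≤ r) (x : H) (k : ℕ) (m : ℤ) (θ : ℝ) :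
    ‖((r : ℂ) ^ k * expI m θ) • (V ^ k) x‖ = r ^ k * ‖x‖ := by
  rw [norm_smul, norm_mul, norm_expI, mul_one, norm_pow, Complex.norm_real,
    Real.norm_of_nonneg hr, norm_pow_apply hV]

lemma summable_orbit {E : Type*} [NormedAddCommGroup E] (hr : 0 ≤ r) (hr1 : r < 1) (x : E) :
    Summable fun k : ℕ => r ^ k * ‖x‖ :=
  (summable_geometric_of_lt_one hr hr1).mul_right _

lemma norm_orbit_le (hV : ∀ x, ‖V x‖ = ‖x‖) (hr : 0 ≤ r) (hr1 : r < 1) (x : H) (θ : ℝ) :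
    ‖orbit V r x θ‖ ≤ (1 - r)⁻¹ * ‖x‖ := by
  unfold orbit
  refine (tsum_of_norm_bounded ((hasSum_geometric_of_lt_one hr hr1).mul_right ‖x‖) fun k => ?_)
  exact (norm_orbit_term hV hr x k _ θ).le

variable [CompleteSpace H]

lemma continuous_orbit (hV : ∀ x, ‖V x‖ = ‖x‖) (hr : 0 ≤ r) (hr1 : r < 1) (x : H) :
    Continuous (orbit V r x) := by
  unfold orbit
  refine continuous_tsum (fun k => by fun_prop) (summable_orbit hr hr1 x) fun k θ => ?_
  exact (norm_orbit_term hV hr x k _ θ).le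

lemma orbit_coeff (hV : ∀ x, ‖V x‖ = ‖x‖) (hr : 0 ≤ r) (hr1 : r < 1) (x : H) (m : ℕ) :
    ∫ θ in (0 : ℝ)..2 * Real.pi, expI m θ • orbit V r x θ =
      (2 * (Real.pi : ℂ)) • ((r : ℂ) ^ m • (V ^ m) x) := by
  have h1 := hasSum_integral_series
    (f := fun k θ => expI m θ • ((r : ℂ) ^ k * expI (-k) θ) • (V ^ k) x)
    (fun k => by fun_prop) (summable_orbit hr hr1 x)
    (fun k θ => by rw [norm_smul, norm_expI, one_mul, norm_orbit_term hV hr]) 0 (2 * Real.pi)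
  have h2 : ∀ θ, ∑' k : ℕ, expI m θ • ((r : ℂ) ^ k * expI (-k) θ) • (V ^ k) x =
      expI m θ • orbit V r x θ := fun θ => tsum_const_smul'' _
  simp only [h2] at h1
  have h3 : ∀ k : ℕ, ∫ θ in (0 : ℝ)..2 * Real.pi,
      expI m θ • ((r : ℂ) ^ k * expI (-k) θ) • (V ^ k) x =
      if k = m then (2 * (Real.pi : ℂ)) • ((r : ℂ) ^ m • (V ^ m) x) else 0 := by
    intro k
    have h4 : ∀ θ, expI m θ • ((r : ℂ) ^ k * expI (-k) θ) • (V ^ k) x =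
        expI (m - k) θ • ((r : ℂ) ^ k • (V ^ k) x) := fun θ => by
      rw [smul_smul, smul_smul, mul_left_comm, expI_mul, ← sub_eq_add_neg, mul_comm]
    simp_rw [h4]
    rw [intervalIntegral.integral_smul_const, integral_expI]
    by_cases hk : k = m
    · subst hk; simp
    · rw [if_neg hk, if_neg (by omega), zero_smul]
  simp only [h3] at h1
  exact h1.unique (hasSum_ite_eq m _)

/-- Pairing an orbit with a function `F` whose nonnegative Fourier coefficients are
`2π r^m V^m a`. -/
lemma integral_inner_orbit (hV : ∀ x, ‖V x‖ = ‖x‖) (hr : 0 ≤ r) (hr1 : r < 1) (a : H)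
    {F : ℝ → H} (hF : Continuous F) {C : ℝ} (hFb : ∀ θ, ‖F θ‖ ≤ C)
    (hcoef : ∀ m : ℕ, ∫ θ in (0 : ℝ)..2 * Real.pi, expI m θ • F θ =
      (2 * (Real.pi : ℂ)) • ((r : ℂ) ^ m • (V ^ m) a)) :
    ∫ θ in (0 : ℝ)..2 * Real.pi, inner ℂ (orbit V r a θ) (F θ) =
      (((2 * Real.pi) * (1 - r ^ 2)⁻¹ * ‖a‖ ^ 2 : ℝ) : ℂ) := by
  have h1 := hasSum_integral_series
    (f := fun (k : ℕ) θ => (inner ℂ (((r : ℂ) ^ k * expI (-k) θ) • (V ^ k) a) (F θ) : ℂ))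
    (u := fun k => r ^ k * ‖a‖ * C)
    (fun k => by fun_prop) ((summable_orbit hr hr1 a).mul_right C)
    (fun k θ => by
      refine (norm_inner_le_norm _ _).trans ?_
      rw [norm_orbit_term hV hr]
      exact mul_le_mul_of_nonneg_left (hFb θ) (by positivity)) 0 (2 * Real.pi)
  have h2 : ∀ θ, ∑' k : ℕ, (inner ℂ (((r : ℂ) ^ k * expI (-k) θ) • (V ^ k) a) (F θ) : ℂ) =
      inner ℂ (orbit V r a θ) (F θ) := by
    intro θ
    have hs : HasSum (fun k : ℕ => ((r : ℂ) ^ k * expI (-k) θ) • (V ^ k) a) (orbit V r a θ) :=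
      (Summable.of_norm_bounded (summable_orbit hr hr1 a) fun k =>
        (norm_orbit_term hV hr a k _ θ).le).hasSum
    exact (hs.mapL (innerSLFlip ℂ (F θ))).tsum_eq
  simp only [h2] at h1
  have h3 : ∀ k : ℕ, ∫ θ in (0 : ℝ)..2 * Real.pi,
      (inner ℂ (((r : ℂ) ^ k * expI (-k) θ) • (V ^ k) a) (F θ) : ℂ) =
      (((2 * Real.pi) * ((r ^ 2) ^ k) * ‖a‖ ^ 2 : ℝ) : ℂ) := by
    intro k
    have h4 : ∀ θ, (inner ℂ (((r : ℂ) ^ k * expI (-k) θ) • (V ^ k) a) (F θ) : ℂ) =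
        innerSL ℂ ((r : ℂ) ^ k • (V ^ k) a) (expI k θ • F θ) := fun θ => by
      rw [innerSL_apply_apply, inner_smul_left, inner_smul_left, inner_smul_right, map_mul,
        conj_expI, neg_neg]
      ring
    simp_rw [h4]
    have hint : IntervalIntegrable (fun θ => expI k θ • F θ) volume 0 (2 * Real.pi) :=
      Continuous.intervalIntegrable (by fun_prop) _ _
    rw [ContinuousLinearMap.intervalIntegral_comp_comm _ hint, hcoef, innerSL_apply_apply,
      inner_smul_right, inner_self_eq_norm_sq_to_K, norm_smul, norm_pow, Complex.norm_real,
      norm_pow_apply hV, Real.norm_of_nonneg hr]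
    push_cast
    simp only [Complex.coe_algebraMap]
    ring
  simp only [h3] at h1
  refine h1.unique ?_
  have h4 := (hasSum_geometric_of_lt_one (sq_nonneg r) (by nlinarith : r ^ 2 < 1)).mul_left
    (2 * Real.pi) |>.mul_right (‖a‖ ^ 2)
  exact_mod_cast h4

/-- **Von Neumann's inequality** for operator coefficients that commute with the isometry: if the
symbol `∑ exp (i k θ) A_k` is contractive on the circle, then `∑ r^k A_k V^k` is a contraction. The
symbol is applied to the orbit of `x`; the nonnegative Fourier coefficients of the result are those
of the orbit of `a = ∑ r^k A_k V^k x`, so pairing it with that orbit compares `‖a‖` with `‖x‖`. -/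
theorem norm_series_isometry_le (hV : ∀ x, ‖V x‖ = ‖x‖) (hr : 0 ≤ r) (hr1 : r < 1)
    {A : ℕ → H →L[ℂ] H} (hcomm : ∀ k x, A k (V x) = V (A k x)) (hA : Summable fun k => ‖A k‖)
    (hp : ∀ θ x, ‖∑' k : ℕ, expI k θ • A k x‖ ≤ ‖x‖) (x : H) :
    ‖∑' k, (r : ℂ) ^ k • A k ((V ^ k) x)‖ ≤ ‖x‖ := by
  have hcomm' : ∀ k m y, A k ((V ^ m) y) = (V ^ m) (A k y) := by
    intro k m y
    induction m with
    | zero => simp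
    | succ m ih => rw [pow_succ', mul_apply_eq_comp, mul_apply_eq_comp,
        hcomm, ih]
  set a := ∑' k, (r : ℂ) ^ k • A k ((V ^ k) x) with ha
  have hasum : HasSum (fun k => (r : ℂ) ^ k • A k ((V ^ k) x)) a := by
    refine (Summable.of_norm_bounded (hA.mul_right ‖x‖) fun k => ?_).hasSum
    rw [norm_smul, norm_pow, Complex.norm_real, Real.norm_of_nonneg hr]
    calc r ^ k * ‖A k ((V ^ k) x)‖ ≤ 1 * ‖A k ((V ^ k) x)‖ := by
          gcongr; exact pow_le_one₀ hr hr1.le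
      _ ≤ ‖A k‖ * ‖x‖ := by
          rw [one_mul]
          refine ((A k).le_opNorm _).trans_eq ?_
          rw [norm_pow_apply hV]
  set F : ℝ → H := fun θ => ∑' k : ℕ, expI k θ • A k (orbit V r x θ) with hF
  have hob := norm_orbit_le hV hr hr1 x
  have htb : ∀ (k : ℕ) θ, ‖expI k θ • A k (orbit V r x θ)‖ ≤ ‖A k‖ * ((1 - r)⁻¹ * ‖x‖) := by
    intro k θ
    rw [norm_smul, norm_expI, one_mul]
    exact ((A k).le_opNorm _).trans (by gcongr; exact hob θ)
  have hoc := continuous_orbit hV hr hr1 x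
  have hFc : Continuous F := continuous_tsum (fun k => by fun_prop) (hA.mul_right _) htb
  have hFle : ∀ θ, ‖F θ‖ ≤ ‖orbit V r x θ‖ := fun θ => hp θ _
  have hFb : ∀ θ, ‖F θ‖ ≤ (1 - r)⁻¹ * ‖x‖ := fun θ => (hFle θ).trans (hob θ)
  have hcoef : ∀ m : ℕ, ∫ θ in (0 : ℝ)..2 * Real.pi, expI m θ • F θ =
      (2 * (Real.pi : ℂ)) • ((r : ℂ) ^ m • (V ^ m) a) := by
    intro m
    have h1 := hasSum_integral_series (f := fun (k : ℕ) θ => expI m θ • expI k θ •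
      A k (orbit V r x θ)) (fun k => by fun_prop) (hA.mul_right ((1 - r)⁻¹ * ‖x‖))
      (fun k θ => by rw [norm_smul, norm_expI, one_mul]; exact htb k θ) 0 (2 * Real.pi)
    have h2 : ∀ θ, ∑' k : ℕ, expI m θ • expI k θ • A k (orbit V r x θ) = expI m θ • F θ :=
      fun θ => tsum_const_smul'' _
    simp only [h2] at h1
    refine h1.unique ?_
    have h3 : ∀ k : ℕ, ∫ θ in (0 : ℝ)..2 * Real.pi, expI m θ • expI k θ • A k (orbit V r x θ) =
        (2 * (Real.pi : ℂ)) • ((r : ℂ) ^ m • (V ^ m) ((r : ℂ) ^ k • A k ((V ^ k) x))) := by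
      intro k
      have h4 : ∀ θ, expI m θ • expI k θ • A k (orbit V r x θ) =
          A k (expI ((m + k : ℕ) : ℤ) θ • orbit V r x θ) := fun θ => by
        rw [smul_smul, expI_mul, map_smul]; push_cast; rfl
      simp_rw [h4]
      rw [ContinuousLinearMap.intervalIntegral_comp_comm _
        (Continuous.intervalIntegrable (by fun_prop) _ _), orbit_coeff hV hr hr1, map_smul,
        map_smul, hcomm', map_smul, hcomm', pow_add, pow_add, mul_apply_eq_comp,
        smul_smul ((r : ℂ) ^ m)]
    simp only [h3]
    exact (((hasum.mapL (V ^ m)).const_smul ((r : ℂ) ^ m)).const_smul (2 * (Real.pi : ℂ)))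
  have hself : ∀ y : H, ∫ θ in (0 : ℝ)..2 * Real.pi, ‖orbit V r y θ‖ ^ 2 =
      (2 * Real.pi) * (1 - r ^ 2)⁻¹ * ‖y‖ ^ 2 := by
    intro y
    have h1 := integral_inner_orbit hV hr hr1 y (continuous_orbit hV hr hr1 y)
      (norm_orbit_le hV hr hr1 y) (orbit_coeff hV hr hr1 y)
    have h2 : ∀ θ, (inner ℂ (orbit V r y θ) (orbit V r y θ) : ℂ) =
        ((‖orbit V r y θ‖ ^ 2 : ℝ) : ℂ) := fun θ => by
      rw [inner_self_eq_norm_sq_to_K]; simp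
    simp only [h2, intervalIntegral.integral_ofReal] at h1
    exact_mod_cast h1
  have hac := continuous_orbit hV hr hr1 a
  have hpair : ∫ θ in (0 : ℝ)..2 * Real.pi, (inner ℂ (orbit V r a θ) (F θ)).re =
      (2 * Real.pi) * (1 - r ^ 2)⁻¹ * ‖a‖ ^ 2 := by
    have h1 := integral_inner_orbit hV hr hr1 a hFc hFb hcoef
    have h2 : IntervalIntegrable (fun θ => (inner ℂ (orbit V r a θ) (F θ) : ℂ)) volume 0
        (2 * Real.pi) := Continuous.intervalIntegrable (by fun_prop) _ _
    have h3 := Complex.reCLM.intervalIntegral_comp_comm h2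
    simp only [Complex.reCLM_apply] at h3
    rw [h3, h1, Complex.ofReal_re]
  have hle : ∫ θ in (0 : ℝ)..2 * Real.pi, 2 * (inner ℂ (orbit V r a θ) (F θ)).re ≤
      ∫ θ in (0 : ℝ)..2 * Real.pi, (‖orbit V r a θ‖ ^ 2 + ‖orbit V r x θ‖ ^ 2) := by
    refine intervalIntegral.integral_mono_on (by positivity)
      (Continuous.intervalIntegrable (by fun_prop) _ _)
      (Continuous.intervalIntegrable (by fun_prop) _ _) fun θ _ => ?_
    have h1 : (inner ℂ (orbit V r a θ) (F θ)).re ≤ ‖orbit V r a θ‖ * ‖orbit V r x θ‖ :=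
      (Complex.re_le_norm _).trans ((norm_inner_le_norm _ _).trans
        (mul_le_mul_of_nonneg_left (hFle θ) (norm_nonneg _)))
    nlinarith [sq_nonneg (‖orbit V r a θ‖ - ‖orbit V r x θ‖)]
  rw [intervalIntegral.integral_const_mul, hpair, intervalIntegral.integral_add
    (Continuous.intervalIntegrable (by fun_prop) _ _)
    (Continuous.intervalIntegrable (by fun_prop) _ _), hself, hself] at hle
  have hpos : 0 < (2 * Real.pi) * (1 - r ^ 2)⁻¹ := by
    have : 0 < 1 - r ^ 2 := by nlinarith
    positivity
  rw [← sq_le_sq₀ (norm_nonneg _) (norm_nonneg _)]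
  refine le_of_mul_le_mul_left ?_ hpos
  linarith

end VonNeumann

/-! ### Weak limits of contractions -/

section WeakLimit

variable {H : Type*} [NormedAddCommGroup H] [InnerProductSpace ℂ H] [CompleteSpace H]

/-- Weak operator compactness of the set of contractions. -/
theorem exists_weak_limit {ι : Type*} (l : Filter ι) [l.NeBot] (T : ι → H →L[ℂ] H)
    (hT : ∀ i x, ‖T i x‖ ≤ ‖x‖) :
    ∃ (T₀ : H →L[ℂ] H) (𝒰 : Ultrafilter ι), (𝒰 : Filter ι) ≤ l ∧ (∀ x, ‖T₀ x‖ ≤ ‖x‖) ∧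
      ∀ x y, Tendsto (fun i => (inner ℂ (T i x) y : ℂ)) 𝒰 (𝓝 (inner ℂ (T₀ x) y)) := by
  set 𝒰 := Ultrafilter.of l with h𝒰
  have hb : ∀ i x y, ‖(inner ℂ (T i x) y : ℂ)‖ ≤ ‖x‖ * ‖y‖ := fun i x y =>
    (norm_inner_le_norm _ _).trans (mul_le_mul_of_nonneg_right (hT i x) (norm_nonneg _))
  have hex : ∀ x y, ∃ c : ℂ, Tendsto (fun i => (inner ℂ (T i x) y : ℂ)) 𝒰 (𝓝 c) := by
    intro x y
    obtain ⟨c, -, hc⟩ := (isCompact_closedBall (0 : ℂ) (‖x‖ * ‖y‖)).ultrafilter_le_nhds'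
      (𝒰.map fun i => (inner ℂ (T i x) y : ℂ)) (by
        rw [Ultrafilter.mem_map]
        exact Filter.mem_of_superset Filter.univ_mem fun i _ =>
          mem_closedBall_zero_iff.mpr (hb i x y))
    exact ⟨c, hc⟩
  choose B hB using hex
  let B' : H →L⋆[ℂ] H →L[ℂ] ℂ := LinearMap.mkContinuous₂
    (LinearMap.mk₂'ₛₗ (starRingEnd ℂ) (RingHom.id ℂ) B
      (fun x₁ x₂ y => tendsto_nhds_unique (hB _ _) (by
        simpa only [map_add, inner_add_left] using (hB x₁ y).add (hB x₂ y)))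
      (fun c x y => tendsto_nhds_unique (hB _ _) (by
        simpa only [map_smul, inner_smul_left, smul_eq_mul] using (hB x y).const_mul _))
      (fun x y₁ y₂ => tendsto_nhds_unique (hB _ _) (by
        simpa only [inner_add_right] using (hB x y₁).add (hB x y₂)))
      (fun c x y => tendsto_nhds_unique (hB _ _) (by
        simpa only [inner_smul_right, smul_eq_mul, RingHom.id_apply] using (hB x y).const_mul c))) 1
    (fun x y => by
      rw [one_mul]
      exact le_of_tendsto (hB x y).norm (Eventually.of_forall fun i => hb i x y))
  have hB' : ∀ x y, (inner ℂ (InnerProductSpace.continuousLinearMapOfBilin B' x) y : ℂ) = B x y :=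
    fun x y => InnerProductSpace.continuousLinearMapOfBilin_apply B' x y
  refine ⟨InnerProductSpace.continuousLinearMapOfBilin B', 𝒰, Ultrafilter.of_le l, fun x => ?_,
    fun x y => by rw [hB']; exact hB x y⟩
  set w := InnerProductSpace.continuousLinearMapOfBilin B' x with hw
  have h1 : ‖w‖ ^ 2 ≤ ‖x‖ * ‖w‖ := by
    have h2 : ‖(inner ℂ w w : ℂ)‖ = ‖w‖ ^ 2 := by
      rw [inner_self_eq_norm_sq_to_K]; simp
    rw [← h2, hw, hB', ← hw]
    exact le_of_tendsto (hB x w).norm (Eventually.of_forall fun i => hb i x w)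
  rcases (norm_nonneg w).eq_or_lt with h0 | h0
  · rw [← h0]; positivity
  · exact le_of_mul_le_mul_right (by rw [← pow_two]; exact h1) h0

end WeakLimit

/-! ### Translations and the all-pass operator on square-integrable signals -/

section Shift

variable {n : ℕ}

/-- Delay by `r`: the signal `t ↦ f (t - r)`. -/
noncomputable def shift (n : ℕ) (r : ℝ) : L2Signal n →ₗᵢ[ℂ] L2Signal n :=
  Lp.compMeasurePreservingₗᵢ ℂ (fun t => t - r) (measurePreserving_sub_right volume r)

lemma coeFn_shift (r : ℝ) (f : L2Signal n) : ∀ᵐ t : ℝ, shift n r f t = f (t - r) :=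
  Lp.coeFn_compMeasurePreserving f (measurePreserving_sub_right volume r)

lemma ae_sub_right {p : ℝ → Prop} (r : ℝ) (h : ∀ᵐ t : ℝ, p t) : ∀ᵐ t : ℝ, p (t - r) :=
  (measurePreserving_sub_right volume r).quasiMeasurePreserving.ae h

lemma shift_shift (r s : ℝ) (f : L2Signal n) : shift n r (shift n s f) = shift n (r + s) f := by
  refine Lp.ext ?_
  filter_upwards [coeFn_shift r (shift n s f), ae_sub_right r (coeFn_shift s f),
    coeFn_shift (r + s) f] with t h1 h2 h3
  rw [h1, h2, h3]; congr 1; ring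

@[fun_prop] lemma continuous_shift (f : L2Signal n) : Continuous fun r => shift n r f := by
  have hg : Continuous fun r : ℝ => (⟨fun t : ℝ => t - r, by fun_prop⟩ : C(ℝ, ℝ)) :=
    ContinuousMap.continuous_of_continuous_uncurry _ (by
      simp only [Function.uncurry_def, ContinuousMap.coe_mk]; fun_prop)
  exact Continuous.compMeasurePreservingLp (continuous_const (y := f)) hg
    (fun r => measurePreserving_sub_right volume r) (by simp)

lemma norm_exp_shift {a : ℝ} (f : L2Signal n) (r : ℝ) :
    ‖((Real.exp (-a * r) : ℝ) : ℂ) • shift n r f‖ = Real.exp (-a * r) * ‖f‖ := by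
  rw [norm_smul, LinearIsometry.norm_map, Complex.norm_real, Real.norm_of_nonneg
    (Real.exp_pos _).le]

lemma integrableOn_exp_shift {a : ℝ} (ha : 0 < a) (f : L2Signal n) (h : ℝ) :
    IntegrableOn (fun r : ℝ => ((Real.exp (-a * r) : ℝ) : ℂ) • shift n r f) (Set.Ioi h) := by
  refine Integrable.mono' ((integrableOn_exp_mul_Ioi (by linarith : -a < 0) h).mul_const ‖f‖)
    (Continuous.aestronglyMeasurable (by fun_prop)) (ae_of_all _ fun r => ?_)
  exact (norm_exp_shift f r).le

/-- The stable first-order lag `(s + a)⁻¹`, as the Bochner integral `∫₀^∞ exp (-a r) f (· - r) dr`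
of translates. -/
noncomputable def lag (n : ℕ) {a : ℝ} (ha : 0 < a) : L2Signal n →L[ℂ] L2Signal n :=
  LinearMap.mkContinuous
    { toFun := fun f => ∫ r in Set.Ioi (0 : ℝ), ((Real.exp (-a * r) : ℝ) : ℂ) • shift n r f
      map_add' := fun f g => by
        rw [← integral_add (integrableOn_exp_shift ha f 0) (integrableOn_exp_shift ha g 0)]
        simp only [map_add, smul_add]
      map_smul' := fun c f => by
        rw [RingHom.id_apply, ← integral_smul]
        simp only [map_smul, smul_comm c] }
    a⁻¹
    (fun f => by
      refine (norm_integral_le_integral_norm _).trans ?_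
      simp only [norm_exp_shift, integral_mul_const]
      rw [integral_exp_mul_Ioi (by linarith : -a < 0)]
      simp)

variable {a : ℝ} (ha : 0 < a)

lemma lag_apply (f : L2Signal n) :
    lag n ha f = ∫ r in Set.Ioi (0 : ℝ), ((Real.exp (-a * r) : ℝ) : ℂ) • shift n r f := rfl

lemma map_lag {E : Type*} [NormedAddCommGroup E] [NormedSpace ℂ E] [CompleteSpace E]
    (L : L2Signal n →L[ℂ] E) (f : L2Signal n) :
    L (lag n ha f) = ∫ r in Set.Ioi (0 : ℝ), ((Real.exp (-a * r) : ℝ) : ℂ) • L (shift n r f) := by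
  rw [lag_apply, ← ContinuousLinearMap.integral_comp_comm _ (integrableOn_exp_shift ha f 0)]
  simp only [map_smul]

lemma lag_comm {L : L2Signal n →L[ℂ] L2Signal n} (hL : ∀ r f, L (shift n r f) = shift n r (L f))
    (f : L2Signal n) : L (lag n ha f) = lag n ha (L f) := by
  rw [map_lag, lag_apply]
  exact integral_congr_ae (ae_of_all _ fun r => by simp only [hL])

lemma lag_shift (h : ℝ) (f : L2Signal n) : lag n ha (shift n h f) = shift n h (lag n ha f) := by
  refine (lag_comm ha (L := (shift n h).toContinuousLinearMap) (fun r g => ?_) f).symm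
  simp only [LinearIsometry.coe_toContinuousLinearMap, shift_shift, add_comm]

/-- The orbit of the lag under translations solves `x' = a x - f`. -/
lemma shift_lag_eq (h : ℝ) (f : L2Signal n) :
    shift n h (lag n ha f) = ((Real.exp (a * h) : ℝ) : ℂ) •
      (lag n ha f - ∫ r in (0 : ℝ)..h, ((Real.exp (-a * r) : ℝ) : ℂ) • shift n r f) := by
  have h1 : shift n h (lag n ha f) = ∫ r in Set.Ioi (0 : ℝ),
      ((Real.exp (a * h) : ℝ) : ℂ) • ((Real.exp (-a * (r + h)) : ℝ) : ℂ) • shift n (r + h) f := by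
    rw [← lag_shift, lag_apply]
    refine integral_congr_ae (ae_of_all _ fun r => ?_)
    simp only [shift_shift, smul_smul, ← Complex.ofReal_mul, ← Real.exp_add]
    congr 3; ring
  rw [h1, integral_smul]
  congr 1
  have h2 : ∫ r in Set.Ioi (0 : ℝ), ((Real.exp (-a * (r + h)) : ℝ) : ℂ) • shift n (r + h) f =
      ∫ r in Set.Ioi h, ((Real.exp (-a * r) : ℝ) : ℂ) • shift n r f := by
    have h3 := (measurePreserving_add_right volume h).setIntegral_preimage_emb
      (Homeomorph.addRight h).measurableEmbedding
      (fun r => ((Real.exp (-a * r) : ℝ) : ℂ) • shift n r f) (Set.Ioi h)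
    rw [← h3]
    congr 2
    ext r; simp
  rw [h2, lag_apply, ← intervalIntegral.integral_interval_add_Ioi (integrableOn_exp_shift ha f 0)
    (integrableOn_exp_shift ha f h), add_sub_cancel_left]

/-- Translations preserve the norm, so the derivative of `‖shift h (lag f)‖²` vanishes. -/
lemma re_inner_lag (f : L2Signal n) :
    (inner ℂ (lag n ha f) ((a : ℂ) • lag n ha f - f)).re = 0 := by
  set x := lag n ha f with hx
  set E : ℝ → L2Signal n := fun h => ((Real.exp (a * h) : ℝ) : ℂ) •
      (x - ∫ r in (0 : ℝ)..h, ((Real.exp (-a * r) : ℝ) : ℂ) • shift n r f) with hE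
  have hE0 : E 0 = x := by simp [hE]
  have hd : HasDerivAt E ((a : ℂ) • x - f) 0 := by
    have hc : Continuous fun r : ℝ => ((Real.exp (-a * r) : ℝ) : ℂ) • shift n r f := by fun_prop
    have h1 := (intervalIntegral.integral_hasDerivAt_right (hc.intervalIntegrable 0 0)
      hc.stronglyMeasurable.stronglyMeasurableAtFilter hc.continuousAt)
    have h2 : HasDerivAt (fun h : ℝ => ((Real.exp (a * h) : ℝ) : ℂ)) (a : ℂ) 0 := by
      have h3 : HasDerivAt (fun h : ℝ => Real.exp (a * h)) a 0 := by
        simpa using ((hasDerivAt_id (0 : ℝ)).const_mul a).exp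
      exact h3.ofReal_comp
    have h4 := h2.smul (h1.const_sub x)
    refine h4.congr_deriv ?_
    have h5 : shift n 0 f = f := by
      refine Lp.ext ?_
      filter_upwards [coeFn_shift 0 f] with t ht
      rw [ht, sub_zero]
    simp [h5]
    abel
  have hn : ∀ h, inner ℂ (E h) (E h) = inner ℂ x x := by
    intro h
    rw [hE]
    simp only [← shift_lag_eq, hx]
    exact (shift n h).inner_map_map _ _
  have h1 := hd.inner ℂ hd
  have h2 : HasDerivAt (fun h => (inner ℂ (E h) (E h) : ℂ)) 0 0 := by
    simp only [hn]; exact hasDerivAt_const _ _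
  have h3 := h1.unique h2
  rw [hE0] at h3
  have h4 := congrArg Complex.re h3
  rw [Complex.add_re, ← inner_conj_symm ((a : ℂ) • x - f) x, Complex.conj_re, Complex.zero_re] at h4
  linarith

/-- The all-pass operator `(a - s) / (a + s)`. -/
noncomputable def allPass (n : ℕ) {a : ℝ} (ha : 0 < a) : L2Signal n →L[ℂ] L2Signal n :=
  (2 * a : ℂ) • lag n ha - ContinuousLinearMap.id ℂ _

lemma allPass_apply (f : L2Signal n) : allPass n ha f = (2 * a : ℂ) • lag n ha f - f := rfl

lemma norm_allPass (f : L2Signal n) : ‖allPass n ha f‖ = ‖f‖ := by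
  have h := re_inner_lag ha f
  rw [inner_sub_right, inner_smul_right, inner_self_eq_norm_sq_to_K, Complex.sub_re,
    Complex.re_ofReal_mul] at h
  have h' : a * ‖lag n ha f‖ ^ 2 = (inner ℂ (lag n ha f) f).re := by
    have : (((‖lag n ha f‖ : ℝ) : ℂ) ^ 2).re = ‖lag n ha f‖ ^ 2 := by norm_cast
    simp only [Complex.coe_algebraMap] at h
    rw [this] at h
    linarith
  rw [← sq_eq_sq₀ (norm_nonneg _) (norm_nonneg _), allPass_apply, @norm_sub_sq ℂ, inner_smul_left,
    norm_smul]
  have h1 : (starRingEnd ℂ) (2 * (a : ℂ)) = ((2 * a : ℝ) : ℂ) := by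
    rw [map_mul, Complex.conj_ofReal, Complex.conj_ofNat]; push_cast; rfl
  have h2 : ‖(2 * (a : ℂ))‖ = 2 * a := by
    rw [norm_mul, Complex.norm_real, Real.norm_of_nonneg ha.le]; simp
  rw [h1, h2, RCLike.re_to_complex, Complex.re_ofReal_mul, ← h']
  ring

lemma allPass_comm {L : L2Signal n →L[ℂ] L2Signal n}
    (hL : ∀ r f, L (shift n r f) = shift n r (L f)) (f : L2Signal n) :
    L (allPass n ha f) = allPass n ha (L f) := by
  rw [allPass_apply, allPass_apply, map_sub, map_smul, lag_comm ha hL]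

lemma allPass_shift (h : ℝ) (f : L2Signal n) :
    allPass n ha (shift n h f) = shift n h (allPass n ha f) := by
  rw [allPass_apply, allPass_apply, map_sub, map_smul, lag_shift]

end Shift

/-! ### Signals that start at a given time -/

section Causal

variable {n m : ℕ}

/-- Restriction to the time interval `t < T`. -/
noncomputable def restr (n : ℕ) (T : ℝ) :
    L2Signal n →L[ℂ] Lp (EuclideanSpace ℂ (Fin n)) 2 ((volume : Measure ℝ).restrict (Set.Iio T)) :=
  LpToLpRestrictCLM ℝ (EuclideanSpace ℂ (Fin n)) ℂ volume 2 (Set.Iio T)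

lemma restr_eq_zero_iff {T : ℝ} {f : L2Signal n} :
    restr n T f = 0 ↔ ∀ᵐ t : ℝ, t < T → f t = 0 := by
  have h1 := LpToLpRestrictCLM_coeFn ℂ (Set.Iio T) f
  have h2 : (∀ᵐ t : ℝ, t < T → f t = 0) ↔ ∀ᵐ t ∂(volume.restrict (Set.Iio T)), f t = 0 :=
    (ae_restrict_iff' measurableSet_Iio).symm
  rw [h2, Lp.eq_zero_iff_ae_eq_zero]
  constructor
  · intro h
    filter_upwards [h, h1] with t ha hb
    rw [← hb]; exact ha
  · intro h
    filter_upwards [h, h1] with t ha hb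
    exact hb.trans ha

lemma restr_shift {T r : ℝ} (hr : 0 ≤ r) {f : L2Signal n} (hf : restr n T f = 0) :
    restr n T (shift n r f) = 0 := by
  rw [restr_eq_zero_iff] at hf ⊢
  filter_upwards [coeFn_shift r f, ae_sub_right r hf] with t h1 h2 h3
  rw [h1, h2 (by linarith)]

lemma restr_lag {T a : ℝ} (ha : 0 < a) {f : L2Signal n} (hf : restr n T f = 0) :
    restr n T (lag n ha f) = 0 := by
  rw [map_lag]
  refine setIntegral_eq_zero_of_forall_eq_zero fun r hr => ?_
  rw [restr_shift (le_of_lt hr) hf, smul_zero]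

lemma restr_allPass {T a : ℝ} (ha : 0 < a) {f : L2Signal n} (hf : restr n T f = 0) :
    restr n T (allPass n ha f) = 0 := by
  rw [allPass_apply, map_sub, map_smul, restr_lag ha hf, hf]; simp

lemma restr_compLp {T : ℝ} (M : EuclideanSpace ℂ (Fin n) →L[ℂ] EuclideanSpace ℂ (Fin m))
    {f : L2Signal n} (hf : restr n T f = 0) : restr m T (M.compLpL 2 volume f) = 0 := by
  rw [restr_eq_zero_iff] at hf ⊢
  filter_upwards [hf, M.coeFn_compLpL f] with t h1 h2 h3
  rw [h2, h1 h3, map_zero]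

lemma compLp_shift (M : EuclideanSpace ℂ (Fin n) →L[ℂ] EuclideanSpace ℂ (Fin m)) (r : ℝ)
    (f : L2Signal n) : M.compLpL 2 volume (shift n r f) = shift m r (M.compLpL 2 volume f) := by
  refine Lp.ext ?_
  filter_upwards [M.coeFn_compLpL (shift n r f), coeFn_shift r f,
    coeFn_shift r (M.compLpL 2 volume f), ae_sub_right r (M.coeFn_compLpL f)] with t h1 h2 h3 h4
  rw [h1, h2, h3, h4]

end Causal

/-! ### The Laplace transform -/

section Laplace

variable {n m : ℕ}

/-- The exponential `exp (-conj s t) v` on the positive time axis, which represents the evaluation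
of Laplace transforms at `s`. -/
noncomputable def kernFun (s : ℂ) (v : EuclideanSpace ℂ (Fin n)) : Signal n :=
  (Set.Ioi (0 : ℝ)).indicator fun t => Complex.exp (-((starRingEnd ℂ) s * t)) • v

lemma norm_exp_neg_mul (s : ℂ) (t : ℝ) : ‖Complex.exp (-(s * t))‖ = Real.exp (-s.re * t) := by
  rw [Complex.norm_exp, Complex.neg_re, Complex.re_mul_ofReal, neg_mul]

lemma norm_kernFun_sq (s : ℂ) (v : EuclideanSpace ℂ (Fin n)) (t : ℝ) :
    ‖kernFun s v t‖ ^ 2 =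
      (Set.Ioi (0 : ℝ)).indicator (fun t => Real.exp (-(2 * s.re) * t) * ‖v‖ ^ 2) t := by
  by_cases ht : t ∈ Set.Ioi (0 : ℝ)
  · simp only [kernFun, Set.indicator_of_mem ht, norm_smul, norm_exp_neg_mul, mul_pow,
      ← Real.exp_nat_mul, Complex.conj_re]
    congr 2; push_cast; ring
  · simp [kernFun, Set.indicator_of_notMem ht]

lemma memLp_kernFun {s : ℂ} (hs : 0 < s.re) (v : EuclideanSpace ℂ (Fin n)) :
    MemLp (kernFun s v) 2 volume := by
  have hm : AEStronglyMeasurable (kernFun s v) volume :=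
    AEStronglyMeasurable.indicator (Continuous.aestronglyMeasurable (by fun_prop))
      measurableSet_Ioi
  rw [memLp_two_iff_integrable_sq_norm hm]
  simp only [norm_kernFun_sq]
  rw [integrable_indicator_iff measurableSet_Ioi]
  exact (integrableOn_exp_mul_Ioi (by linarith) 0).mul_const _

/-- The reproducing kernel `kernFun s v` as an element of `L²`. -/
noncomputable def kern {s : ℂ} (hs : 0 < s.re) (v : EuclideanSpace ℂ (Fin n)) : L2Signal n :=
  (memLp_kernFun hs v).toLp _

lemma coeFn_kern {s : ℂ} (hs : 0 < s.re) (v : EuclideanSpace ℂ (Fin n)) :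
    kern hs v =ᵐ[volume] kernFun s v := (memLp_kernFun hs v).coeFn_toLp

lemma kern_causal {s : ℂ} (hs : 0 < s.re) (v : EuclideanSpace ℂ (Fin n)) :
    ∀ᵐ t : ℝ, t < 0 → kern hs v t = 0 := by
  filter_upwards [coeFn_kern hs v] with t ht h0
  rw [ht, kernFun, Set.indicator_of_notMem]
  simpa using h0.le

lemma L2_norm_sq (f : L2Signal n) : ‖f‖ ^ 2 = ∫ t, ‖f t‖ ^ 2 := by
  have h1 : ((‖f‖ ^ 2 : ℝ) : ℂ) = inner ℂ f f := by rw [inner_self_eq_norm_sq_to_K]; simp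
  have h2 : ∀ t, (inner ℂ (f t) (f t) : ℂ) = ((‖f t‖ ^ 2 : ℝ) : ℂ) := fun t => by
    rw [inner_self_eq_norm_sq_to_K]; simp
  rw [L2.inner_def] at h1
  simp only [h2] at h1
  rw [integral_complex_ofReal] at h1
  exact_mod_cast h1

lemma norm_kern_sq {s : ℂ} (hs : 0 < s.re) (v : EuclideanSpace ℂ (Fin n)) :
    ‖kern hs v‖ ^ 2 = ‖v‖ ^ 2 / (2 * s.re) := by
  have h1 : ∀ᵐ t : ℝ, ‖kern hs v t‖ ^ 2 =
      (Set.Ioi (0 : ℝ)).indicator (fun t => Real.exp (-(2 * s.re) * t) * ‖v‖ ^ 2) t := by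
    filter_upwards [coeFn_kern hs v] with t ht
    rw [ht, norm_kernFun_sq]
  rw [L2_norm_sq, integral_congr_ae h1, integral_indicator measurableSet_Ioi, integral_mul_const,
    integral_exp_mul_Ioi (by linarith)]
  simp
  field_simp

lemma integrable_laplace {s : ℂ} (hs : 0 < s.re) (f : L2Signal n) :
    IntegrableOn (fun t : ℝ => Complex.exp (-(s * t)) • f t) (Set.Ioi 0) := by
  rw [← integrable_indicator_iff measurableSet_Ioi]
  have h1 : MemLp (fun t : ℝ => ‖f t‖) 2 volume := (Lp.memLp f).norm
  have h2 : MemLp (fun t : ℝ => (Set.Ioi (0 : ℝ)).indicator (fun t => Real.exp (-s.re * t)) t) 2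
      volume := by
    refine (memLp_two_iff_integrable_sq (AEStronglyMeasurable.indicator
      (Continuous.aestronglyMeasurable (by fun_prop)) measurableSet_Ioi)).mpr ?_
    have h3 : ∀ t : ℝ, ((Set.Ioi (0 : ℝ)).indicator (fun t => Real.exp (-s.re * t)) t) ^ 2 =
        (Set.Ioi (0 : ℝ)).indicator (fun t => Real.exp (-(2 * s.re) * t)) t := by
      intro t
      by_cases ht : t ∈ Set.Ioi (0 : ℝ)
      · simp only [Set.indicator_of_mem ht, ← Real.exp_nat_mul]
        congr 1; push_cast; ring
      · simp [Set.indicator_of_notMem ht]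
    simp only [h3]
    rw [integrable_indicator_iff measurableSet_Ioi]
    exact integrableOn_exp_mul_Ioi (by linarith) 0
  have h4 := h2.integrable_mul h1
  refine h4.mono' ?_ (ae_of_all _ fun t => ?_)
  · refine AEStronglyMeasurable.indicator ?_ measurableSet_Ioi
    have hc : Continuous fun t : ℝ => Complex.exp (-(s * t)) := by fun_prop
    exact hc.aestronglyMeasurable.smul (Lp.aestronglyMeasurable f)
  · by_cases ht : t ∈ Set.Ioi (0 : ℝ)
    · simp only [Set.indicator_of_mem ht, norm_smul, norm_exp_neg_mul, Pi.mul_apply]; rfl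
    · simp [Set.indicator_of_notMem ht]

lemma inner_kern {s : ℂ} (hs : 0 < s.re) (v : EuclideanSpace ℂ (Fin n)) (f : L2Signal n) :
    (inner ℂ (kern hs v) f : ℂ) = inner ℂ v (laplace f s) := by
  have h1 : ∀ᵐ t : ℝ, (inner ℂ (kern hs v t) (f t) : ℂ) = (Set.Ioi (0 : ℝ)).indicator
      (fun t : ℝ => innerSL ℂ v (Complex.exp (-(s * t)) • f t)) t := by
    filter_upwards [coeFn_kern hs v] with t ht
    by_cases h0 : t ∈ Set.Ioi (0 : ℝ)
    · rw [ht, kernFun, Set.indicator_of_mem h0, Set.indicator_of_mem h0, innerSL_apply_apply,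
        inner_smul_left, inner_smul_right, ← Complex.exp_conj]
      simp
    · rw [ht, kernFun, Set.indicator_of_notMem h0, Set.indicator_of_notMem h0, inner_zero_left]
  rw [L2.inner_def, integral_congr_ae h1, integral_indicator measurableSet_Ioi,
    ContinuousLinearMap.integral_comp_comm _ (integrable_laplace hs f), innerSL_apply_apply]
  rfl

/-- The Laplace transform at `s` as a continuous linear map. -/
noncomputable def laplaceL {s : ℂ} (hs : 0 < s.re) : L2Signal n →L[ℂ] EuclideanSpace ℂ (Fin n) :=
  LinearMap.mkContinuous
    { toFun := fun f => laplace f s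
      map_add' := fun f g => by
        refine ext_inner_left ℂ fun v => ?_
        rw [inner_add_right, ← inner_kern hs, ← inner_kern hs, ← inner_kern hs, inner_add_right]
      map_smul' := fun c f => by
        refine ext_inner_left ℂ fun v => ?_
        rw [RingHom.id_apply, inner_smul_right, ← inner_kern hs, ← inner_kern hs,
          inner_smul_right] }
    (Real.sqrt (2 * s.re))⁻¹
    (fun f => by
      change ‖laplace f s‖ ≤ _
      set v := laplace f s with hv
      have hs2 : 0 < Real.sqrt (2 * s.re) := Real.sqrt_pos.mpr (by linarith)
      have hk : ‖kern hs v‖ = (Real.sqrt (2 * s.re))⁻¹ * ‖v‖ := by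
        rw [← sq_eq_sq₀ (norm_nonneg _) (by positivity), norm_kern_sq, mul_pow, inv_pow,
          Real.sq_sqrt (by linarith)]
        field_simp
      have h1 : ‖v‖ ^ 2 ≤ (Real.sqrt (2 * s.re))⁻¹ * ‖f‖ * ‖v‖ := by
        have h2 : ‖(inner ℂ v v : ℂ)‖ = ‖v‖ ^ 2 := by
          rw [inner_self_eq_norm_sq_to_K]; simp
        calc ‖v‖ ^ 2 = ‖(inner ℂ (kern hs v) f : ℂ)‖ := by rw [inner_kern, ← hv, h2]
          _ ≤ ‖kern hs v‖ * ‖f‖ := norm_inner_le_norm _ _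
          _ = _ := by rw [hk]; ring
      rcases (norm_nonneg v).eq_or_lt with h0 | h0
      · rw [← h0]; positivity
      · exact le_of_mul_le_mul_right (by rw [← pow_two]; exact h1) h0)

lemma laplaceL_apply {s : ℂ} (hs : 0 < s.re) (f : L2Signal n) : laplaceL hs f = laplace f s := rfl

lemma norm_laplace_le {s : ℂ} (hs : 0 < s.re) (f : L2Signal n) :
    ‖laplace f s‖ ≤ (Real.sqrt (2 * s.re))⁻¹ * ‖f‖ :=
  (laplaceL hs).le_of_opNorm_le (LinearMap.mkContinuous_norm_le _ (by positivity) _) f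

lemma laplace_compLp {s : ℂ} (hs : 0 < s.re)
    (M : EuclideanSpace ℂ (Fin n) →L[ℂ] EuclideanSpace ℂ (Fin m)) (f : L2Signal n) :
    laplace (M.compLpL 2 volume f) s = M (laplace f s) := by
  rw [laplace, laplace, ← ContinuousLinearMap.integral_comp_comm _ (integrable_laplace hs f)]
  refine integral_congr_ae (ae_restrict_of_ae ?_)
  filter_upwards [M.coeFn_compLpL f] with t ht
  rw [ht, map_smul]

lemma laplace_shift {s : ℂ} {r : ℝ} (hr : 0 ≤ r) {f : L2Signal n}
    (hf : restr n 0 f = 0) : laplace (shift n r f) s = Complex.exp (-(s * r)) • laplace f s := by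
  have key : ∀ g : L2Signal n, restr n 0 g = 0 →
      laplace g s = ∫ t : ℝ, Complex.exp (-(s * t)) • g t := by
    intro g hg
    rw [restr_eq_zero_iff] at hg
    rw [laplace, ← integral_indicator measurableSet_Ioi]
    refine integral_congr_ae ?_
    have h0 : ∀ᵐ t : ℝ, t ≠ 0 := by
      simp [ae_iff, measure_singleton]
    filter_upwards [hg, h0] with t ht h0
    by_cases h : t ∈ Set.Ioi (0 : ℝ)
    · rw [Set.indicator_of_mem h]
    · rw [Set.indicator_of_notMem h, ht (lt_of_le_of_ne (not_lt.mp h) h0), smul_zero]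
  rw [key _ (restr_shift hr hf), key _ hf, ← integral_smul]
  have h1 : ∀ᵐ t : ℝ, Complex.exp (-(s * t)) • shift n r f t =
      (fun u : ℝ => Complex.exp (-(s * r)) • Complex.exp (-(s * u)) • f u) (t - r) := by
    filter_upwards [coeFn_shift r f] with t ht
    rw [ht, smul_smul, ← Complex.exp_add]
    congr 2; push_cast; ring
  rw [integral_congr_ae h1, integral_sub_right_eq_self
    (fun u : ℝ => Complex.exp (-(s * r)) • Complex.exp (-(s * u)) • f u) r]

lemma laplace_lag {s : ℂ} (hs : 0 < s.re) {a : ℝ} (ha : 0 < a) {f : L2Signal n}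
    (hf : restr n 0 f = 0) : laplace (lag n ha f) s = (a + s)⁻¹ • laplace f s := by
  rw [← laplaceL_apply hs, map_lag]
  have h1 : ∀ r ∈ Set.Ioi (0 : ℝ), ((Real.exp (-a * r) : ℝ) : ℂ) • laplaceL hs (shift n r f) =
      Complex.exp (-(a + s) * r) • laplace f s := by
    intro r hr
    rw [laplaceL_apply, laplace_shift (le_of_lt hr) hf, smul_smul, Complex.ofReal_exp,
      ← Complex.exp_add]
    congr 2; push_cast; ring
  rw [setIntegral_congr_fun measurableSet_Ioi h1, integral_smul_const,
    integral_exp_mul_complex_Ioi (by simp; linarith)]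
  congr 1
  rw [Complex.ofReal_zero, mul_zero, Complex.exp_zero, neg_div_neg_eq, one_div]

lemma laplace_allPass {s : ℂ} (hs : 0 < s.re) {a : ℝ} (ha : 0 < a) {f : L2Signal n}
    (hf : restr n 0 f = 0) :
    laplace (allPass n ha f) s = ((a - s) / (a + s)) • laplace f s := by
  have h0 : (a : ℂ) + s ≠ 0 := by
    intro h
    have := congrArg Complex.re h
    simp at this
    linarith
  rw [← laplaceL_apply hs, allPass_apply, map_sub, map_smul, laplaceL_apply, laplaceL_apply,
    laplace_lag hs ha hf, smul_smul]
  nth_rw 2 [← one_smul ℂ (laplace f s)]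
  rw [← sub_smul]
  congr 1
  field_simp
  ring

end Laplace

/-! ### The causal time-invariant operator with a given contractive transfer function -/

section Realize

variable {n : ℕ}

/-- The Cayley transform maps the right half-plane into the unit disc. -/
lemma norm_cayley_lt_one {a : ℝ} (ha : 0 < a) {s : ℂ} (hs : 0 < s.re) :
    ‖((a : ℂ) - s) / (a + s)‖ < 1 := by
  have h0 : (a : ℂ) + s ≠ 0 := by
    intro h
    have := congrArg Complex.re h
    simp at this
    linarith
  rw [norm_div, div_lt_one (norm_pos_iff.mpr h0), ← sq_lt_sq₀ (norm_nonneg _) (norm_nonneg _),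
    ← Complex.normSq_eq_norm_sq, ← Complex.normSq_eq_norm_sq, Complex.normSq_apply,
    Complex.normSq_apply]
  simp
  nlinarith [mul_pos ha hs]

set_option maxHeartbeats 1600000 in
/-- The operator with the dilated symbol `Θ (r² z)`, as an absolutely convergent power series in
the all-pass operator. One factor `r` makes the coefficients summable, the other one is the factor
`r` in von Neumann's inequality. -/
lemma exists_contraction_dilated {a : ℝ} (ha : 0 < a)
    {Θ : ℂ → (EuclideanSpace ℂ (Fin n) →L[ℂ] EuclideanSpace ℂ (Fin n))}
    (hΘ : DifferentiableOn ℂ Θ (Metric.ball 0 1)) (hc : ∀ z : ℂ, ‖z‖ < 1 → ‖Θ z‖ ≤ 1)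
    {r : ℝ} (hr : 0 ≤ r) (hr1 : r < 1) :
    ∃ T : L2Signal n →L[ℂ] L2Signal n, (∀ f, ‖T f‖ ≤ ‖f‖) ∧
      (∀ t f, restr n t f = 0 → restr n t (T f) = 0) ∧
      (∀ h f, T (shift n h f) = shift n h (T f)) ∧
      ∀ s : ℂ, 0 < s.re → ∀ f, restr n 0 f = 0 →
        laplace (T f) s = Θ ((r : ℂ) ^ 2 * ((a - s) / (a + s))) (laplace f s) := by
  obtain ⟨R, hrR, hR1⟩ := exists_between hr1
  have hR0 : 0 < R := lt_of_le_of_lt hr hrR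
  lift R to NNReal using hR0.le
  have hps := (hΘ.mono (Metric.closedBall_subset_ball hR1)).hasFPowerSeriesOnBall
    (by exact_mod_cast hR0)
  set p := cauchyPowerSeries Θ 0 R with hp
  set c : ℕ → (EuclideanSpace ℂ (Fin n) →L[ℂ] EuclideanSpace ℂ (Fin n)) := p.coeff with hcdef
  have hsum : ∀ z : ℂ, ‖z‖ < R → HasSum (fun k => z ^ k • c k) (Θ z) := by
    intro z hz
    have h1 := hps.hasSum_sub (y := z) (by
      rw [Metric.mem_eball, edist_zero_right]
      exact_mod_cast hz)
    simpa [sub_zero] using h1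
  have hcs : Summable fun k => ‖c k‖ * r ^ k := by
    lift r to NNReal using hr
    have h1 : (r : ENNReal) < p.radius := lt_of_lt_of_le (by exact_mod_cast hrR) hps.r_le
    have h2 := p.summable_norm_mul_pow h1
    simpa [hcdef, FormalMultilinearSeries.norm_apply_eq_norm_coef] using h2
  set Φ : (EuclideanSpace ℂ (Fin n) →L[ℂ] EuclideanSpace ℂ (Fin n)) →L[ℂ]
      (L2Signal n →L[ℂ] L2Signal n) :=
    (ContinuousLinearMap.id ℂ (EuclideanSpace ℂ (Fin n) →L[ℂ] EuclideanSpace ℂ (Fin n))).compLpL₂ 2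
      volume with hΦ
  have hΦa : ∀ M f, Φ M f = M.compLpL 2 volume f := fun M f => rfl
  have hΦn : ∀ M, ‖Φ M‖ ≤ ‖M‖ := fun M => M.norm_compLpL_le
  have hΦs : ∀ M h f, Φ M (shift n h f) = shift n h (Φ M f) := fun M h f => compLp_shift M h f
  set V := allPass n ha with hV
  have hVn : ∀ f, ‖V f‖ = ‖f‖ := norm_allPass ha
  set A : ℕ → L2Signal n →L[ℂ] L2Signal n := fun k => (r : ℂ) ^ k • Φ (c k) with hA
  have hAn : ∀ k, ‖A k‖ ≤ ‖c k‖ * r ^ k := fun k => by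
    rw [hA, norm_smul, norm_pow, Complex.norm_real, Real.norm_of_nonneg hr, mul_comm]
    exact mul_le_mul_of_nonneg_right (hΦn _) (by positivity)
  have hAs : Summable fun k => ‖A k‖ := hcs.of_nonneg_of_le (fun _ => norm_nonneg _) hAn
  have hAsh : ∀ k h f, A k (shift n h f) = shift n h (A k f) := fun k h f => by
    simp only [hA, _root_.smul_apply, hΦs, map_smul]
  have hcomm : ∀ k f, A k (V f) = V (A k f) := fun k f =>
    allPass_comm ha (fun h g => hAsh k h g) f
  have hsymb : ∀ θ f, ‖∑' k : ℕ, expI k θ • A k f‖ ≤ ‖f‖ := by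
    intro θ f
    have hz : ‖(r : ℂ) * expI 1 θ‖ = r := by
      rw [norm_mul, norm_expI, mul_one, Complex.norm_real, Real.norm_of_nonneg hr]
    have h1 := (hsum ((r : ℂ) * expI 1 θ) (by rw [hz]; exact hrR)).mapL Φ
    have h2 := h1.mapL (ContinuousLinearMap.apply ℂ _ f)
    have h3 : ∀ k : ℕ, expI k θ • A k f =
        (ContinuousLinearMap.apply ℂ (L2Signal n) f) (Φ (((r : ℂ) * expI 1 θ) ^ k • c k)) := by
      intro k
      have h4 : expI 1 θ ^ k = expI k θ := by
        rw [expI, expI, ← Complex.exp_nat_mul]; congr 1; push_cast; ring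
      rw [map_smul, mul_pow, h4]
      simp only [hA, ContinuousLinearMap.apply_apply, _root_.smul_apply, smul_smul]
      rw [mul_comm]
    simp only [h3]
    rw [h2.tsum_eq]
    refine ((Φ (Θ ((r : ℂ) * expI 1 θ))).le_opNorm f).trans ?_
    refine mul_le_of_le_one_left (norm_nonneg _) ((hΦn _).trans (hc _ ?_))
    rw [hz]; exact hr1
  have hTs : Summable fun k : ℕ => (r : ℂ) ^ k • (A k * V ^ k) := by
    refine Summable.of_norm_bounded hAs fun k => ?_
    rw [norm_smul, norm_pow, Complex.norm_real, Real.norm_of_nonneg hr]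
    have h1 : ‖V ^ k‖ ≤ 1 := ContinuousLinearMap.opNorm_le_bound _ zero_le_one fun f => by
      rw [norm_pow_apply hVn, one_mul]
    calc r ^ k * ‖A k * V ^ k‖ ≤ 1 * (‖A k‖ * 1) := by
          gcongr
          · exact pow_le_one₀ hr hr1.le
          · exact (norm_mul_le _ _).trans (by gcongr)
      _ = ‖A k‖ := by ring
  set T := ∑' k : ℕ, (r : ℂ) ^ k • (A k * V ^ k) with hT
  have hTf : ∀ f, HasSum (fun k : ℕ => (r : ℂ) ^ k • A k ((V ^ k) f)) (T f) := fun f =>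
    hTs.hasSum.mapL (ContinuousLinearMap.apply ℂ _ f)
  have hVsh : ∀ k h f, (V ^ k) (shift n h f) = shift n h ((V ^ k) f) := by
    intro k h f
    induction k with
    | zero => simp
    | succ k ih =>
      rw [pow_succ', mul_apply_eq_comp, mul_apply_eq_comp, ih]
      exact allPass_shift ha _ _
  have hVr : ∀ k t f, restr n t f = 0 → restr n t ((V ^ k) f) = 0 := by
    intro k t f hf
    induction k with
    | zero => simpa using hf
    | succ k ih =>
      rw [pow_succ', mul_apply_eq_comp]
      exact restr_allPass ha ih
  refine ⟨T, fun f => ?_, fun t f hf => ?_, fun h f => ?_, fun s hs f hf => ?_⟩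
  · rw [← (hTf f).tsum_eq]
    exact norm_series_isometry_le hVn hr hr1 hcomm hAs hsymb f
  · refine ((hTf f).mapL (restr n t)).unique ?_
    have h1 : ∀ k : ℕ, restr n t ((r : ℂ) ^ k • A k ((V ^ k) f)) = 0 := fun k => by
      have h2 : restr n t (Φ (c k) ((V ^ k) f)) = 0 := restr_compLp (c k) (hVr k t f hf)
      simp only [hA, _root_.smul_apply, map_smul, h2, smul_zero]
    simp only [h1]
    exact hasSum_zero
  · refine (hTf _).unique ?_
    have h1 := (hTf f).mapL (shift n h).toContinuousLinearMap
    simp only [LinearIsometry.coe_toContinuousLinearMap] at h1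
    refine h1.congr_fun fun k => ?_
    rw [hVsh, hAsh, map_smul]
  · have hVl : ∀ k, laplace ((V ^ k) f) s = ((a - s) / (a + s)) ^ k • laplace f s := by
      intro k
      induction k with
      | zero => simp
      | succ k ih =>
        rw [pow_succ', mul_apply_eq_comp, laplace_allPass hs ha (hVr k 0 f hf), ih, smul_smul,
          pow_succ']
    have h1 := (hTf f).mapL (laplaceL hs)
    refine h1.unique ?_
    have hzn := norm_cayley_lt_one ha hs
    have hz : ‖(r : ℂ) ^ 2 * ((a - s) / (a + s))‖ < R := by
      rw [norm_mul, norm_pow, Complex.norm_real, Real.norm_of_nonneg hr]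
      have h2 : r ^ 2 ≤ r := by nlinarith
      calc r ^ 2 * ‖((a : ℂ) - s) / (a + s)‖ ≤ r * 1 := by gcongr
        _ < R := by rwa [mul_one]
    have h2 := (hsum _ hz).mapL (ContinuousLinearMap.apply ℂ _ (laplace f s))
    refine h2.congr_fun fun k => ?_
    simp only [hA, _root_.smul_apply, map_smul, hΦa]
    rw [laplaceL_apply, laplace_compLp hs, hVl, map_smul, smul_smul, smul_smul,
      ContinuousLinearMap.apply_apply]
    congr 1
    generalize ((a : ℂ) - s) / (a + s) = z
    ring

/-- Every contractive analytic function of `z = (a - s) / (a + s)` is the transfer function of a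
causal, time-invariant contraction on `L²`, a weak limit of the operators with dilated symbols. -/
theorem exists_contraction_of_symbol {a : ℝ} (ha : 0 < a)
    {Θ : ℂ → (EuclideanSpace ℂ (Fin n) →L[ℂ] EuclideanSpace ℂ (Fin n))}
    (hΘ : DifferentiableOn ℂ Θ (Metric.ball 0 1)) (hc : ∀ z : ℂ, ‖z‖ < 1 → ‖Θ z‖ ≤ 1) :
    ∃ T : L2Signal n →L[ℂ] L2Signal n, (∀ f, ‖T f‖ ≤ ‖f‖) ∧
      (∀ t f, restr n t f = 0 → restr n t (T f) = 0) ∧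
      (∀ h f, T (shift n h f) = shift n h (T f)) ∧
      ∀ s : ℂ, 0 < s.re → ∀ f, restr n 0 f = 0 →
        laplace (T f) s = Θ ((a - s) / (a + s)) (laplace f s) := by
  set ρ : ℕ → ℝ := fun k => 1 - 1 / ((k : ℝ) + 1) with hρ
  have hρ0 : ∀ k, 0 ≤ ρ k := fun k => by
    have : 1 / ((k : ℝ) + 1) ≤ 1 := by
      rw [div_le_one (by positivity)]; linarith [(Nat.cast_nonneg k : (0 : ℝ) ≤ k)]
    simp only [hρ]; linarith
  have hρ1 : ∀ k, ρ k < 1 := fun k => by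
    have : 0 < 1 / ((k : ℝ) + 1) := by positivity
    simp only [hρ]; linarith
  have hρlim : Tendsto ρ atTop (𝓝 1) := by
    have := (tendsto_one_div_add_atTop_nhds_zero_nat (𝕜 := ℝ)).const_sub 1
    simpa [hρ] using this
  choose T hTn hTc hTs hTl using fun k => exists_contraction_dilated ha hΘ hc (hρ0 k) (hρ1 k)
  obtain ⟨T₀, 𝒰, h𝒰, hn, hlim⟩ := exists_weak_limit atTop T hTn
  refine ⟨T₀, hn, fun t f hf => ?_, fun h f => ?_, fun s hs f hf => ?_⟩
  · refine ext_inner_right ℂ fun g => ?_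
    have h1 := hlim f (ContinuousLinearMap.adjoint (restr n t) g)
    simp only [ContinuousLinearMap.adjoint_inner_right, hTc _ t f hf, inner_zero_left] at h1
    rw [inner_zero_left]
    exact tendsto_nhds_unique h1 tendsto_const_nhds
  · refine ext_inner_right ℂ fun g => ?_
    have h1 := hlim f (ContinuousLinearMap.adjoint (shift n h).toContinuousLinearMap g)
    simp only [ContinuousLinearMap.adjoint_inner_right,
      LinearIsometry.coe_toContinuousLinearMap, ← hTs] at h1
    exact tendsto_nhds_unique (hlim _ g) h1
  · refine ext_inner_right ℂ fun v => ?_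
    have h1 := hlim f (kern hs v)
    have h2 : ∀ g : L2Signal n, (inner ℂ g (kern hs v) : ℂ) = inner ℂ (laplace g s) v := fun g => by
      rw [← inner_conj_symm, inner_kern, inner_conj_symm]
    simp only [h2, hTl _ s hs f hf] at h1
    refine tendsto_nhds_unique h1 ?_
    have hz := norm_cayley_lt_one ha hs
    have h3 : ContinuousAt Θ ((a - s) / (a + s)) := (hΘ.differentiableAt
      (Metric.isOpen_ball.mem_nhds (mem_ball_zero_iff.mpr hz))).continuousAt
    have h4 : Tendsto (fun k => ((ρ k : ℝ) : ℂ) ^ 2 * ((a - s) / (a + s))) 𝒰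
        (𝓝 ((a - s) / (a + s))) := by
      have h5 : Tendsto (fun k => ((ρ k : ℝ) : ℂ)) 𝒰 (𝓝 1) :=
        ((Complex.continuous_ofReal.tendsto 1).comp hρlim).mono_left h𝒰
      simpa using (h5.pow 2).mul_const ((a - s) / (a + s))
    have h6 : Tendsto (fun k => Θ (((ρ k : ℝ) : ℂ) ^ 2 * ((a - s) / (a + s))) (laplace f s)) 𝒰
        (𝓝 (Θ ((a - s) / (a + s)) (laplace f s))) :=
      ((ContinuousLinearMap.apply ℂ _ (laplace f s)).continuous.tendsto _).comp (h3.tendsto.comp h4)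
    exact h6.inner tendsto_const_nhds

end Realize

/-! ### Transfer functions of output strictly passive maps -/

section Transfer

variable {n : ℕ}

/-- Output strict passivity with parameter `ε` says that `1 - ε S` is a contraction. -/
lemma mem_ospClass_iff {ε : ℝ} (hε : 0 < ε) {S : LTIMap n n} :
    S ∈ ospClass n ε ↔ ∀ f : L2Signal n, ‖f - (ε : ℂ) • S.toLin f‖ ≤ ‖f‖ := by
  have key : ∀ y u : L2Signal n, (∫ t, (inner ℂ (u t) (y t) + inner ℂ (y t) (u t)).re) =
      2 * (inner ℂ y u : ℂ).re := by
    intro y u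
    have h1 : ∀ t, (inner ℂ (u t) (y t) + inner ℂ (y t) (u t)).re =
        2 * (inner ℂ (y t) (u t) : ℂ).re := fun t => by
      rw [Complex.add_re, inner_re_comm (u t)]; ring
    simp only [h1]
    have h2 := integral_re (𝕜 := ℂ) (L2.integrable_inner (𝕜 := ℂ) y u)
    simp only [RCLike.re_to_complex] at h2
    rw [integral_const_mul, h2, L2.inner_def]
  have h2 : ∀ f : L2Signal n, ‖f - (ε : ℂ) • S.toLin f‖ ≤ ‖f‖ ↔
      0 ≤ 2 * (inner ℂ f (S.toLin f) : ℂ).re - ε * ‖S.toLin f‖ ^ 2 := by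
    intro f
    rw [← sq_le_sq₀ (norm_nonneg _) (norm_nonneg _), @norm_sub_sq ℂ, inner_smul_right, norm_smul,
      RCLike.re_to_complex, Complex.re_ofReal_mul, mul_pow, Complex.norm_real, Real.norm_eq_abs,
      sq_abs]
    constructor
    · intro h
      have : 0 ≤ ε * (2 * (inner ℂ f (S.toLin f) : ℂ).re - ε * ‖S.toLin f‖ ^ 2) := by linarith
      exact nonneg_of_mul_nonneg_right this hε
    · intro h
      nlinarith
  simp only [h2]
  constructor
  · intro h f
    have h3 := h f (-S.toLin f) (by rw [neg_neg])
    rw [key, inner_neg_right, norm_neg, Complex.neg_re] at h3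
    linarith
  · intro h y u hyu
    have h3 := h y
    rw [hyu, inner_neg_right, norm_neg, Complex.neg_re] at h3
    rw [key]
    linarith

lemma laplace_kern {s w : ℂ} (hs : 0 < s.re) (hw : 0 < w.re) (v : EuclideanSpace ℂ (Fin n)) :
    laplace (kern hs v) w = (w + (starRingEnd ℂ) s)⁻¹ • v := by
  have h1 : ∀ᵐ (t : ℝ) ∂(volume.restrict (Set.Ioi (0 : ℝ))), Complex.exp (-(w * t)) • kern hs v t =
      Complex.exp (-(w + (starRingEnd ℂ) s) * t) • v := by
    filter_upwards [ae_restrict_of_ae (coeFn_kern hs v), ae_restrict_mem measurableSet_Ioi]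
      with t ht h0
    rw [ht, kernFun, Set.indicator_of_mem h0, smul_smul, ← Complex.exp_add]
    congr 2; ring
  rw [laplace, integral_congr_ae h1, integral_smul_const,
    integral_exp_mul_complex_Ioi (by simp; linarith)]
  congr 1
  rw [Complex.ofReal_zero, mul_zero, Complex.exp_zero, neg_div_neg_eq, one_div]

lemma differentiableOn_laplace (f : L2Signal n) :
    DifferentiableOn ℂ (laplace f) {s : ℂ | 0 < s.re} := by
  intro s hs
  have hs : 0 < s.re := hs
  set σ := s.re / 2 with hσ
  have hσ0 : 0 < σ := by positivity
  have hbound := (integrable_laplace (s := ((σ / 2 : ℝ) : ℂ)) (by simpa using hσ0) f).norm.const_mul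
    (2 / σ)
  have hm : ∀ w : ℂ, AEStronglyMeasurable (fun t : ℝ => Complex.exp (-(w * t)) • f t)
      (volume.restrict (Set.Ioi 0)) := fun w =>
    (Continuous.aestronglyMeasurable (by fun_prop : Continuous fun t : ℝ =>
      Complex.exp (-(w * t)))).smul (Lp.aestronglyMeasurable f).restrict
  have h := hasDerivAt_integral_of_dominated_loc_of_deriv_le (𝕜 := ℂ)
    (μ := volume.restrict (Set.Ioi (0 : ℝ))) (x₀ := s) (s := Metric.ball s σ)
    (F := fun w t => Complex.exp (-(w * t)) • f t)
    (F' := fun w t => (Complex.exp (-(w * t)) * -(t : ℂ)) • f t)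
    (Metric.ball_mem_nhds s hσ0) (Eventually.of_forall hm) (integrable_laplace hs f) ?_ ?_
    hbound ?_
  · exact h.2.differentiableAt.differentiableWithinAt
  · exact (Continuous.aestronglyMeasurable (by fun_prop : Continuous fun t : ℝ =>
      Complex.exp (-(s * t)) * -(t : ℂ))).smul (Lp.aestronglyMeasurable f).restrict
  · filter_upwards [ae_restrict_mem measurableSet_Ioi] with t ht w hw
    have ht : 0 < t := ht
    have hwσ : σ ≤ w.re := by
      have h1 := (Complex.abs_re_le_norm (w - s)).trans_lt (mem_ball_iff_norm.mp hw)
      rw [Complex.sub_re] at h1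
      have := (abs_lt.mp h1).1
      linarith
    rw [norm_smul, norm_mul, norm_smul, norm_exp_neg_mul, norm_exp_neg_mul, norm_neg,
      Complex.norm_real, Real.norm_of_nonneg ht.le, Complex.ofReal_re, ← mul_assoc]
    refine mul_le_mul_of_nonneg_right ?_ (norm_nonneg _)
    -- half of the decay absorbs the factor `t`
    have h1 : Real.exp (-w.re * t) ≤ Real.exp (-(σ / 2) * t) * Real.exp (-(σ / 2) * t) := by
      rw [← Real.exp_add]
      exact Real.exp_le_exp.mpr (by nlinarith)
    have h2 : Real.exp (-(σ / 2) * t) * t ≤ 2 / σ := by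
      have h3 := Real.add_one_le_exp (σ / 2 * t)
      have h4 : Real.exp (-(σ / 2) * t) * Real.exp (σ / 2 * t) = 1 := by
        rw [← Real.exp_add]; simp
      have h5 : Real.exp (-(σ / 2) * t) * (σ / 2 * t) ≤ 1 := by
        rw [← h4]; exact mul_le_mul_of_nonneg_left (by linarith) (Real.exp_pos _).le
      rw [le_div_iff₀ hσ0]
      linarith
    calc Real.exp (-w.re * t) * t
        ≤ Real.exp (-(σ / 2) * t) * Real.exp (-(σ / 2) * t) * t := by gcongr
      _ = (Real.exp (-(σ / 2) * t) * t) * Real.exp (-(σ / 2) * t) := by ring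
      _ ≤ _ := by gcongr
  · refine ae_of_all _ fun t w _ => ?_
    refine HasDerivAt.smul_const ?_ _
    exact ((hasDerivAt_mul_const (t : ℂ)).neg).cexp

lemma matrix_act_eq_iff {M : Matrix (Fin n) (Fin n) ℂ} {x y : EuclideanSpace ℂ (Fin n)} :
    x = act M y ↔ ∀ i, x i = ∑ j, M i j * y j :=
  ⟨fun h i => by rw [h, act_coord], fun h => PiLp.ext fun i => by rw [h, act_coord]⟩

lemma isOpen_re_gt (σ : ℝ) : IsOpen {s : ℂ | σ < s.re} :=
  isOpen_lt continuous_const Complex.continuous_re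

lemma isPreconnected_re_pos : IsPreconnected {s : ℂ | 0 < s.re} :=
  (convex_halfSpace_re_gt 0).isPreconnected

/-- Two analytic functions on the right half-plane that agree far to the right agree. -/
lemma eqOn_of_eq_right {f g : ℂ → ℂ} (hf : DifferentiableOn ℂ f {s | 0 < s.re})
    (hg : DifferentiableOn ℂ g {s | 0 < s.re}) {σ₀ : ℝ} (hσ : 0 ≤ σ₀)
    (h : ∀ s : ℂ, σ₀ < s.re → f s = g s) : Set.EqOn f g {s | 0 < s.re} := by
  have hmem : ((σ₀ + 1 : ℝ) : ℂ) ∈ {s : ℂ | σ₀ < s.re} := by simp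
  refine (hf.analyticOnNhd (isOpen_re_gt 0)).eqOn_of_preconnected_of_eventuallyEq
    (hg.analyticOnNhd (isOpen_re_gt 0)) isPreconnected_re_pos
    (z₀ := ((σ₀ + 1 : ℝ) : ℂ)) (by simp; linarith) ?_
  filter_upwards [(isOpen_re_gt σ₀).mem_nhds hmem] with s hs using h s hs

/-- The transfer function of an output strictly passive map extends analytically to the open right
half-plane and satisfies there the passivity inequality pointwise. The extension is read off from
the responses to `exp (-t)`; testing with the reproducing kernel at `s` gives the inequality. -/
theorem exists_transfer_of_mem_ospClass {ε : ℝ} (hε : 0 < ε) {S : LTIMap n n}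
    (hS : S ∈ ospClass n ε) {σ₀ : ℝ} (hσ : 0 ≤ σ₀) {K : ℂ → Matrix (Fin n) (Fin n) ℂ}
    (hK : S.HasTransferFunction σ₀ K) :
    ∃ H : ℂ → Matrix (Fin n) (Fin n) ℂ, MatDiff H {s | 0 < s.re} ∧
      (∀ s : ℂ, σ₀ < s.re → H s = K s) ∧ ∀ s : ℂ, 0 < s.re → YoulaIneq 0 (H s) ε := by
  have h1re : 0 < (1 : ℂ).re := by simp
  -- `exp (-t)` has the Laplace transform `(s + 1)⁻¹`, whence the factor `s + 1`
  set g : Fin n → L2Signal n := fun j => S.toLin (kern h1re (EuclideanSpace.single j 1)) with hg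
  set H : ℂ → Matrix (Fin n) (Fin n) ℂ := fun s i j => (s + 1) * laplace (g j) s i with hH
  have hdc : ∀ (f : L2Signal n) (i : Fin n),
      DifferentiableOn ℂ (fun s => laplace f s i) {s : ℂ | 0 < s.re} := fun f i s hs =>
    (EuclideanSpace.proj (𝕜 := ℂ) i).differentiableAt.comp_differentiableWithinAt s
      (differentiableOn_laplace f s hs)
  have hHd : MatDiff H {s | 0 < s.re} := fun i j =>
    DifferentiableOn.mul (by fun_prop) (hdc (g j) i)
  have hHK : ∀ s : ℂ, σ₀ < s.re → H s = K s := by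
    intro s hs
    have hs0 : 0 < s.re := hσ.trans_lt hs
    have hs1 : s + 1 ≠ 0 := by
      intro h
      have := congrArg Complex.re h
      simp at this
      linarith
    ext i j
    simp only [hH, hg]
    rw [hK _ (kern_causal h1re _) s hs, laplace_kern h1re hs0, map_one, act_smul,
      PiLp.smul_apply, act_single, smul_eq_mul, mul_inv_cancel_left₀ hs1]
  have hext : ∀ f : L2Signal n, (∀ᵐ t : ℝ, t < 0 → f t = 0) → ∀ s : ℂ, 0 < s.re →
      laplace (S.toLin f) s = act (H s) (laplace f s) := by
    intro f hf s hs
    refine matrix_act_eq_iff.mpr fun i => ?_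
    refine eqOn_of_eq_right (hdc (S.toLin f) i) (DifferentiableOn.fun_sum fun j _ =>
      (hHd i j).mul (hdc f j)) hσ (fun w hw => ?_) hs
    exact matrix_act_eq_iff.mp (by rw [hHK w hw]; exact hK f hf w hw) i
  refine ⟨H, hHd, hHK, fun s hs => (youlaIneq_zero_iff hε).mpr fun b => ?_⟩
  have hs2 : 0 < 2 * s.re := by linarith
  have hss : s + (starRingEnd ℂ) s = ((2 * s.re : ℝ) : ℂ) := by
    rw [Complex.add_conj]
  set f := kern hs b with hf
  have h1 : laplace f s = ((2 * s.re : ℝ) : ℂ)⁻¹ • b := by rw [hf, laplace_kern hs hs, hss]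
  have h2 : laplaceL hs (f - (ε : ℂ) • S.toLin f) =
      ((2 * s.re : ℝ) : ℂ)⁻¹ • (b - (ε : ℂ) • act (H s) b) := by
    rw [map_sub, map_smul, laplaceL_apply, laplaceL_apply, hext f (kern_causal hs b) s hs, h1,
      act_smul, smul_sub, smul_comm]
  have h3 := norm_laplace_le hs (f - (ε : ℂ) • S.toLin f)
  rw [← laplaceL_apply hs, h2, norm_smul, norm_inv, Complex.norm_real,
    Real.norm_of_nonneg hs2.le] at h3
  have h4 : ‖f‖ = (Real.sqrt (2 * s.re))⁻¹ * ‖b‖ := by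
    rw [← sq_eq_sq₀ (norm_nonneg _) (by positivity), hf, norm_kern_sq, mul_pow, inv_pow,
      Real.sq_sqrt hs2.le]
    field_simp
  have h5 := (mem_ospClass_iff hε).mp hS f
  have h6 : (Real.sqrt (2 * s.re))⁻¹ * (Real.sqrt (2 * s.re))⁻¹ = (2 * s.re)⁻¹ := by
    rw [← mul_inv, Real.mul_self_sqrt hs2.le]
  have h7 : (2 * s.re)⁻¹ * ‖b - (ε : ℂ) • act (H s) b‖ ≤ (2 * s.re)⁻¹ * ‖b‖ := by
    refine h3.trans ?_
    rw [← h6, mul_assoc, ← h4]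
    gcongr
  exact le_of_mul_le_mul_left h7 (by positivity)

end Transfer

/-! ### Boundary values of bounded analytic matrix functions -/

section Boundary

lemma norm_radial {r : ℝ} (hr : 1 < r) (Ω : ℝ) :
    1 < ‖(r : ℂ) * Complex.exp (Ω * Complex.I)‖ := by
  rw [norm_mul, Complex.norm_exp_ofReal_mul_I, mul_one, Complex.norm_real,
    Real.norm_of_nonneg (by linarith)]
  exact hr

lemma inv_radial (r Ω : ℝ) : ((r : ℂ) * Complex.exp (Ω * Complex.I))⁻¹ =
    ((r⁻¹ : ℝ) : ℂ) * Complex.exp ((-Ω : ℝ) * Complex.I) := by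
  rw [mul_inv, ← Complex.exp_neg]; push_cast; rw [neg_mul]

lemma tendsto_inv_nhdsGT_one : Tendsto (fun r : ℝ => r⁻¹) (𝓝[>] 1) (𝓝[<] 1) := by
  refine tendsto_nhdsWithin_iff.mpr ⟨?_, ?_⟩
  · have := (continuousAt_inv₀ (one_ne_zero : (1 : ℝ) ≠ 0)).tendsto
    rw [inv_one] at this
    exact this.mono_left nhdsWithin_le_nhds
  · filter_upwards [self_mem_nhdsWithin] with r hr using inv_lt_one_of_one_lt₀ (Set.mem_Ioi.mp hr)

lemma tendsto_inv_nhdsLT_one : Tendsto (fun r : ℝ => r⁻¹) (𝓝[<] 1) (𝓝[>] 1) := by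
  refine tendsto_nhdsWithin_iff.mpr ⟨?_, ?_⟩
  · have := (continuousAt_inv₀ (one_ne_zero : (1 : ℝ) ≠ 0)).tendsto
    rw [inv_one] at this
    exact this.mono_left nhdsWithin_le_nhds
  · have h : Set.Ioo (0 : ℝ) 1 ∈ 𝓝[<] (1 : ℝ) := Ioo_mem_nhdsLT zero_lt_one
    filter_upwards [h] with r hr using (one_lt_inv₀ hr.1).mpr hr.2

lemma ae_exp_periodic {p : ℂ → Prop}
    (h : ∀ᵐ θ ∂(volume.restrict (Set.Icc (-Real.pi) Real.pi)),
      p (Complex.exp ((θ : ℝ) * Complex.I))) :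
    ∀ᵐ θ : ℝ, p (Complex.exp (θ * Complex.I)) := by
  refine ae_of_ae_restrict_of_periodic (fun θ n hn => ?_) h
  have h1 : (((θ - n * (2 * Real.pi) : ℝ) : ℂ) * Complex.I) =
      θ * Complex.I - n * (2 * Real.pi * Complex.I) := by push_cast; ring
  rwa [h1, Complex.exp_periodic.sub_int_mul_eq] at hn

/-- Maximum principle on the exterior of the disc, with radial limits as boundary data. -/
lemma norm_le_of_exterior_limits {g : ℂ → ℂ} (hg : DifferentiableOn ℂ g {q | 1 < ‖q‖}) {c : ℝ}
    (hb : ∀ q : ℂ, 1 < ‖q‖ → ‖g q‖ ≤ c) {C : ℝ}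
    (hlim : ∀ᵐ Ω ∂(volume.restrict (Set.Icc (-Real.pi) Real.pi)), ∃ l : ℂ,
      Tendsto (fun r : ℝ => g (r * Complex.exp ((Ω : ℝ) * Complex.I))) (𝓝[>] 1) (𝓝 l) ∧ ‖l‖ ≤ C)
    {q : ℂ} (hq : 1 < ‖q‖) : ‖g q‖ ≤ C := by
  obtain ⟨f, hf, hfb, hfg⟩ := exists_disc_function hg hb
  rw [← hfg q hq]
  have h1 := ae_exp_periodic (p := fun e => ∃ l : ℂ,
    Tendsto (fun r : ℝ => g (r * e)) (𝓝[>] 1) (𝓝 l) ∧ ‖l‖ ≤ C) hlim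
  refine norm_le_of_radial_limits hf hfb ?_ (by
    rw [norm_inv]; exact inv_lt_one_of_one_lt₀ hq)
  filter_upwards [ae_neg h1] with θ ⟨l, hl, hlC⟩
  refine ⟨l, (hl.comp tendsto_inv_nhdsLT_one).congr' ?_, hlC⟩
  have h : Set.Ioo (0 : ℝ) 1 ∈ 𝓝[<] (1 : ℝ) := Ioo_mem_nhdsLT zero_lt_one
  filter_upwards [h] with r hr
  have hr1 : 1 < r⁻¹ := (one_lt_inv₀ hr.1).mpr hr.2
  rw [Function.comp_apply, ← hfg _ (norm_radial hr1 _), inv_radial, inv_inv, neg_neg]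

lemma exists_exterior_limit {g : ℂ → ℂ} (hg : DifferentiableOn ℂ g {q | 1 < ‖q‖}) {c : ℝ}
    (hb : ∀ q : ℂ, 1 < ‖q‖ → ‖g q‖ ≤ c) : ∀ᵐ Ω : ℝ, ∃ l : ℂ,
      Tendsto (fun r : ℝ => g (r * Complex.exp (Ω * Complex.I))) (𝓝[>] 1) (𝓝 l) := by
  obtain ⟨f, hf, hfb, hfg⟩ := exists_disc_function hg hb
  filter_upwards [ae_neg (exists_radial_limit hf hfb)] with Ω ⟨l, hl⟩
  refine ⟨l, (hl.comp tendsto_inv_nhdsGT_one).congr' ?_⟩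
  filter_upwards [self_mem_nhdsWithin] with r hr
  rw [Function.comp_apply, ← hfg _ (norm_radial hr _), inv_radial]

variable {m n : ℕ}

lemma HInf.exists_bound_act {G : ℂ → Matrix (Fin m) (Fin n) ℂ} (hG : HInf G) :
    ∃ c : ℝ, 0 ≤ c ∧ ∀ q : ℂ, 1 < ‖q‖ → ∀ x, ‖act (G q) x‖ ≤ c * ‖x‖ := by
  obtain ⟨-, c, hc⟩ := hG
  refine ⟨m * n * max c 0, by positivity, fun q hq x => ?_⟩
  exact norm_act_le (fun i j => (hc q hq i j).trans (le_max_left _ _)) x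

lemma hInf_of_act_bound {G : ℂ → Matrix (Fin m) (Fin n) ℂ} (hG : MatDiff G {q | 1 < ‖q‖}) {c : ℝ}
    (hc : ∀ q : ℂ, 1 < ‖q‖ → ∀ x, ‖act (G q) x‖ ≤ c * ‖x‖) : HInf G :=
  ⟨hG, c, fun q hq i j => norm_entry_le (hc q hq) i j⟩

lemma HInf.exists_boundaryValue {G : ℂ → Matrix (Fin m) (Fin n) ℂ} (hG : HInf G) :
    ∀ᵐ Ω : ℝ, ∃ M, HasBoundaryValue G Ω M := by
  obtain ⟨hd, c, hc⟩ := hG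
  have h1 : ∀ᵐ Ω : ℝ, ∀ i j, ∃ l : ℂ,
      Tendsto (fun r : ℝ => G (r * Complex.exp (Ω * Complex.I)) i j) (𝓝[>] 1) (𝓝 l) :=
    ae_all_iff.mpr fun i => ae_all_iff.mpr fun j =>
      exists_exterior_limit (hd i j) fun q hq => hc q hq i j
  filter_upwards [h1] with Ω hΩ
  choose M hM using hΩ
  exact ⟨Matrix.of M, tendsto_pi_nhds.mpr fun i => tendsto_pi_nhds.mpr fun j => hM i j⟩

/-- The inequality `YoulaIneq 0 Q κ` is a norm bound on `1 - κ Q`, so the maximum principle carries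
it from the circle to the exterior of the disc. -/
lemma HInf.youlaIneq_zero_of_boundary {Q : ℂ → Matrix (Fin n) (Fin n) ℂ} (hQ : HInf Q) {κ : ℝ}
    (hκ : 0 < κ) (h : ∀ᵐ Ω ∂(volume.restrict (Set.Icc (-Real.pi) Real.pi)),
      ∃ M, HasBoundaryValue Q Ω M ∧ YoulaIneq 0 M κ) {q : ℂ} (hq : 1 < ‖q‖) :
    YoulaIneq 0 (Q q) κ := by
  obtain ⟨c, hc0, hc⟩ := hQ.exists_bound_act
  refine (youlaIneq_zero_iff hκ).mpr fun a => ?_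
  set b := a - (κ : ℂ) • act (Q q) a with hb
  have key : ‖(inner ℂ b (a - (κ : ℂ) • act (Q q) a) : ℂ)‖ ≤ ‖b‖ * ‖a‖ := by
    refine norm_le_of_exterior_limits (g := fun w => inner ℂ b (a - (κ : ℂ) • act (Q w) a))
      (c := ‖b‖ * (‖a‖ + κ * (c * ‖a‖))) ?_ ?_ ?_ hq
    · simp only [inner_sub_right, inner_smul_right]
      exact (differentiableOn_const _).sub ((MatDiff.inner_act hQ.1 a b).const_mul _)
    · intro w hw
      refine (norm_inner_le_norm _ _).trans ?_
      gcongr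
      refine (norm_sub_le _ _).trans ?_
      rw [norm_smul, Complex.norm_real, Real.norm_of_nonneg hκ.le]
      gcongr
      exact hc w hw a
    · filter_upwards [h] with Ω ⟨M, hM, hY⟩
      refine ⟨inner ℂ b (a - (κ : ℂ) • act M a), ?_, ?_⟩
      · exact tendsto_const_nhds.inner (tendsto_const_nhds.sub ((tendsto_act hM a).const_smul _))
      · refine (norm_inner_le_norm _ _).trans ?_
        gcongr
        exact (youlaIneq_zero_iff hκ).mp hY a
  rw [← hb, inner_self_eq_norm_sq_to_K, norm_pow, RCLike.norm_ofReal, abs_norm, pow_two] at key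
  rcases (norm_nonneg b).eq_or_lt with h0 | h0
  · rw [← h0]; exact norm_nonneg a
  · exact le_of_mul_le_mul_left key h0

lemma tendsto_matrix_inv {α : Type*} {l : Filter α} {f : α → Matrix (Fin n) (Fin n) ℂ}
    {M : Matrix (Fin n) (Fin n) ℂ} (hf : Tendsto f l (𝓝 M)) (hM : IsUnit M.det) :
    Tendsto (fun a => (f a)⁻¹) l (𝓝 M⁻¹) := by
  simp only [Matrix.inv_def, Ring.inverse_eq_inv']
  have h1 : Continuous fun N : Matrix (Fin n) (Fin n) ℂ => N.det := continuous_id.matrix_det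
  have h2 : Continuous fun N : Matrix (Fin n) (Fin n) ℂ => N.adjugate :=
    continuous_id.matrix_adjugate
  exact (((h1.tendsto M).comp hf).inv₀ hM.ne_zero).smul ((h2.tendsto M).comp hf)

end Boundary

/-! ### The constraint as a pointwise inequality -/

section Constraint

variable {nP nw nu nz : ℕ} {P : Plant nP nw nu nz}

/-- The transfer function `u ↦ y` at the boundary point `e^{iΩ}`. -/
noncomputable def Plant.bdryTf (P : Plant nP nw nu nz) (τ Ω : ℝ) : Matrix (Fin nu) (Fin nu) ℂ :=
  P.discTf τ (Complex.exp (Ω * Complex.I))⁻¹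

lemma norm_inv_exp (Ω : ℝ) : ‖(Complex.exp (Ω * Complex.I))⁻¹‖ = 1 := by
  rw [norm_inv, Complex.norm_exp_ofReal_mul_I, inv_one]

lemma accretive_bdryTf (hP : P ∈ plantClass nP nw nu nz) {τ : ℝ} (hτ : 0 < τ) (Ω : ℝ) :
    Accretive (P.bdryTf τ Ω) := accretive_discTf P hP hτ (norm_inv_exp Ω).le

lemma inv_norm_lt_one {q : ℂ} (hq : 1 < ‖q‖) : ‖q⁻¹‖ < 1 := by
  rw [norm_inv]; exact inv_lt_one_of_one_lt₀ hq

lemma hasBoundaryValue_of_continuousOn {m n : ℕ} {G : ℂ → Matrix (Fin m) (Fin n) ℂ}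
    (hG : ContinuousOn G (Metric.closedBall 0 1)) (Ω : ℝ) :
    HasBoundaryValue (fun q => G q⁻¹) Ω (G (Complex.exp (Ω * Complex.I))⁻¹) := by
  have h1 : (Complex.exp (Ω * Complex.I))⁻¹ ∈ Metric.closedBall (0 : ℂ) 1 :=
    mem_closedBall_zero_iff.mpr (norm_inv_exp Ω).le
  refine (hG _ h1).tendsto.comp (tendsto_nhdsWithin_iff.mpr ⟨?_, ?_⟩)
  · have h2 : ContinuousAt (fun r : ℝ => ((r : ℂ) * Complex.exp (Ω * Complex.I))⁻¹) 1 :=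
      ContinuousAt.inv₀ (by fun_prop) (by simp [Complex.exp_ne_zero])
    have h3 := h2.tendsto
    simp only [Complex.ofReal_one, one_mul] at h3
    exact h3.mono_left nhdsWithin_le_nhds
  · filter_upwards [self_mem_nhdsWithin] with r hr
    exact mem_closedBall_zero_iff.mpr (inv_norm_lt_one (norm_radial hr Ω)).le

lemma hasBoundaryValue_discTf (hP : P ∈ plantClass nP nw nu nz) {τ : ℝ} (hτ : 0 < τ) (Ω : ℝ) :
    HasBoundaryValue (fun q => P.discTf τ q⁻¹) Ω (P.bdryTf τ Ω) :=
  hasBoundaryValue_of_continuousOn (continuousOn_discTf P hP hτ) Ω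

/-- The point `q = -1`, which corresponds to `s = ∞`, is negligible on the circle. -/
lemma ae_bilinear_eq_bdryTf (hP : P ∈ plantClass nP nw nu nz) {τ : ℝ} (hτ : 0 < τ) :
    ∀ᵐ Ω ∂(volume.restrict (Set.Icc (-Real.pi) Real.pi)),
      bilinear τ P.tfUY (Complex.exp ((Ω : ℝ) * Complex.I)) = P.bdryTf τ Ω := by
  have h1 : ∀ x : ℝ, ∀ᵐ Ω : ℝ, Ω ≠ x := fun x => by simp [ae_iff, measure_singleton]
  filter_upwards [ae_restrict_of_ae (h1 Real.pi), ae_restrict_of_ae (h1 (-Real.pi)),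
    ae_restrict_mem measurableSet_Icc] with Ω ha hb hΩ
  refine bilinear_tfUY_eq P hP hτ (Complex.norm_exp_ofReal_mul_I Ω).ge fun h => ha ?_
  have h2 : Complex.arg (Complex.exp (Ω * Complex.I)) = Ω :=
    Complex.arg_exp_mul_I Ω ▸ (toIocMod_eq_self _).mpr
      ⟨lt_of_le_of_ne hΩ.1 (Ne.symm hb), by linarith [hΩ.2]⟩
  rw [eq_neg_of_add_eq_zero_left h, Complex.arg_neg_one] at h2
  exact h2.symm

lemma hasBoundaryValue_blockU {n : ℕ} {Q F : ℂ → Matrix (Fin n) (Fin n) ℂ} {Ω : ℝ}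
    {M N : Matrix (Fin n) (Fin n) ℂ} (hQ : HasBoundaryValue Q Ω M)
    (hF : HasBoundaryValue F Ω N) :
    HasBoundaryValue (blockU Q F) Ω (Matrix.fromBlocks M M 0 N) := by
  have hc : Continuous fun p : Matrix (Fin n) (Fin n) ℂ × Matrix (Fin n) (Fin n) ℂ =>
      Matrix.fromBlocks p.1 p.1 0 p.2 :=
    continuous_fst.matrix_fromBlocks continuous_fst continuous_const continuous_snd
  exact (hc.tendsto (M, N)).comp (Tendsto.prodMk_nhds hQ hF)

lemma hasBoundaryValue_of_blockU {n : ℕ} {Q F : ℂ → Matrix (Fin n) (Fin n) ℂ} {Ω : ℝ}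
    {M : Matrix (Fin n ⊕ Fin n) (Fin n ⊕ Fin n) ℂ} (h : HasBoundaryValue (blockU Q F) Ω M) :
    HasBoundaryValue Q Ω M.toBlocks₁₁ := by
  have hc : Continuous fun N : Matrix (Fin n ⊕ Fin n) (Fin n ⊕ Fin n) ℂ => N.toBlocks₁₁ :=
    continuous_id.matrix_submatrix _ _
  exact (hc.tendsto M).comp h

/-- On the circle the block constraint is the pointwise inequality `YoulaIneq` for the plant. -/
lemma youlaConstraint_iff (hP : P ∈ plantClass nP nw nu nz) {ε τ : ℝ} (hε : 0 < ε) (hτ : 0 < τ)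
    {F : ℂ → Matrix (Fin nu) (Fin nu) ℂ} (hF : IsSpectralSummand P ε τ F)
    {Q : ℂ → Matrix (Fin nu) (Fin nu) ℂ} :
    YoulaConstraint Q F ↔ ∀ᵐ Ω ∂(volume.restrict (Set.Icc (-Real.pi) Real.pi)),
      ∃ M, HasBoundaryValue Q Ω M ∧ YoulaIneq (P.bdryTf τ Ω) M ε := by
  obtain ⟨-, -, -, hF⟩ := hF
  constructor
  · intro h
    filter_upwards [h, hF, ae_bilinear_eq_bdryTf hP hτ] with Ω ⟨M, hM, hpsd⟩ ⟨N, hN, hNeq⟩ hb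
    have hQ := hasBoundaryValue_of_blockU hM
    have hMeq := tendsto_nhds_unique hM (hasBoundaryValue_blockU hQ hN)
    rw [hb] at hNeq
    rw [hMeq] at hpsd
    exact ⟨_, hQ, (posSemidef_block_iff (accretive_bdryTf hP hτ Ω) hε hNeq).mp hpsd⟩
  · intro h
    filter_upwards [h, hF, ae_bilinear_eq_bdryTf hP hτ] with Ω ⟨M, hM, hY⟩ ⟨N, hN, hNeq⟩ hb
    rw [hb] at hNeq
    exact ⟨_, hasBoundaryValue_blockU hM hN,
      (posSemidef_block_iff (accretive_bdryTf hP hτ Ω) hε hNeq).mpr hY⟩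

end Constraint

/-! ### From passive feedback to the Youla parameter -/

section Forward

variable {nP nw nu nz : ℕ} {P : Plant nP nw nu nz}

lemma add_one_ne_zero_of_norm {q : ℂ} (hq : 1 < ‖q‖) : q + 1 ≠ 0 := by
  intro h
  rw [eq_neg_of_add_eq_zero_left h] at hq
  simp at hq

lemma ne_zero_of_norm {q : ℂ} (hq : 1 < ‖q‖) : q ≠ 0 := by
  rintro rfl
  simp at hq
  linarith

lemma bilinear_tfUY_eq_discTf (hP : P ∈ plantClass nP nw nu nz) {τ : ℝ} (hτ : 0 < τ) {q : ℂ}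
    (hq : 1 < ‖q‖) : bilinear τ P.tfUY q = P.discTf τ q⁻¹ :=
  bilinear_tfUY_eq P hP hτ hq.le (add_one_ne_zero_of_norm hq)

lemma sOfQ_re_pos {τ : ℝ} (hτ : 0 < τ) {q : ℂ} (hq : 1 < ‖q‖) : 0 < (sOfQ τ q).re := by
  rw [sOfQ_eq_sOfZ hτ (ne_zero_of_norm hq) (add_one_ne_zero_of_norm hq)]
  exact sOfZ_re_pos hτ (inv_norm_lt_one hq)

lemma differentiableOn_sOfQ (τ : ℝ) : DifferentiableOn ℂ (sOfQ τ) {q : ℂ | 1 < ‖q‖} := by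
  unfold sOfQ
  refine DifferentiableOn.const_mul (DifferentiableOn.div (by fun_prop) (by fun_prop) ?_) _
  exact fun q hq => add_one_ne_zero_of_norm hq

lemma matDiff_discTf_inv (hP : P ∈ plantClass nP nw nu nz) {τ : ℝ} (hτ : 0 < τ) :
    MatDiff (fun q => P.discTf τ q⁻¹) {q : ℂ | 1 < ‖q‖} := by
  refine (matDiff_discTf P τ).comp (g := fun q => q⁻¹) ?_ fun q hq => ?_
  · exact DifferentiableOn.inv differentiableOn_id fun q hq => ne_zero_of_norm hq
  · exact closedBall_subset_discDomain P hP hτ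
      (mem_closedBall_zero_iff.mpr (inv_norm_lt_one hq).le)

/-- Closing a passive plant around an output strictly passive controller gives a Youla parameter
in `H∞` that satisfies the constraint. -/
theorem exists_youlaParameter (hP : P ∈ plantClass nP nw nu nz) {ε τ : ℝ} (hε : 0 < ε)
    (hτ : 0 < τ) {F : ℂ → Matrix (Fin nu) (Fin nu) ℂ} (hF : IsSpectralSummand P ε τ F)
    {σ₀ : ℝ} (hσ : 0 ≤ σ₀) {K : ℂ → Matrix (Fin nu) (Fin nu) ℂ} {S : LTIMap nu nu}
    (hS : S ∈ ospClass nu ε) (hK : S.HasTransferFunction σ₀ K) :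
    ∃ Q : ℂ → Matrix (Fin nu) (Fin nu) ℂ,
      IsYoulaParameter P τ σ₀ K Q ∧ HInf Q ∧ YoulaConstraint Q F := by
  obtain ⟨H, hHd, hHK, hHY⟩ := exists_transfer_of_mem_ospClass hε hS hσ hK
  have hacc : ∀ q : ℂ, 1 < ‖q‖ → Accretive (P.discTf τ q⁻¹) := fun q hq =>
    accretive_discTf P hP hτ (inv_norm_lt_one hq).le
  have hfb : ∀ q : ℂ, 1 < ‖q‖ → IsUnit (1 + P.discTf τ q⁻¹ * H (sOfQ τ q)).det ∧
      YoulaIneq (P.discTf τ q⁻¹)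
        (H (sOfQ τ q) * (1 + P.discTf τ q⁻¹ * H (sOfQ τ q))⁻¹) ε := fun q hq => by
    have h := (hHY _ (sOfQ_re_pos hτ hq)).feedback (H := P.discTf τ q⁻¹) hε
      (by rw [zero_add]; exact hacc q hq)
    rwa [zero_add] at h
  set Q : ℂ → Matrix (Fin nu) (Fin nu) ℂ := fun q =>
    H (sOfQ τ q) * (1 + P.discTf τ q⁻¹ * H (sOfQ τ q))⁻¹ with hQ
  have hHq : MatDiff (fun q => H (sOfQ τ q)) {q : ℂ | 1 < ‖q‖} :=
    hHd.comp (differentiableOn_sOfQ τ) fun q hq => sOfQ_re_pos hτ hq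
  have hQd : MatDiff Q {q : ℂ | 1 < ‖q‖} :=
    hHq.mul (((MatDiff.const 1).add ((matDiff_discTf_inv hP hτ).mul hHq)).inv
      fun q hq => (hfb q hq).1)
  have hQi : HInf Q := hInf_of_act_bound hQd fun q hq x => (hfb q hq).2.norm_le hε (hacc q hq) x
  refine ⟨Q, fun q hq hqσ => ?_, hQi, (youlaConstraint_iff hP hε hτ hF).mpr ?_⟩
  · have h1 : bilinear τ K q = H (sOfQ τ q) := (hHK _ hqσ).symm
    rw [h1, bilinear_tfUY_eq_discTf hP hτ hq]
    exact ⟨(hfb q hq).1, rfl⟩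
  · filter_upwards [ae_restrict_of_ae hQi.exists_boundaryValue] with Ω ⟨M, hM⟩
    refine ⟨M, hM, YoulaIneq.of_tendsto (hasBoundaryValue_discTf hP hτ Ω) hM ?_⟩
    filter_upwards [self_mem_nhdsWithin] with r hr using (hfb _ (norm_radial hr Ω)).2

end Forward

/-! ### From the Youla parameter to passive feedback -/

section Backward

variable {nP nw nu nz : ℕ} {P : Plant nP nw nu nz}

/-- The boundary inequality for `Q` propagates to the exterior of the disc. It is not itself a norm
bound, so `Q` is first closed around `c - P`, which replaces the plant by the constant `c`; for a
constant plant the inequality is a norm bound, and closing around `P - c` recovers `Q`. -/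
theorem youlaIneq_of_boundary (hP : P ∈ plantClass nP nw nu nz) {ε τ : ℝ} (hε : 0 < ε)
    (hτ : 0 < τ) {Q : ℂ → Matrix (Fin nu) (Fin nu) ℂ} (hQ : HInf Q)
    (h : ∀ᵐ Ω ∂(volume.restrict (Set.Icc (-Real.pi) Real.pi)),
      ∃ M, HasBoundaryValue Q Ω M ∧ YoulaIneq (P.bdryTf τ Ω) M ε) {q : ℂ} (hq : 1 < ‖q‖) :
    YoulaIneq (P.discTf τ q⁻¹) (Q q) ε := by
  obtain ⟨c, hc0, hc⟩ := exists_bound_discTf P hP hτ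
  have h0 : ∀ q : ℂ, 1 < ‖q‖ → YoulaIneq 0 (Q q) ε := fun q hq => by
    refine hQ.youlaIneq_zero_of_boundary hε ?_ hq
    filter_upwards [h] with Ω ⟨M, hM, hY⟩
    exact ⟨M, hM, hY.weaken (by rw [sub_zero]; exact accretive_bdryTf hP hτ Ω)⟩
  set H : ℂ → Matrix (Fin nu) (Fin nu) ℂ := fun q => (c : ℂ) • 1 - P.discTf τ q⁻¹ with hH
  have hHacc : ∀ q : ℂ, 1 < ‖q‖ → Accretive (H q) := fun q hq v => by
    have h1 : (inner ℂ v (act (P.discTf τ q⁻¹) v)).re ≤ c * ‖v‖ ^ 2 := by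
      refine (Complex.re_le_norm _).trans ((norm_inner_le_norm _ _).trans ?_)
      have := mul_le_mul_of_nonneg_left (hc _ (inv_norm_lt_one hq).le v) (norm_nonneg v)
      linarith
    rw [hH, sub_act, smul_act, one_act, inner_sub_right, inner_smul_right, Complex.sub_re,
      Complex.re_ofReal_mul, inner_self_re_eq]
    linarith
  have hfb : ∀ q : ℂ, 1 < ‖q‖ → IsUnit (1 + H q * Q q).det ∧
      YoulaIneq (H q) (Q q * (1 + H q * Q q)⁻¹) ε := fun q hq => by
    have h := (h0 q hq).feedback (H := H q) hε (by rw [zero_add]; exact hHacc q hq)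
    rwa [zero_add] at h
  set Y : ℂ → Matrix (Fin nu) (Fin nu) ℂ := fun q => Q q * (1 + H q * Q q)⁻¹ with hY
  have hHd : MatDiff H {q : ℂ | 1 < ‖q‖} := (MatDiff.const _).sub (matDiff_discTf_inv hP hτ)
  have hYd : MatDiff Y {q : ℂ | 1 < ‖q‖} :=
    MatDiff.mul hQ.1 (((MatDiff.const 1).add (hHd.mul hQ.1)).inv fun q hq => (hfb q hq).1)
  have hYi : HInf Y := hInf_of_act_bound hYd fun q hq x => (hfb q hq).2.norm_le hε (hHacc q hq) x
  have hκ : 0 < 2 * c + ε := by linarith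
  have hcacc : Accretive ((c : ℂ) • (1 : Matrix (Fin nu) (Fin nu) ℂ)) := fun v => by
    rw [smul_act, one_act, inner_smul_right, Complex.re_ofReal_mul, inner_self_re_eq]
    positivity
  have hYY : YoulaIneq 0 (Y q) (2 * c + ε) := by
    refine hYi.youlaIneq_zero_of_boundary hκ ?_ hq
    filter_upwards [h] with Ω ⟨M, hM, hMY⟩
    set Hb : Matrix (Fin nu) (Fin nu) ℂ := (c : ℂ) • 1 - P.bdryTf τ Ω with hHb
    have hsum : P.bdryTf τ Ω + Hb = (c : ℂ) • 1 := by rw [hHb]; abel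
    have h1 := hMY.feedback (H := Hb) hε (by rw [hsum]; exact hcacc)
    rw [hsum, youlaIneq_smul_one] at h1
    refine ⟨_, ?_, h1.2⟩
    have h2 : HasBoundaryValue H Ω Hb :=
      Tendsto.sub tendsto_const_nhds (hasBoundaryValue_discTf hP hτ Ω)
    exact Tendsto.mul hM (tendsto_matrix_inv (tendsto_const_nhds.add (Tendsto.mul h2 hM)) h1.1)
  have hYc := youlaIneq_smul_one.mpr hYY
  have hsum : (c : ℂ) • 1 + -H q = P.discTf τ q⁻¹ := by simp only [hH]; abel
  have h2 := (hYc.feedback (H := -H q) hε (by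
    rw [hsum]; exact accretive_discTf P hP hτ (inv_norm_lt_one hq).le)).2
  rwa [hsum, hY, feedback_feedback_neg (hfb q hq).1] at h2

/-- A matrix function with analytic entries is analytic as an operator-valued function. -/
lemma MatDiff.actL {m n : ℕ} {f : ℂ → Matrix (Fin m) (Fin n) ℂ} {U : Set ℂ} (hf : MatDiff f U) :
    DifferentiableOn ℂ (fun q => PassiveYoula.actL (f q)) U := by
  have h : ∀ q, PassiveYoula.actL (f q) =
      ∑ i, ∑ j, f q i j • PassiveYoula.actL (Matrix.single i j (1 : ℂ)) := by
    intro q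
    have h1 : ∀ x, act (f q) x =
        act (∑ i, ∑ j, f q i j • Matrix.single i j (1 : ℂ)) x := fun x => by
      congr 1
      conv_lhs => rw [Matrix.matrix_eq_sum_single (f q)]
      simp [Matrix.smul_single]
    ext1 x
    rw [actL_apply, h1]
    simp only [FunLike.coe_sum, Finset.sum_apply, _root_.smul_apply, actL_apply]
    have hs : ∀ {ι : Type} (s : Finset ι) (g : ι → Matrix (Fin m) (Fin n) ℂ),
        act (∑ i ∈ s, g i) x = ∑ i ∈ s, act (g i) x := fun s g =>
      map_sum (AddMonoidHom.mk' (fun M : Matrix (Fin m) (Fin n) ℂ => act M x)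
        fun a b => add_act a b x) g s
    simp only [hs, smul_act]
  simp only [h]
  exact DifferentiableOn.fun_sum fun i _ => DifferentiableOn.fun_sum fun j _ =>
    (hf i j).smul_const _

/-- The map `(1 - T) / ε` for a causal time-invariant operator `T`. -/
noncomputable def ltiOfContraction {n : ℕ} (ε : ℝ) (T : L2Signal n →L[ℂ] L2Signal n)
    (hc : ∀ t f, restr n t f = 0 → restr n t (T f) = 0)
    (hs : ∀ h f, T (shift n h f) = shift n h (T f)) : LTIMap n n where
  toLin := ((ε : ℂ)⁻¹ • (ContinuousLinearMap.id ℂ _ - T)).toLinearMap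
  causal t f hf := by
    have h1 := restr_eq_zero_iff.mpr hf
    refine restr_eq_zero_iff.mp ?_
    change restr n t ((ε : ℂ)⁻¹ • (f - T f)) = 0
    rw [map_smul, map_sub, h1, hc t f h1, sub_zero, smul_zero]
  timeInvariant r f g hg := by
    have h1 : g = shift n r f := by
      refine Lp.ext ?_
      filter_upwards [hg, coeFn_shift r f] with t h1 h2
      rw [h1, h2]
    have h2 : (ε : ℂ)⁻¹ • (g - T g) = shift n r ((ε : ℂ)⁻¹ • (f - T f)) := by
      rw [h1, hs, map_smul, map_sub]
    have h3 := coeFn_shift r ((ε : ℂ)⁻¹ • (f - T f))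
    rw [← h2] at h3
    exact h3

lemma ltiOfContraction_apply {n : ℕ} {ε : ℝ} {T : L2Signal n →L[ℂ] L2Signal n}
    {hc : ∀ t f, restr n t f = 0 → restr n t (T f) = 0}
    {hs : ∀ h f, T (shift n h f) = shift n h (T f)} (f : L2Signal n) :
    (ltiOfContraction ε T hc hs).toLin f = (ε : ℂ)⁻¹ • (f - T f) := rfl

lemma sOfQ_cayley {τ : ℝ} (hτ : 0 < τ) {s : ℂ} (hs : 0 < s.re)
    (hne : s ≠ ((1 / (2 * τ) : ℝ) : ℂ)) :
    1 < ‖((((1 / (2 * τ) : ℝ) : ℂ) - s) / (((1 / (2 * τ) : ℝ) : ℂ) + s))⁻¹‖ ∧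
      sOfQ τ ((((1 / (2 * τ) : ℝ) : ℂ) - s) / (((1 / (2 * τ) : ℝ) : ℂ) + s))⁻¹ = s := by
  set a : ℝ := 1 / (2 * τ) with ha
  have ha0 : 0 < a := by positivity
  have h1 : (a : ℂ) + s ≠ 0 := by
    intro h
    have := congrArg Complex.re h
    simp at this
    linarith
  have h2 : (a : ℂ) - s ≠ 0 := sub_ne_zero.mpr hne.symm
  have ha' : (a : ℂ) ≠ 0 := by exact_mod_cast ha0.ne'
  constructor
  · rw [norm_inv]
    exact (one_lt_inv₀ (norm_pos_iff.mpr (div_ne_zero h2 h1))).mpr (norm_cayley_lt_one ha0 hs)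
  · have h3 : 1 / (2 * (τ : ℂ)) = (a : ℂ) := by rw [ha]; push_cast; rfl
    rw [sOfQ, h3, inv_div]
    have h4 : ((a : ℂ) + s) / (a - s) + 1 ≠ 0 := by
      rw [div_add_one h2]
      refine div_ne_zero ?_ h2
      ring_nf
      exact mul_ne_zero ha' two_ne_zero
    rw [div_sub_one h2, div_add_one h2, div_div_div_cancel_right₀ h2]
    have h5 : (a : ℂ) + s + (a - s) = 2 * a := by ring
    have h6 : (a : ℂ) + s - (a - s) = 2 * s := by ring
    rw [h5, h6]
    field_simp

lemma tendsto_act_act {α : Type*} {l : Filter α} {m n : ℕ}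
    {f : α → Matrix (Fin m) (Fin n) ℂ} {g : α → EuclideanSpace ℂ (Fin n)}
    {M : Matrix (Fin m) (Fin n) ℂ} {x : EuclideanSpace ℂ (Fin n)}
    (hf : Tendsto f l (𝓝 M)) (hg : Tendsto g l (𝓝 x)) :
    Tendsto (fun a => act (f a) (g a)) l (𝓝 (act M x)) := by
  have h1 : ∀ i, Tendsto (fun a => act (f a) (g a) i) l (𝓝 (act M x i)) := fun i => by
    simp only [act_coord]
    refine tendsto_finsetSum _ fun j _ => Tendsto.mul ?_ ?_
    · exact tendsto_pi_nhds.mp (tendsto_pi_nhds.mp hf i) j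
    · exact ((EuclideanSpace.proj (𝕜 := ℂ) j).continuous.tendsto x).comp hg
  exact ((PiLp.continuous_toLp 2 _).tendsto _).comp (tendsto_pi_nhds.mpr h1)

/-- Both sides of the defining identity of a transfer function are continuous in `s`, so a single
point may be left out. -/
lemma hasTransferFunction_of_ne {n : ℕ} {S : LTIMap n n} {σ₀ : ℝ} (hσ : 0 ≤ σ₀)
    {K : ℂ → Matrix (Fin n) (Fin n) ℂ} (hK : AnalyticOnHalfPlane σ₀ K) {s₁ : ℂ}
    (h : ∀ f : L2Signal n, (∀ᵐ t : ℝ, t < 0 → f t = 0) → ∀ s : ℂ, σ₀ < s.re → s ≠ s₁ →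
      laplace (S.toLin f) s = act (K s) (laplace f s)) : S.HasTransferFunction σ₀ K := by
  intro f hf s hs
  by_cases hsa : s = s₁
  swap
  · exact h f hf s hs hsa
  have hs0 : 0 < s.re := hσ.trans_lt hs
  have hcont : ∀ g : L2Signal n, Tendsto (laplace g) (𝓝[≠] s) (𝓝 (laplace g s)) := fun g =>
    ((differentiableOn_laplace g).differentiableAt
      ((isOpen_re_gt 0).mem_nhds hs0)).continuousAt.tendsto.mono_left nhdsWithin_le_nhds
  have hKc : Tendsto K (𝓝[≠] s) (𝓝 (K s)) :=
    ((MatDiff.continuousOn hK).continuousAt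
      ((isOpen_re_gt σ₀).mem_nhds hs)).tendsto.mono_left nhdsWithin_le_nhds
  have heq : (fun w => act (K w) (laplace f w)) =ᶠ[𝓝[≠] s] laplace (S.toLin f) := by
    filter_upwards [self_mem_nhdsWithin, nhdsWithin_le_nhds ((isOpen_re_gt σ₀).mem_nhds hs)]
      with w hw1 hw2
    exact (h f hf w hw2 (by rw [← hsa]; exact hw1)).symm
  have hlim := (tendsto_act_act hKc (hcont f)).congr' heq
  exact tendsto_nhds_unique (hcont (S.toLin f)) hlim

/-- A Youla parameter in `H∞` that satisfies the constraint comes from an output strictly passive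
controller. -/
theorem exists_mem_ospClass (hP : P ∈ plantClass nP nw nu nz) {ε τ : ℝ} (hε : 0 < ε)
    (hτ : 0 < τ) {F : ℂ → Matrix (Fin nu) (Fin nu) ℂ} (hF : IsSpectralSummand P ε τ F)
    {σ₀ : ℝ} (hσ : 0 ≤ σ₀) {K Q : ℂ → Matrix (Fin nu) (Fin nu) ℂ}
    (hK : AnalyticOnHalfPlane σ₀ K) (hYP : IsYoulaParameter P τ σ₀ K Q) (hQ : HInf Q)
    (hQF : YoulaConstraint Q F) : ∃ S ∈ ospClass nu ε, S.HasTransferFunction σ₀ K := by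
  have hεc : (ε : ℂ) ≠ 0 := by exact_mod_cast hε.ne'
  have hY : ∀ q : ℂ, 1 < ‖q‖ → YoulaIneq (P.discTf τ q⁻¹) (Q q) ε := fun q hq =>
    youlaIneq_of_boundary hP hε hτ hQ ((youlaConstraint_iff hP hε hτ hF).mp hQF) hq
  have hfb : ∀ q : ℂ, 1 < ‖q‖ → IsUnit (1 + -P.discTf τ q⁻¹ * Q q).det ∧
      YoulaIneq 0 (Q q * (1 + -P.discTf τ q⁻¹ * Q q)⁻¹) ε := fun q hq => by
    have h := (hY q hq).feedback (H := -P.discTf τ q⁻¹) hε (by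
      rw [add_neg_cancel]; intro v; simp)
    rwa [add_neg_cancel] at h
  set G : ℂ → Matrix (Fin nu) (Fin nu) ℂ := fun q =>
    Q q * (1 + -P.discTf τ q⁻¹ * Q q)⁻¹ with hG
  have hGK : ∀ q : ℂ, 1 < ‖q‖ → σ₀ < (sOfQ τ q).re → G q = K (sOfQ τ q) := by
    intro q hq hqσ
    obtain ⟨h1, h2⟩ := hYP q hq hqσ
    rw [bilinear_tfUY_eq_discTf hP hτ hq] at h1 h2
    simp only [hG]
    rw [h2, feedback_feedback_neg h1]
    rfl
  have hGd : MatDiff G {q : ℂ | 1 < ‖q‖} :=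
    MatDiff.mul hQ.1 (((MatDiff.const 1).add ((matDiff_discTf_inv hP hτ).neg.mul hQ.1)).inv
      fun q hq => (hfb q hq).1)
  have hdiff : MatDiff (fun q => 1 - (ε : ℂ) • G q) {q : ℂ | 1 < ‖q‖} :=
    (MatDiff.const 1).sub (MatDiff.smul (differentiableOn_const _) hGd)
  have hnorm : ∀ q : ℂ, 1 < ‖q‖ → ‖actL (1 - (ε : ℂ) • G q)‖ ≤ 1 := fun q hq => by
    refine ContinuousLinearMap.opNorm_le_bound _ zero_le_one fun x => ?_
    rw [actL_apply, sub_act, one_act, smul_act, one_mul]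
    exact (youlaIneq_zero_iff hε).mp (hfb q hq).2 x
  obtain ⟨Θ, hΘd, hΘn, hΘ⟩ := exists_disc_function hdiff.actL hnorm
  have ha : 0 < 1 / (2 * τ) := by positivity
  obtain ⟨T, hTn, hTc, hTs, hTl⟩ := exists_contraction_of_symbol ha hΘd hΘn
  refine ⟨ltiOfContraction ε T hTc hTs, (mem_ospClass_iff hε).mpr fun f => ?_,
    -- The point `s = 1 / (2 τ)` corresponds to `q = ∞`.
    hasTransferFunction_of_ne hσ hK (s₁ := ((1 / (2 * τ) : ℝ) : ℂ)) fun f hf s hs hsa => ?_⟩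
  · rw [ltiOfContraction_apply, smul_inv_smul₀ hεc, sub_sub_cancel]
    exact hTn f
  · have hs0 : 0 < s.re := hσ.trans_lt hs
    obtain ⟨h1, h2⟩ := sOfQ_cayley hτ hs0 hsa
    have h3 := hΘ _ h1
    rw [inv_inv] at h3
    rw [ltiOfContraction_apply, ← laplaceL_apply hs0, map_smul, map_sub, laplaceL_apply,
      laplaceL_apply, hTl s hs0 f (restr_eq_zero_iff.mpr hf), h3, hGK _ h1 (by rwa [h2]), h2,
      actL_apply, sub_act, one_act, smul_act, sub_sub_cancel, inv_smul_smul₀ hεc]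

end Backward

/-! ### Additive splitting of an analytic function on the circle -/

section Splitting

lemma fact_two_pi_pos : Fact (0 < 2 * Real.pi) := ⟨Real.two_pi_pos⟩

attribute [local instance] fact_two_pi_pos

/-- The Laurent coefficient of index `k` of a function on the unit circle. -/
noncomputable def circleCoeff (φ : ℂ → ℂ) (k : ℤ) : ℂ :=
  fourierCoeff (fun x : AddCircle (2 * Real.pi) => φ (AddCircle.toCircle x)) k

lemma toCircle_two_pi (x : ℝ) :
    ((AddCircle.toCircle (x : AddCircle (2 * Real.pi)) : Circle) : ℂ) =
      Complex.exp (x * Complex.I) := by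
  rw [AddCircle.toCircle_apply_mk, Circle.coe_exp, div_self (by positivity), one_mul]

lemma continuous_toCircle_comp {φ : ℂ → ℂ} {U : Set ℂ} (hφ : ContinuousOn φ U)
    (hU : Metric.sphere 0 1 ⊆ U) :
    Continuous fun x : AddCircle (2 * Real.pi) => φ (AddCircle.toCircle x) := by
  refine hφ.comp_continuous (continuous_subtype_val.comp AddCircle.continuous_toCircle) fun x => ?_
  exact hU (mem_sphere_zero_iff_norm.mpr (Circle.norm_coe _))

lemma exists_bound_circleCoeff {φ : ℂ → ℂ} {U : Set ℂ} (hφ : ContinuousOn φ U)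
    (hU : Metric.sphere 0 1 ⊆ U) : ∃ C : ℝ, 0 ≤ C ∧ ∀ k, ‖circleCoeff φ k‖ ≤ C := by
  obtain ⟨C, hC⟩ := (isCompact_sphere (0 : ℂ) 1).exists_bound_of_continuousOn (hφ.mono hU)
  refine ⟨C, (norm_nonneg _).trans (hC 1 (by simp)), fun k => ?_⟩
  rw [circleCoeff, fourierCoeff]
  refine (norm_integral_le_of_norm_le_const (C := C) (ae_of_all _ fun x => ?_)).trans (by simp)
  rw [norm_smul, fourier_apply, Circle.norm_coe, one_mul]
  exact hC _ (mem_sphere_zero_iff_norm.mpr (Circle.norm_coe _))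

/-- Integration by parts on the circle. -/
lemma circleCoeff_eq_div {φ : ℂ → ℂ} {U : Set ℂ} (hUo : IsOpen U) (hφ : DifferentiableOn ℂ φ U)
    (hU : Metric.sphere 0 1 ⊆ U) {k : ℤ} (hk : k ≠ 0) :
    circleCoeff φ k = circleCoeff (fun z => z * Complex.I * deriv φ z) k / (Complex.I * k) := by
  have hcoe : ∀ ψ : ℂ → ℂ, circleCoeff ψ k =
      fourierCoeffOn Real.two_pi_pos (fun x => ψ (Complex.exp ((x : ℝ) * Complex.I))) k := by
    intro ψ
    rw [circleCoeff, fourierCoeff_eq_intervalIntegral _ _ 0, fourierCoeffOn_eq_integral]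
    simp only [toCircle_two_pi, fourier_coe_apply, zero_add, sub_zero]
  have hmem : ∀ x : ℝ, Complex.exp (x * Complex.I) ∈ U := fun x => hU (by simp)
  have hd : ∀ x : ℝ, HasDerivAt (fun x : ℝ => φ (Complex.exp (x * Complex.I)))
      (Complex.exp (x * Complex.I) * Complex.I * deriv φ (Complex.exp (x * Complex.I))) x := by
    intro x
    have h1 : HasDerivAt (fun x : ℝ => Complex.exp (x * Complex.I))
        (Complex.exp (x * Complex.I) * Complex.I) x := by
      have := ((hasDerivAt_mul_const (Complex.I)).cexp (x := (x : ℂ))).comp_ofReal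
      simpa using this
    have h2 := ((hφ.differentiableAt (hUo.mem_nhds (hmem x))).hasDerivAt).comp x h1
    exact h2.congr_deriv (mul_comm _ _)
  have hc : Continuous fun x : ℝ => Complex.exp (x * Complex.I) * Complex.I *
      deriv φ (Complex.exp (x * Complex.I)) := by
    refine Continuous.mul (by fun_prop) ?_
    exact (hφ.deriv hUo).continuousOn.comp_continuous (by fun_prop) hmem
  rw [hcoe, hcoe, fourierCoeffOn_of_hasDerivAt Real.two_pi_pos hk (fun x _ => hd x)
    (hc.intervalIntegrable _ _)]
  have hper : Complex.exp (((2 * Real.pi : ℝ) : ℂ) * Complex.I) =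
      Complex.exp (((0 : ℝ) : ℂ) * Complex.I) := by
    push_cast; rw [Complex.exp_two_pi_mul_I]; simp
  have hk' : (k : ℂ) ≠ 0 := by exact_mod_cast hk
  have hpi : (Real.pi : ℂ) ≠ 0 := by exact_mod_cast Real.pi_ne_zero
  rw [hper, sub_self, mul_zero, zero_sub]
  push_cast
  field_simp
  ring

/-- Two integrations by parts bound the coefficients by a multiple of `k⁻²`. -/
lemma summable_circleCoeff {φ : ℂ → ℂ} {U : Set ℂ} (hUo : IsOpen U)
    (hφ : DifferentiableOn ℂ φ U) (hU : Metric.sphere 0 1 ⊆ U) :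
    Summable fun k => ‖circleCoeff φ k‖ := by
  have hstep : ∀ ψ : ℂ → ℂ, DifferentiableOn ℂ ψ U →
      DifferentiableOn ℂ (fun z => z * Complex.I * deriv ψ z) U := fun ψ hψ =>
    DifferentiableOn.mul (by fun_prop) (hψ.deriv hUo)
  obtain ⟨C, hC0, hC⟩ := exists_bound_circleCoeff (hstep _ (hstep φ hφ)).continuousOn hU
  have h1 : Summable fun k : ℤ => C * (1 / (k : ℝ) ^ 2) :=
    (Real.summable_one_div_int_pow.mpr one_lt_two).mul_left C
  refine Summable.of_norm_bounded_eventually h1 ?_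
  have h2 : ∀ᶠ k : ℤ in cofinite, k ≠ 0 := by
    simpa using (Set.finite_singleton (0 : ℤ)).compl_mem_cofinite
  filter_upwards [h2] with k hk
  rw [circleCoeff_eq_div hUo hφ hU hk, circleCoeff_eq_div hUo (hstep φ hφ) hU hk, norm_norm,
    norm_div, norm_div, norm_mul, Complex.norm_I, one_mul, div_div, ← pow_two,
    Complex.norm_intCast, sq_abs, mul_one_div]
  gcongr
  exact hC k

lemma hasSum_circleCoeff {φ : ℂ → ℂ} {U : Set ℂ} (hUo : IsOpen U)
    (hφ : DifferentiableOn ℂ φ U) (hU : Metric.sphere 0 1 ⊆ U) {z : ℂ} (hz : ‖z‖ = 1) :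
    HasSum (fun k : ℤ => circleCoeff φ k * z ^ k) (φ z) := by
  set x : AddCircle (2 * Real.pi) := ((Complex.arg z : ℝ) : AddCircle (2 * Real.pi)) with hx
  have hxz : ((AddCircle.toCircle x : Circle) : ℂ) = z := by
    rw [hx, toCircle_two_pi]
    have := Complex.norm_mul_exp_arg_mul_I z
    rwa [hz, Complex.ofReal_one, one_mul] at this
  have h := has_pointwise_sum_fourier_series_of_summable
    (f := ⟨_, continuous_toCircle_comp hφ.continuousOn hU⟩)
    ((summable_circleCoeff hUo hφ hU).of_norm) x
  have h2 : ∀ k : ℤ, (fourier k x : ℂ) = z ^ k := fun k => by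
    rw [fourier_apply, AddCircle.toCircle_zsmul, Circle.coe_zpow, hxz]
  simp only [h2, ContinuousMap.coe_mk, hxz, smul_eq_mul] at h
  exact h

lemma conj_circleCoeff {φ ψ : ℂ → ℂ}
    (h : ∀ z : ℂ, ‖z‖ = 1 → ψ z = (starRingEnd ℂ) (φ z)) (k : ℤ) :
    (starRingEnd ℂ) (circleCoeff ψ k) = circleCoeff φ (-k) := by
  rw [circleCoeff, circleCoeff, fourierCoeff, fourierCoeff, ← integral_conj]
  refine integral_congr_ae (ae_of_all _ fun x => ?_)
  simp only [smul_eq_mul, map_mul]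
  rw [h _ (Circle.norm_coe (AddCircle.toCircle x)), Complex.conj_conj, neg_neg,
    fourier_neg, Complex.conj_conj]

/-- The analytic half `c₀ / 2 + ∑_{k ≥ 1} c_k z ^ k` of the Laurent series of `φ`. -/
noncomputable def analyticHalf (φ : ℂ → ℂ) (z : ℂ) : ℂ :=
  (∑' k : ℕ, circleCoeff φ k * z ^ k) - circleCoeff φ 0 / 2

lemma summable_circleCoeff_nat {φ : ℂ → ℂ} {U : Set ℂ} (hUo : IsOpen U)
    (hφ : DifferentiableOn ℂ φ U) (hU : Metric.sphere 0 1 ⊆ U) :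
    Summable fun k : ℕ => ‖circleCoeff φ k‖ :=
  (summable_circleCoeff hUo hφ hU).comp_injective Nat.cast_injective

lemma differentiableOn_analyticHalf {φ : ℂ → ℂ} {U : Set ℂ} (hUo : IsOpen U)
    (hφ : DifferentiableOn ℂ φ U) (hU : Metric.sphere 0 1 ⊆ U) :
    DifferentiableOn ℂ (analyticHalf φ) (Metric.ball 0 1) := by
  refine DifferentiableOn.sub_const ?_ _
  refine Complex.differentiableOn_tsum_of_summable_norm (summable_circleCoeff_nat hUo hφ hU)
    (fun k => by fun_prop) Metric.isOpen_ball fun k w hw => ?_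
  rw [norm_mul, norm_pow]
  exact mul_le_of_le_one_right (norm_nonneg _)
    (pow_le_one₀ (norm_nonneg _) (mem_ball_zero_iff.mp hw).le)

lemma continuousOn_analyticHalf {φ : ℂ → ℂ} {U : Set ℂ} (hUo : IsOpen U)
    (hφ : DifferentiableOn ℂ φ U) (hU : Metric.sphere 0 1 ⊆ U) :
    ContinuousOn (analyticHalf φ) (Metric.closedBall 0 1) := by
  refine ContinuousOn.sub ?_ continuousOn_const
  refine continuousOn_tsum (fun k => by fun_prop) (summable_circleCoeff_nat hUo hφ hU)
    fun k w hw => ?_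
  rw [norm_mul, norm_pow]
  exact mul_le_of_le_one_right (norm_nonneg _)
    (pow_le_one₀ (norm_nonneg _) (mem_closedBall_zero_iff.mp hw))

/-- On the circle a function is the sum of its analytic half and the conjugate of the analytic half
of its conjugate. -/
lemma analyticHalf_add_conj {φ : ℂ → ℂ} {U : Set ℂ} (hUo : IsOpen U)
    (hφ : DifferentiableOn ℂ φ U) (hU : Metric.sphere 0 1 ⊆ U)
    {ψ : ℂ → ℂ} {V : Set ℂ} (hVo : IsOpen V)
    (hψ : DifferentiableOn ℂ ψ V) (hV : Metric.sphere 0 1 ⊆ V)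
    (h : ∀ z : ℂ, ‖z‖ = 1 → ψ z = (starRingEnd ℂ) (φ z)) {z : ℂ} (hz : ‖z‖ = 1) :
    analyticHalf φ z + (starRingEnd ℂ) (analyticHalf ψ z) = φ z := by
  have hb : ∀ {χ : ℂ → ℂ}, (Summable fun k : ℕ => ‖circleCoeff χ k‖) →
      Summable fun k : ℕ => circleCoeff χ k * z ^ k := fun hs =>
    Summable.of_norm_bounded hs fun k => by rw [norm_mul, norm_pow, hz, one_pow, mul_one]
  have h1 := (hb (summable_circleCoeff_nat hUo hφ hU)).hasSum
  have h2 := Complex.hasSum_conj'.mpr (hb (summable_circleCoeff_nat hVo hψ hV)).hasSum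
  have h3 := (hasSum_circleCoeff hUo hφ hU hz).nat_add_neg
  have hzc : (starRingEnd ℂ) z = z⁻¹ := (Complex.inv_eq_conj hz).symm
  have h4 : ∀ k : ℕ, (starRingEnd ℂ) (circleCoeff ψ k * z ^ k) =
      circleCoeff φ (-k) * z ^ (-(k : ℤ)) := fun k => by
    rw [map_mul, conj_circleCoeff h, map_pow, hzc, _root_.zpow_neg, zpow_natCast, inv_pow]
  simp only [h4] at h2
  have h5 := (h1.add h2).unique (by simpa using h3)
  have h6 : (starRingEnd ℂ) (circleCoeff ψ 0) = circleCoeff φ 0 := by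
    rw [conj_circleCoeff h, neg_zero]
  rw [analyticHalf, analyticHalf, map_sub, map_div₀, h6, Complex.conj_ofNat]
  linear_combination h5

end Splitting

/-! ### The spectral summand -/

section Spectral

variable {n : ℕ}

/-- A Hermitian matrix function on the circle, analytic near it, is `F + Fᴴ` for a function `F`
that is analytic in the disc and continuous up to the circle. -/
lemma exists_add_conjTranspose_eq {Φ : ℂ → Matrix (Fin n) (Fin n) ℂ} {U : Set ℂ} (hUo : IsOpen U)
    (hΦ : MatDiff Φ U) (hU : Metric.sphere 0 1 ⊆ U)
    (hH : ∀ z : ℂ, ‖z‖ = 1 → (Φ z).IsHermitian) :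
    ∃ F : ℂ → Matrix (Fin n) (Fin n) ℂ, MatDiff F (Metric.ball 0 1) ∧
      ContinuousOn F (Metric.closedBall 0 1) ∧ ∀ z : ℂ, ‖z‖ = 1 → F z + (F z)ᴴ = Φ z := by
  refine ⟨fun z => Matrix.of fun i j => analyticHalf (fun w => Φ w i j) z, fun i j => ?_, ?_, ?_⟩
  · exact differentiableOn_analyticHalf hUo (hΦ i j) hU
  · exact continuousOn_pi.mpr fun i => continuousOn_pi.mpr fun j =>
      continuousOn_analyticHalf hUo (hΦ i j) hU
  · intro z hz
    ext i j
    rw [Matrix.add_apply, Matrix.conjTranspose_apply]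
    exact analyticHalf_add_conj hUo (hΦ i j) hU hUo (hΦ j i) hU
      (fun w hw => ((hH w hw).apply j i).symm) hz

/-- A lower bound for the Hermitian part propagates from the circle into the disc, by the maximum
principle for `exp (-⟪v, F z v⟫)`. -/
lemma le_re_inner_of_sphere {F : ℂ → Matrix (Fin n) (Fin n) ℂ} (hF : MatDiff F (Metric.ball 0 1))
    (hFc : ContinuousOn F (Metric.closedBall 0 1)) {δ : ℝ}
    (h : ∀ z : ℂ, ‖z‖ = 1 → ∀ v, δ * ‖v‖ ^ 2 ≤ (inner ℂ v (act (F z) v)).re) {z : ℂ}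
    (hz : ‖z‖ ≤ 1) (v : EuclideanSpace ℂ (Fin n)) :
    δ * ‖v‖ ^ 2 ≤ (inner ℂ v (act (F z) v)).re := by
  have hcl : closure (Metric.ball (0 : ℂ) 1) = Metric.closedBall 0 1 :=
    closure_ball _ one_ne_zero
  have hd : DiffContOnCl ℂ (fun w => Complex.exp (-(inner ℂ v (act (F w) v) : ℂ)))
      (Metric.ball 0 1) := by
    refine ⟨(hF.inner_act v v).neg.cexp, ?_⟩
    rw [hcl]
    intro w hw
    exact (Complex.continuous_exp.tendsto _).comp
      ((tendsto_const_nhds.inner (tendsto_act (hFc w hw).tendsto v)).neg)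
  have hnorm : ∀ w, ‖Complex.exp (-(inner ℂ v (act (F w) v) : ℂ))‖ =
      Real.exp (-(inner ℂ v (act (F w) v) : ℂ).re) := fun w => by
    rw [Complex.norm_exp, Complex.neg_re]
  have hle := Complex.norm_le_of_forall_mem_frontier_norm_le Metric.isBounded_ball hd
    (C := Real.exp (-(δ * ‖v‖ ^ 2))) (fun w hw => ?_)
    (z := z) (by rw [hcl]; exact mem_closedBall_zero_iff.mpr hz)
  · rw [hnorm, Real.exp_le_exp] at hle
    linarith
  · rw [frontier_ball _ one_ne_zero] at hw
    rw [hnorm, Real.exp_le_exp]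
    have := h w (mem_sphere_zero_iff_norm.mp hw) v
    linarith

lemma norm_act_conjTranspose_le {M : Matrix (Fin n) (Fin n) ℂ} {c : ℝ}
    (h : ∀ x, ‖act M x‖ ≤ c * ‖x‖) (x : EuclideanSpace ℂ (Fin n)) : ‖act Mᴴ x‖ ≤ c * ‖x‖ := by
  have h1 : ‖act Mᴴ x‖ * ‖act Mᴴ x‖ ≤ (c * ‖x‖) * ‖act Mᴴ x‖ := by
    calc ‖act Mᴴ x‖ * ‖act Mᴴ x‖ = (inner ℂ (act Mᴴ x) (act Mᴴ x)).re := by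
          rw [inner_self_re_eq, pow_two]
      _ = (inner ℂ x (act M (act Mᴴ x))).re := by
          rw [inner_act_left, conjTranspose_conjTranspose]
      _ ≤ ‖x‖ * ‖act M (act Mᴴ x)‖ := (Complex.re_le_norm _).trans (norm_inner_le_norm _ _)
      _ ≤ ‖x‖ * (c * ‖act Mᴴ x‖) := by gcongr; exact h _
      _ = _ := by ring
  rcases (norm_nonneg (act Mᴴ x)).eq_or_lt with h0 | h0
  · rw [← h0]; exact (norm_nonneg _).trans (h x)
  · exact le_of_mul_le_mul_right h1 h0

/-- Quantitative positivity of `(P + Pᴴ + ε)⁻¹` for an accretive `P` of norm at most `c`. -/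
lemma le_re_inner_inv {P : Matrix (Fin n) (Fin n) ℂ} {ε c : ℝ} (hP : Accretive P) (hε : 0 < ε)
    (hc0 : 0 ≤ c) (hc : ∀ x, ‖act P x‖ ≤ c * ‖x‖) (v : EuclideanSpace ℂ (Fin n)) :
    ε / (2 * c + ε) ^ 2 * ‖v‖ ^ 2 ≤ (inner ℂ v
      (act (P + Pᴴ + (ε : ℂ) • (1 : Matrix (Fin n) (Fin n) ℂ))⁻¹ v)).re := by
  have hΨ := posDef_add_smul_one hP hε
  set Ψ := P + Pᴴ + (ε : ℂ) • (1 : Matrix (Fin n) (Fin n) ℂ) with hΨdef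
  set w := act Ψ⁻¹ v with hw
  have hv : v = act Ψ w := by
    rw [hw, ← mul_act, Matrix.mul_nonsing_inv _ ((Matrix.isUnit_iff_isUnit_det _).mp hΨ.isUnit),
      one_act]
  have h1 : ‖v‖ ≤ (2 * c + ε) * ‖w‖ := by
    rw [hv, hΨdef, add_act, add_act, smul_act, one_act]
    refine (norm_add_le _ _).trans ?_
    have h2 := norm_add_le (act P w) (act Pᴴ w)
    have h3 := hc w
    have h4 := norm_act_conjTranspose_le hc w
    rw [norm_smul, Complex.norm_real, Real.norm_of_nonneg hε.le]
    linarith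
  have h2 : ε * ‖w‖ ^ 2 ≤ (inner ℂ v w).re := by
    have h3 : (inner ℂ v w).re = 2 * (inner ℂ w (act P w)).re + ε * ‖w‖ ^ 2 := by
      rw [hv, inner_re_comm, hΨdef, add_act, add_act, inner_add_right, inner_add_right,
        ← inner_act_left, smul_act, one_act, inner_smul_right, Complex.add_re, Complex.add_re,
        Complex.re_ofReal_mul, inner_re_comm (act P w), inner_self_re_eq]
      ring
    rw [h3]
    linarith [hP w]
  refine le_trans ?_ h2
  have h5 : 0 < 2 * c + ε := by linarith
  rw [div_mul_eq_mul_div, div_le_iff₀ (by positivity), mul_assoc]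
  refine mul_le_mul_of_nonneg_left ?_ hε.le
  rw [← mul_pow, mul_comm ‖w‖]
  exact pow_le_pow_left₀ (norm_nonneg _) h1 2

variable {nP nw nu nz : ℕ} {P : Plant nP nw nu nz}

/-- The function `(P + Pᴴ + ε)⁻¹` on the circle, continued analytically to a neighbourhood by
reflecting `Pᴴ` in the circle. -/
lemma exists_analytic_inverse (hP : P ∈ plantClass nP nw nu nz) {ε τ : ℝ} (hε : 0 < ε)
    (hτ : 0 < τ) : ∃ (U : Set ℂ) (Φ : ℂ → Matrix (Fin nu) (Fin nu) ℂ), IsOpen U ∧ MatDiff Φ U ∧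
      Metric.sphere 0 1 ⊆ U ∧ ∀ z : ℂ, ‖z‖ = 1 → Φ z =
        (P.discTf τ z + (P.discTf τ z)ᴴ + (ε : ℂ) • (1 : Matrix (Fin nu) (Fin nu) ℂ))⁻¹ := by
  set σ : ℂ → ℂ := fun z => (starRingEnd ℂ) z⁻¹ with hσ
  have hσ1 : ∀ z : ℂ, ‖z‖ = 1 → σ z = z := fun z hz => by
    simp only [hσ]
    rw [Complex.inv_eq_conj hz, Complex.conj_conj]
  set U₁ : Set ℂ := P.discDomain τ ∩ ({0}ᶜ ∩ σ ⁻¹' P.discDomain τ) with hU₁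
  have hσc : ContinuousOn σ {0}ᶜ := fun z hz =>
    (Complex.continuous_conj.continuousAt.comp (continuousAt_inv₀ hz)).continuousWithinAt
  have hU₁o : IsOpen U₁ := (isOpen_discDomain P τ).inter
    (hσc.isOpen_inter_preimage isOpen_compl_singleton (isOpen_discDomain P τ))
  set W : ℂ → Matrix (Fin nu) (Fin nu) ℂ := fun z =>
    P.discTf τ z + (P.discTf τ (σ z))ᴴ + (ε : ℂ) • 1 with hW
  have hrefl : MatDiff (fun z => (P.discTf τ (σ z))ᴴ) U₁ := by
    intro i j z hz
    have h1 : DifferentiableAt ℂ (fun w => P.discTf τ w j i) ((starRingEnd ℂ) z⁻¹) :=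
      (matDiff_discTf P τ j i).differentiableAt ((isOpen_discDomain P τ).mem_nhds hz.2.2)
    have h2 := h1.conj_conj
    rw [Complex.conj_conj] at h2
    exact (h2.comp z (differentiableAt_inv hz.2.1)).differentiableWithinAt
  have hWd : MatDiff W U₁ :=
    (((matDiff_discTf P τ).mono Set.inter_subset_left).add hrefl).add (MatDiff.const _)
  have hUo : IsOpen (U₁ ∩ (fun z => (W z).det) ⁻¹' {0}ᶜ) :=
    hWd.det.continuousOn.isOpen_inter_preimage hU₁o isOpen_compl_singleton
  have hWs : ∀ z : ℂ, ‖z‖ = 1 →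
      W z = P.discTf τ z + (P.discTf τ z)ᴴ + (ε : ℂ) • 1 := fun z hz => by
    simp only [hW, hσ1 z hz]
  refine ⟨U₁ ∩ (fun z => (W z).det) ⁻¹' {0}ᶜ, fun z => (W z)⁻¹, hUo,
    (hWd.mono Set.inter_subset_left).inv fun z hz => isUnit_iff_ne_zero.mpr hz.2, fun z hz => ?_,
    fun z hz => congrArg Inv.inv (hWs z hz)⟩
  have hz1 : ‖z‖ = 1 := mem_sphere_zero_iff_norm.mp hz
  have hzD : z ∈ P.discDomain τ := closedBall_subset_discDomain P hP hτ
    (mem_closedBall_zero_iff.mpr hz1.le)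
  have hz0 : z ≠ 0 := by rintro rfl; simp at hz1
  refine ⟨⟨hzD, hz0, ?_⟩, ?_⟩
  · rw [Set.mem_preimage, hσ1 z hz1]; exact hzD
  · have h := posDef_add_smul_one (accretive_discTf P hP hτ hz1.le) hε
    rw [← hWs z hz1] at h
    exact ((Matrix.isUnit_iff_isUnit_det _).mp h.isUnit).ne_zero

/-- The analytic half of `(P + Pᴴ + ε)⁻¹` is a spectral summand. It is invertible because its
Hermitian part stays bounded below inside the disc. -/
theorem exists_isSpectralSummand (hP : P ∈ plantClass nP nw nu nz) {ε τ : ℝ} (hε : 0 < ε)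
    (hτ : 0 < τ) : ∃ F : ℂ → Matrix (Fin nu) (Fin nu) ℂ, IsSpectralSummand P ε τ F := by
  obtain ⟨U, Φ, hUo, hΦ, hU, hΦs⟩ := exists_analytic_inverse hP hε hτ
  have hacc : ∀ z : ℂ, ‖z‖ = 1 → Accretive (P.discTf τ z) := fun z hz =>
    accretive_discTf P hP hτ hz.le
  obtain ⟨F, hFd, hFc, hFs⟩ := exists_add_conjTranspose_eq hUo hΦ hU fun z hz => by
    rw [hΦs z hz]; exact (posDef_add_smul_one (hacc z hz) hε).inv.isHermitian
  obtain ⟨c, hc0, hc⟩ := exists_bound_discTf P hP hτ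
  set δ := ε / (2 * c + ε) ^ 2 / 2 with hδ
  have hδ0 : 0 < δ := by positivity
  have hlow : ∀ z : ℂ, ‖z‖ ≤ 1 → ∀ v, δ * ‖v‖ ^ 2 ≤ (inner ℂ v (act (F z) v)).re := by
    intro z hz v
    refine le_re_inner_of_sphere hFd hFc (fun w hw x => ?_) hz v
    have h1 := le_re_inner_inv (hacc w hw) hε hc0 (hc w hw.le) x
    rw [← hΦs w hw, ← hFs w hw, add_act, inner_add_right, ← inner_act_left, Complex.add_re,
      inner_re_comm (act (F w) x)] at h1
    rw [hδ]
    linarith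
  have hlow' : ∀ z : ℂ, ‖z‖ ≤ 1 → ∀ v, δ * ‖v‖ ≤ ‖act (F z) v‖ := by
    intro z hz v
    have h1 := (hlow z hz v).trans ((Complex.re_le_norm _).trans (norm_inner_le_norm _ _))
    rcases (norm_nonneg v).eq_or_lt with h0 | h0
    · rw [← h0, mul_zero]; exact norm_nonneg _
    · refine le_of_mul_le_mul_left ?_ h0
      linarith
  have hunit : ∀ z : ℂ, ‖z‖ ≤ 1 → IsUnit (F z).det := fun z hz =>
    isUnit_det_of_act fun x hx => by
      have h1 := hlow' z hz x
      rw [hx, norm_zero] at h1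
      exact norm_le_zero_iff.mp (nonpos_of_mul_nonpos_right h1 hδ0)
  have hinv : Set.MapsTo (fun q : ℂ => q⁻¹) {q : ℂ | 1 < ‖q‖} (Metric.ball 0 1) := fun q hq =>
    mem_ball_zero_iff.mpr (inv_norm_lt_one hq)
  have hinvd : DifferentiableOn ℂ (fun q : ℂ => q⁻¹) {q : ℂ | 1 < ‖q‖} :=
    DifferentiableOn.inv differentiableOn_id fun q hq => ne_zero_of_norm hq
  have hGd : MatDiff (fun q => F q⁻¹) {q : ℂ | 1 < ‖q‖} := hFd.comp hinvd hinv
  have hun : ∀ q : ℂ, 1 < ‖q‖ → IsUnit (F q⁻¹).det := fun q hq =>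
    hunit _ (inv_norm_lt_one hq).le
  refine ⟨fun q => F q⁻¹, ?_, hun, ?_, ?_⟩
  · obtain ⟨C, hC⟩ := (isCompact_closedBall (0 : ℂ) 1).exists_bound_of_continuousOn hFc
    refine hInf_of_act_bound hGd (c := C) fun q hq x => ?_
    have h2 : ‖act (F q⁻¹) x‖ ≤ ‖F q⁻¹‖ * ‖x‖ := Matrix.l2_opNorm_mulVec (F q⁻¹) x
    refine h2.trans (mul_le_mul_of_nonneg_right (hC _ ?_) (norm_nonneg _))
    exact Metric.ball_subset_closedBall (hinv hq)
  · refine hInf_of_act_bound (hGd.inv hun) (c := δ⁻¹) fun q hq x => ?_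
    have h1 := hlow' q⁻¹ (inv_norm_lt_one hq).le (act (F q⁻¹)⁻¹ x)
    rw [← mul_act, Matrix.mul_nonsing_inv _ (hun q hq), one_act] at h1
    rw [inv_mul_eq_div, le_div_iff₀ hδ0]
    linarith
  · filter_upwards [ae_bilinear_eq_bdryTf hP hτ] with Ω hΩ
    refine ⟨_, hasBoundaryValue_of_continuousOn hFc Ω, ?_⟩
    rw [hΩ, Plant.bdryTf, ← hΦs _ (norm_inv_exp Ω), ← hFs _ (norm_inv_exp Ω), add_comm]

end Spectral

/-! ### Convexity -/

section Convexity

variable {n : ℕ}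

/-- The constraint is a linear matrix inequality in `Q`. -/
lemma convex_youlaConstraint (F : ℂ → Matrix (Fin n) (Fin n) ℂ) :
    Convex ℝ {Q : ℂ → Matrix (Fin n) (Fin n) ℂ | HInf Q ∧ YoulaConstraint Q F} := by
  rintro Q₁ ⟨⟨hd₁, c₁, hc₁⟩, h₁⟩ Q₂ ⟨⟨hd₂, c₂, hc₂⟩, h₂⟩ a b ha hb hab
  refine ⟨⟨fun i j => ?_, a * c₁ + b * c₂, fun q hq i j => ?_⟩, ?_⟩
  · exact ((hd₁ i j).const_smul a).add ((hd₂ i j).const_smul b)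
  · refine (norm_add_le _ _).trans ?_
    simp only [Pi.smul_apply, Matrix.smul_apply, norm_smul, Real.norm_of_nonneg ha,
      Real.norm_of_nonneg hb]
    have := hc₁ q hq i j
    have := hc₂ q hq i j
    gcongr
  · filter_upwards [h₁, h₂] with Ω ⟨M₁, hM₁, hp₁⟩ ⟨M₂, hM₂, hp₂⟩
    refine ⟨a • M₁ + b • M₂, ?_, ?_⟩
    · have h := (Tendsto.const_smul hM₁ a).add (Tendsto.const_smul hM₂ b)
      refine h.congr fun r => ?_
      simp only [blockU, Matrix.fromBlocks_smul, Matrix.fromBlocks_add, smul_zero, add_zero,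
        ← add_smul, hab, one_smul]
      rfl
    · have h := (hp₁.smul ha).add (hp₂.smul hb)
      rw [conjTranspose_add, conjTranspose_smul, conjTranspose_smul, star_trivial, star_trivial,
        add_add_add_comm, ← smul_add, ← smul_add]
      exact h

end Convexity

end PassiveYoula

end Development

open PassiveYoula

theorem mainTheorem1 {nP nw nu nz : ℕ} (P : Plant nP nw nu nz)
    (hP : P ∈ plantClass nP nw nu nz) (ε τ : ℝ) (hε : 0 < ε) (hτ : 0 < τ) :
    (∃ F : ℂ → Matrix (Fin nu) (Fin nu) ℂ, IsSpectralSummand P ε τ F) ∧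
    ∀ F : ℂ → Matrix (Fin nu) (Fin nu) ℂ, IsSpectralSummand P ε τ F →
      (∀ (σ₀ : ℝ) (K : ℂ → Matrix (Fin nu) (Fin nu) ℂ), 0 ≤ σ₀ → AnalyticOnHalfPlane σ₀ K →
        ((∃ S ∈ ospClass nu ε, S.HasTransferFunction σ₀ K) ↔
          ∃ Q : ℂ → Matrix (Fin nu) (Fin nu) ℂ,
            IsYoulaParameter P τ σ₀ K Q ∧ HInf Q ∧ YoulaConstraint Q F)) ∧
      Convex ℝ {Q : ℂ → Matrix (Fin nu) (Fin nu) ℂ | HInf Q ∧ YoulaConstraint Q F} := by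
  refine ⟨exists_isSpectralSummand hP hε hτ, fun F hF => ⟨fun σ₀ K hσ hK => ⟨?_, ?_⟩,
    convex_youlaConstraint F⟩⟩
  · rintro ⟨S, hS, hSK⟩
    exact exists_youlaParameter hP hε hτ hF hσ hS hSK
  · rintro ⟨Q, hQ, hQi, hQc⟩
    exact exists_mem_ospClass hP hε hτ hF hσ hK hQ hQi hQc
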